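/- **Theorem 3.2 (SSA of Platonic solids is a Coxeter group).** A disk of $\widehat{\mathbb R}^2=\mathbb R^2\cup\{\infty\}$ is a closed disk, the closure of the complement of one (signed curvature $\kappa<0$), or a closed half-plane; its Lorentzian vector is $\mathbf x_b=\frac{\kappa}{2}(2c,\|c\|^2-\kappa^{-2}-1,\|c\|^2-\kappa^{-2}+1)$ for centre $c$ and curvature $\kappa\neq0$, and $\mathbf x_b=(n,\delta,\delta)$ for the half-plane $\{x : n\cdot x\ge\delta\}$, $\|n\|=1$. The Möbius group $\mathsf{M\ddot ob}(\widehat{\mathbb R}^2)$ is generated by the inversions $s_b$ in disks $b$. For a point $u\in\mathbb R^3$ with $\|u\|>1$, let $b(u)$ be the disk obtained from the cap $\{s\in\mathbb S^2: s\cdot u\ge1\}$ by stereographic projection from the north pole, and for a polyhedron $P$ whose vertices have norm $>1$ let $\mathsf B(P)=\{b(u): u \text{ a vertex of } P\}$. Let $P\subset\mathbb R^3$ be a convex polyhedron all of whose edges are tangent to the unit sphere, combinatorially equivalent to the Platonic solid with Schläfli symbol $\{p,q\}$ (faces are $p$-gons, $q$ of them at each vertex), and let $\mathcal B$ be a polytopal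 disk packing with tangency polytope $P$, i.e. a collection of disks with $\mu(\mathcal B)=\mathsf B(P)$ for some Möbius transformation $\mu$. The dual of $\mathcal B$ is $\mathcal B^*=\mu_0^{-1}(\mathsf B(P_0^*))$, where $\mu_0$ is a Möbius transformation with $\mu_0(\mathcal B)=\mathsf B(P_0)$ for a polyhedron $P_0$ with all edges tangent to the unit sphere and the origin in its interior, and $P_0^*$ is the polar of $P_0$ (the result does not depend on the choices). Let $\mathsf A(\mathcal B)$ be the group generated by the inversions in the disks of $\mathcal B^*$, $\mathsf{Sym}(\mathcal B)$ the group of Möbius transformations preserving $\mathcal B$, and $$\mathsf{SSA}(\mathcal B)=\langle \mathsf A(\mathcal B^*)\cup\mathsf{Sym}(\mathcal B)\cup\mathsf A(\mathcal B)\rangle .$$ There is a faithful representation $\rho$ of $\mathsf{M\ddot ob}(\widehat{\mathbb R}^2)$ in $O^\uparrow_{3,1}(\mathbb R)=\{M: M^T\mathbf QM=\mathbf Q,\ M_{44}>0\}$, $\mathbf Q=\mathrm{diag}(1,1,1,-1)$, with $\rho(s_b)=\mathbf I-2\mathbf x_b\mathbf x_b^T\mathbf Q$ for every disk $b$, and $\mathsf{SSA}(\mathcal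 B)$ is a hyperbolic Coxeter group with linear Coxeter diagram $\infty-p-q-\infty$: its image under $\rho$ is discrete, and for some Möbius transformation $\nu$ the group $\rho(\nu\,\mathsf{SSA}(\mathcal B)\,\nu^{-1})$ is generated by the five matrices $$\mathbf S=\begin{pmatrix}-1&0&0&0\\0&1&0&0\\0&0&1&0\\0&0&0&1\end{pmatrix},\quad \mathbf S^*=\begin{pmatrix}1&0&0&0\\0&-1&-2&2\\0&-2&-1&2\\0&-2&-2&3\end{pmatrix},\quad \mathbf V=\begin{pmatrix}1&0&0&0\\0&-1&0&0\\0&0&1&0\\0&0&0&1\end{pmatrix},\quad \mathbf E=\begin{pmatrix}1&0&0&0\\0&\frac12&1&-\frac12\\0&1&-1&1\\0&\frac12&-1&\frac32\end{pmatrix},$$ $$\mathbf F_m=\begin{pmatrix}-1&0&4\cos\frac\pi m&-4\cos\frac\pi m\\0&1&0&0\\4\cos\frac\pi m&0&1-8\cos^2\frac\pi m&8\cos^2\frac\pi m\\4\cos\frac\pi m&0&-8\cos^2\frac\pi m&1+8\cos^2\frac\pi m\end{pmatrix},\qquad m=\max(p,q),$$ which correspond to the Coxeter generators along the diagram $\infty-p-q-\infty$,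 in the order $\mathbf S^*,\mathbf V,\mathbf E,\mathbf F_q,\mathbf S$ if $p=3$, and $\mathbf S,\mathbf F_p,\mathbf E,\mathbf V,\mathbf S^*$ if $p>3$ (then $q=3$). -/

import Mathlib

noncomputable section

namespace PlatonicPacking

/-- The Euclidean plane. -/
abbrev E2 := EuclideanSpace ℝ (Fin 2)

/-- Euclidean 3-space. -/
abbrev E3 := EuclideanSpace ℝ (Fin 3)

/-- The extended plane `ℝ² ∪ {∞}`. -/
abbrev Rhat := OnePoint E2

/-- Real `4 × 4` matrices. -/
abbrev Mat4 := Matrix (Fin 4) (Fin 4) ℝ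

/-! ### Disks of the extended plane, inversions and the Möbius group -/

/-- The (closed, oriented) disks of the extended plane. `round c κ` has centre `c` and signed
curvature `κ ≠ 0`; it is bounded if `κ > 0` and contains `∞` if `κ < 0`. `half n δ` is the
half-plane with unit normal `n` pointing to the interior and signed distance `δ` to the origin. -/
inductive Disk : Type
  | round (c : E2) (κ : ℝ) (hκ : κ ≠ 0) : Disk
  | half (n : E2) (δ : ℝ) (hn : ‖n‖ = 1) : Disk

/-- The underlying subset of the extended plane. -/
def Disk.carrier : Disk → Set Rhat
  | .round c κ _ =>
      if 0 < κ then (fun x : E2 => (x : Rhat)) '' Metric.closedBall c κ⁻¹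
      else ((fun x : E2 => (x : Rhat)) '' Metric.ball c (-κ⁻¹))ᶜ
  | .half n δ _ => insert OnePoint.infty ((fun x : E2 => (x : Rhat)) '' {x | δ ≤ inner ℝ n x})

/-- The inversive coordinates (the Lorentzian vector) of a disk. -/
def Disk.vec : Disk → Fin 4 → ℝ
  | .round c κ _ =>
      ![κ * c 0, κ * c 1, κ / 2 * (‖c‖ ^ 2 - (κ ^ 2)⁻¹ - 1), κ / 2 * (‖c‖ ^ 2 - (κ ^ 2)⁻¹ + 1)]
  | .half n δ _ => ![n 0, n 1, δ, δ]

open Classical in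
/-- The inversion of the extended plane in the circle of centre `c` and radius `|r|`. -/
def circleInv (c : E2) (r : ℝ) : Rhat → Rhat
  | none => (c : Rhat)
  | some x => if x = c then OnePoint.infty else ((EuclideanGeometry.inversion c r x : E2) : Rhat)

/-- The reflection of the extended plane in the line `⟨n, x⟩ = δ`, for a unit vector `n`. -/
def lineRefl (n : E2) (δ : ℝ) : Rhat → Rhat :=
  OnePoint.map (fun x : E2 => x - (2 * (inner ℝ n x - δ)) • n)

theorem circleInv_involutive (c : E2) {r : ℝ} (hr : r ≠ 0) :
    Function.Involutive (circleInv c r) := by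
  have h0 : circleInv c r OnePoint.infty = (c : Rhat) := rfl
  have h1 : ∀ x : E2, circleInv c r (x : Rhat) =
      if x = c then OnePoint.infty else ((EuclideanGeometry.inversion c r x : E2) : Rhat) :=
    fun x => by
      rw [show circleInv c r (x : Rhat) = circleInv c r (some x) from rfl, circleInv]
  intro X
  induction X using OnePoint.rec with
  | infty => rw [h0, h1, if_pos rfl]
  | coe x =>
    by_cases h : x = c
    · rw [h1, if_pos h, h0, h]
    · have h2 : EuclideanGeometry.inversion c r x ≠ c := by
        rw [Ne, EuclideanGeometry.inversion_eq_center hr]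
        exact h
      rw [h1, if_neg h, h1, if_neg h2, EuclideanGeometry.inversion_inversion c hr]

theorem lineRefl_involutive {n : E2} (δ : ℝ) (hn : ‖n‖ = 1) :
    Function.Involutive (lineRefl n δ) := by
  intro X
  induction X using OnePoint.rec with
  | infty => simp [lineRefl]
  | coe x =>
    simp only [lineRefl, OnePoint.map_some]
    congr 1
    have h1 : inner ℝ n n = (1 : ℝ) := by rw [real_inner_self_eq_norm_sq, hn]; norm_num
    rw [inner_sub_right, inner_smul_right, h1, sub_sub, ← add_smul]
    have h0 : (2 * (inner ℝ n x - δ) + 2 * (inner ℝ n x - 2 * (inner ℝ n x - δ) * 1 - δ)) = 0 := by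
      ring
    rw [h0, zero_smul, sub_zero]

/-- The inversion in (the boundary of) a disk, as a permutation of the extended plane. -/
def Disk.invPerm : Disk → Equiv.Perm Rhat
  | .round c _ hκ => (circleInv_involutive c (inv_ne_zero hκ)).toPerm
  | .half _ δ hn => (lineRefl_involutive δ hn).toPerm

/-- The Möbius group: the group generated by all inversions. -/
def mobGroup : Subgroup (Equiv.Perm Rhat) := Subgroup.closure (Set.range Disk.invPerm)

/-- Möbius transformations. -/
abbrev Mob : Type := mobGroup

/-- The inversion in a disk, as a Möbius transformation. -/
def Disk.inv (D : Disk) : Mob := ⟨D.invPerm, Subgroup.subset_closure ⟨D, rfl⟩⟩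

/-- The image of a collection of subsets of the extended plane under a Möbius transformation. -/
def act (μ : Mob) (𝓑 : Set (Set Rhat)) : Set (Set Rhat) :=
  (fun b => (μ : Equiv.Perm Rhat) '' b) '' 𝓑

/-! ### The Lorentz group and the matrices of inversions -/

/-- The matrix of the Lorentzian product. -/
def Q : Mat4 := Matrix.diagonal ![1, 1, 1, -1]

/-- The orthochronous Lorentz group, as a set of matrices. -/
def lorentz : Set Mat4 := {A | A.transpose * Q * A = Q ∧ 0 < A 3 3}

/-- The Lorentz reflection `I - 2 x xᵀ Q`. -/
def reflMat (x : Fin 4 → ℝ) : Mat4 := 1 - (2 : ℝ) • (Matrix.vecMulVec x x * Q)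

/-! ### Polyhedra -/

/-- A convex polyhedron: the convex hull of finitely many points of 3-space, of dimension 3. -/
def IsPolyhedron (P : Set E3) : Prop :=
  (∃ V : Set E3, V.Finite ∧ P = convexHull ℝ V) ∧ (interior P).Nonempty

/-- The face lattice, ordered by inclusion; `∅` and `P` are faces. -/
abbrev Faces (P : Set E3) : Type := {F : Set E3 // IsExposed ℝ P F}

/-- Combinatorial equivalence: the face lattices are isomorphic. -/
def CombEquiv (P P' : Set E3) : Prop := Nonempty (Faces P ≃o Faces P')

/-- The edges, i.e. the one-dimensional faces. -/
def IsEdge (P F : Set E3) : Prop :=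
  IsExposed ℝ P F ∧ F.Nonempty ∧ Module.finrank ℝ (vectorSpan ℝ F) = 1

/-- Every edge is tangent to the unit sphere, at a point `t` of the edge. -/
def EdgeScribed (P : Set E3) : Prop :=
  ∀ F, IsEdge P F → ∃ t ∈ F, ‖t‖ = 1 ∧ ∀ x ∈ F, inner ℝ t x = (1 : ℝ)

/-- The polar of a set. -/
def polarSet (X : Set E3) : Set E3 := {u | ∀ v ∈ X, inner ℝ u v ≤ (1 : ℝ)}

/-! ### The five Platonic solids -/

/-- The names of the Platonic solids. -/
inductive Solid : Type
  | tetrahedron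
  | octahedron
  | cube
  | icosahedron
  | dodecahedron

/-- First entry of the Schläfli symbol: the faces are `p`-gons. -/
def Solid.p : Solid → ℕ
  | .tetrahedron => 3
  | .octahedron => 3
  | .cube => 4
  | .icosahedron => 3
  | .dodecahedron => 5

/-- Second entry of the Schläfli symbol: `q` faces meet at each vertex. -/
def Solid.q : Solid → ℕ
  | .tetrahedron => 3
  | .octahedron => 4
  | .cube => 3
  | .icosahedron => 5
  | .dodecahedron => 3

/-- The usual Cartesian coordinates of the vertices of the Platonic solids:
alternate vertices of the cube; the points `± eᵢ`; the points `(±1, ±1, ±1)`; the cyclic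
permutations of `(0, ±1, ±φ)`; the points `(±1, ±1, ±1)` together with the cyclic permutations
of `(0, ±φ⁻¹, ±φ)`. -/
def Solid.vertices : Solid → Set E3
  | .tetrahedron => {x | (∀ i, x i = 1 ∨ x i = -1) ∧ x 0 * x 1 * x 2 = 1}
  | .octahedron => {x | ∃ i, (x i = 1 ∨ x i = -1) ∧ ∀ j, j ≠ i → x j = 0}
  | .cube => {x | ∀ i, x i = 1 ∨ x i = -1}
  | .icosahedron =>
      {x | ∃ i : Fin 3, x i = 0 ∧ (x (i + 1) = 1 ∨ x (i + 1) = -1) ∧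
        (x (i + 2) = Real.goldenRatio ∨ x (i + 2) = -Real.goldenRatio)}
  | .dodecahedron =>
      {x | ∀ i, x i = 1 ∨ x i = -1} ∪
      {x | ∃ i : Fin 3, x i = 0 ∧
        (x (i + 1) = Real.goldenRatio⁻¹ ∨ x (i + 1) = -Real.goldenRatio⁻¹) ∧
        (x (i + 2) = Real.goldenRatio ∨ x (i + 2) = -Real.goldenRatio)}

/-- The Platonic solid itself, as a regular convex polyhedron. -/
def Solid.body (T : Solid) : Set E3 := convexHull ℝ T.vertices

/-! ### Polytopal disk packings -/

/-- The inverse of the stereographic projection of the unit sphere from the north pole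
`(0, 0, 1)`. -/
def stereoInv : Rhat → E3
  | none => !₂[0, 0, 1]
  | some x =>
      !₂[2 * x 0 / (‖x‖ ^ 2 + 1), 2 * x 1 / (‖x‖ ^ 2 + 1), (‖x‖ ^ 2 - 1) / (‖x‖ ^ 2 + 1)]

/-- The illuminated region of the light source `u`: the stereographic projection of the cap of
the unit sphere that is seen from `u`. -/
def illum (u : E3) : Set Rhat := {X | 1 ≤ inner ℝ (stereoInv X) u}

/-- The ball arrangement projection: the disks whose light sources are the vertices of `P`. -/
def ballProj (P : Set E3) : Set (Set Rhat) := illum '' (P.extremePoints ℝ)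

/-- `𝓑` is a polytopal disk packing with tangency polytope the edge-scribed polyhedron `P`. -/
def IsPolytopalPacking (𝓑 : Set (Set Rhat)) (P : Set E3) : Prop :=
  IsPolyhedron P ∧ EdgeScribed P ∧ ∃ μ : Mob, act μ 𝓑 = ballProj P

/-- The dual of a polytopal disk packing: if a Möbius transformation `μ` maps `𝓑` onto the ball
arrangement projection of an edge-scribed polyhedron `P₀` with the origin in its interior, then
the disks of the dual are the images under `μ⁻¹` of the illuminated regions of the vertices of the
polar of `P₀`. (The result is the same for every such `μ` and `P₀`.) -/
def dual (𝓑 : Set (Set Rhat)) : Set (Set Rhat) :=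
  {b | ∃ (μ : Mob) (P₀ : Set E3), IsPolyhedron P₀ ∧ EdgeScribed P₀ ∧ (0 : E3) ∈ interior P₀ ∧
    act μ 𝓑 = ballProj P₀ ∧ b ∈ act μ⁻¹ (ballProj (polarSet P₀))}

/-! ### The Apollonian groups -/

/-- The inversions in the disks of `𝓑`. -/
def inversions (𝓑 : Set (Set Rhat)) : Set Mob := {s | ∃ D : Disk, D.carrier ∈ 𝓑 ∧ s = D.inv}

/-- The symmetric group of `𝓑`. -/
def symGroup (𝓑 : Set (Set Rhat)) : Subgroup Mob := Subgroup.closure {μ | act μ 𝓑 = 𝓑}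

/-- The Apollonian group of `𝓑`, generated by the inversions in the disks of the dual. -/
def apollonian (𝓑 : Set (Set Rhat)) : Subgroup Mob := Subgroup.closure (inversions (dual 𝓑))

/-- The super symmetrized Apollonian group of `𝓑`. -/
def superSym (𝓑 : Set (Set Rhat)) : Subgroup Mob :=
  Subgroup.closure
    ((apollonian (dual 𝓑) : Set Mob) ∪ (symGroup 𝓑 : Set Mob) ∪ (apollonian 𝓑 : Set Mob))

/-! ### The Coxeter diagram and the five matrices -/

/-- The Coxeter matrix with linear diagram `∞ – p – q – ∞` (the entry `0` stands for `∞`). -/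
def Solid.coxeterMatrix (T : Solid) : CoxeterMatrix (Fin 5) where
  M := !![1, 0, 2, 2, 2;
          0, 1, T.p, 2, 2;
          2, T.p, 1, T.q, 2;
          2, 2, T.q, 1, 0;
          2, 2, 2, 0, 1]
  isSymm := by
    ext i j
    fin_cases i <;> fin_cases j <;> rfl
  diagonal i := by fin_cases i <;> rfl
  off_diagonal i j h := by
    cases T <;> fin_cases i <;> fin_cases j <;> simp [Solid.p, Solid.q] at h ⊢

def matS : Mat4 :=
  !![-1, 0, 0, 0;
      0, 1, 0, 0;
      0, 0, 1, 0;
      0, 0, 0, 1]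

def matSstar : Mat4 :=
  !![1,  0,  0, 0;
     0, -1, -2, 2;
     0, -2, -1, 2;
     0, -2, -2, 3]

def matV : Mat4 :=
  !![1,  0, 0, 0;
     0, -1, 0, 0;
     0,  0, 1, 0;
     0,  0, 0, 1]

def matE : Mat4 :=
  !![1, 0,    0, 0;
     0, 1/2,  1, -1/2;
     0, 1,   -1, 1;
     0, 1/2, -1, 3/2]

open Real in
def matF (m : ℕ) : Mat4 :=
  !![-1, 0, 4 * cos (π / m), -4 * cos (π / m);
      0, 1, 0, 0;
      4 * cos (π / m), 0, 1 - 8 * cos (π / m) ^ 2, 8 * cos (π / m) ^ 2;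
      4 * cos (π / m), 0, -8 * cos (π / m) ^ 2, 1 + 8 * cos (π / m) ^ 2]

/-- The five matrices, listed along the diagram `∞ – p – q – ∞`. -/
def Solid.gens (T : Solid) : Fin 5 → Mat4 :=
  if T.p = 3 then ![matSstar, matV, matE, matF T.q, matS]
  else ![matS, matF T.p, matE, matV, matSstar]

end PlatonicPacking

end

/-! Points of the extended plane are the null rays of Lorentzian 4-space. A disk consists of the
null rays on one side of its vector, and the inversion in it is induced by the Lorentz reflection in
that vector (`carrier_eq`, `reflMat_nullVec`). Hence each Möbius transformation is induced by a
form-preserving matrix, unique because a few null rays determine it (`Represents.unique`); this is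
`rho`. Products of reflections exhaust the orthochronous group (`exists_rho_eq`), so every Lorentz
equivalence found below is a Möbius transformation.

The polyhedron is only combinatorially Platonic, so a rigidity theorem is needed. An edge-scribed
polyhedron gives a family of unit spacelike vectors indexed by flags: the cap of the vertex and the
plane of the facet (`Chain.exists_family`). Two families of the same Platonic type differ by a
Lorentz transformation (`IsFamily.exists_lorentz`). Exchanging vertices and facets (`IsFamily.dual`)
reduces this to triangular facets. There the Gram matrix of a facet is fixed, and the position of
the next facet depends on one positive number per edge, `IsFamily.sep`. If three triangles meet at
each vertex this number is 1. Otherwise Ptolemy's relation for consecutive tangency points on the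
circle of a vertex (`IsFamily.sep_mul`) yields equations: four triangles give √2, while five give at
each vertex the pentagon relations ab = 1 + d, whose constant positive solution is the golden ratio.
These have non-constant local solutions too, excluded globally by double counting corners at which
two edges lie on the same side of the golden ratio (`IsFamily.sep_of_five`).

It remains to treat a regular model (`Chain`): a finite reflection group with a chamber whose
extremal rays carry a vertex v, an edge midpoint t on the sphere and a facet centre f. The polar of
the hull of the orbit of v is the hull of the orbit of f, and a Lorentz transformation carries the
cone over a polar to the cone over a polar, so the dual packing is the orbit of caps at f
(`Chain.polarSet_eq`, `ballProj_polarSet_subset`). The symmetries of the packing are generated by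
the three mirrors, and the inversions in each packing are conjugate to a single one; thus five
reflections generate the whole group (`Chain.superSym_eq`). Their Gram matrix is that of the diagram
with -1 on the two infinite edges, so a Lorentz transformation carries them to the explicit roots
(`Chain.exists_rho_mirrors`).

The Coxeter presentation comes from Tits' positivity theorem (`pos_of_ascent`). An element taking
one interior point of the fundamental chamber into the open chamber is trivial
(`eq_one_of_chamber`), which gives both faithfulness of the abstract Coxeter group and discreteness
of the image. Applied to the diagram p – q, the same theorem supplies the fundamental-domain
property of the regular model. -/

noncomputable section

namespace PlatonicPacking

open scoped Matrix
open scoped RealInnerProductSpace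

/-! ### Reflections and the positivity theorem for root chains -/

section Reflections

variable {V : Type*} [AddCommGroup V] [Module ℝ V]

/-- The reflection in a vector `a` of norm one with respect to a bilinear form. -/
def formRefl (φ : LinearMap.BilinForm ℝ V) (a : V) : Module.End ℝ V :=
  Module.preReflection a (2 • φ a)

theorem formRefl_apply (φ : LinearMap.BilinForm ℝ V) (a x : V) :
    formRefl φ a x = x - (2 * φ a x) • a := by
  simp [formRefl, Module.preReflection_apply]

theorem formRefl_mul_self (φ : LinearMap.BilinForm ℝ V) {a : V} (ha : φ a a = 1) :
    formRefl φ a * formRefl φ a = 1 := by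
  ext x
  simp only [Module.End.mul_apply, formRefl_apply, map_sub, map_smul, ha, smul_eq_mul,
    Module.End.one_apply]
  module

theorem formRefl_mul_pow_two (φ : LinearMap.BilinForm ℝ V) {a b : V} (ha : φ a a = 1)
    (hb : φ b b = 1) (hab : φ a b = 0) (hba : φ b a = 0) :
    (formRefl φ a * formRefl φ b) ^ 2 = 1 := by
  have h : formRefl φ a * formRefl φ b = formRefl φ b * formRefl φ a := by
    ext x
    simp [formRefl_apply, hab, hba]
    abel
  rw [pow_two]
  nth_rewrite 2 [h]
  rw [mul_assoc, ← mul_assoc (formRefl φ b), formRefl_mul_self φ hb, one_mul,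
    formRefl_mul_self φ ha]

-- Powers of a product of two reflections are given by Chebyshev polynomials evaluated at 4cos²(π/m)
-- - 2 = 2cos(2π/m). Only m up to 5 occurs, so the required vanishing is checked value by value.
open Polynomial.Chebyshev in
theorem formRefl_mul_pow (φ : LinearMap.BilinForm ℝ V) {a b : V} (ha : φ a a = 1)
    (hb : φ b b = 1) (hab : φ b a = φ a b) {m : ℕ} (hm : 2 ≤ m) (hm' : m ≤ 5)
    (hc : φ a b = -Real.cos (Real.pi / m)) :
    (formRefl φ a * formRefl φ b) ^ m = 1 := by
  have h2 : m = 2 → (formRefl φ a * formRefl φ b) ^ m = 1 := by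
    rintro rfl
    have : φ a b = 0 := by rw [hc]; simp
    exact formRefl_mul_pow_two φ ha hb this (hab.trans this)
  rcases hm.eq_or_lt with h | hm3
  · exact h2 h.symm
  have ha' : (2 • φ a) a = 2 := by simp [ha]
  have hb' : (2 • φ b) b = 2 := by simp [hb]
  have key := Module.reflection_mul_reflection_pow (f := 2 • φ a) (x := a) (g := 2 • φ b) (y := b)
    ha' hb' m
  have e : ((Module.reflection ha' * Module.reflection hb') ^ m).toLinearMap =
      (formRefl φ a * formRefl φ b) ^ m := by
    have h1 : ∀ k : ℕ, ((Module.reflection ha' * Module.reflection hb') ^ k).toLinearMap =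
      (formRefl φ a * formRefl φ b) ^ k := by
      intro k
      induction k with
      | zero => rfl
      | succ k ih =>
        rw [pow_succ, pow_succ, ← ih]
        rfl
    exact h1 m
  rw [← e, key]
  have ht : ((2 • φ a) b * (2 • φ b) a - 2 : ℝ) = 4 * Real.cos (Real.pi / m) ^ 2 - 2 := by
    simp [hab, hc]; ring
  rw [ht]
  interval_cases m
  · norm_num [Real.cos_pi_div_three]
    rfl
  · have : Real.cos (Real.pi / (4 : ℕ)) ^ 2 = 1 / 2 := by
      norm_num [Real.cos_pi_div_four, div_pow]
    rw [this]
    norm_num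
    rfl
  · have : (4 * Real.cos (Real.pi / (5 : ℕ)) ^ 2 - 2) = (Real.sqrt 5 - 1) / 2 := by
      have h5 : Real.sqrt 5 ^ 2 = 5 := Real.sq_sqrt (by norm_num)
      push_cast
      rw [Real.cos_pi_div_five]
      nlinarith
    rw [this]
    have h5 : Real.sqrt 5 * Real.sqrt 5 = 5 := Real.mul_self_sqrt (by norm_num)
    have e0 : (((5 : ℕ) : ℤ) - 2) / 2 = 1 := by norm_num
    have e1 : (((5 : ℕ) : ℤ) - 1) / 2 = 2 := by norm_num
    have e2 : (((5 : ℕ) : ℤ) - 3) / 2 = 1 := by norm_num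
    have e3 : (((5 : ℕ) : ℤ)) / 2 = 2 := by norm_num
    -- S₂ + S₁ = X² + X - 1, and (√5 - 1)/2 = 2cos(2π/5) is one of its roots.
    have e4 : (((Polynomial.Chebyshev.S ℝ 2).eval ((Real.sqrt 5 - 1) / 2) +
      (Polynomial.Chebyshev.S ℝ 1).eval ((Real.sqrt 5 - 1) / 2)) : ℝ) = 0 := by
      simp [S_two]
      nlinarith
    rw [e0, e1, e2, e3, e4]
    simp
    rfl

end Reflections

/-! ### Tits' positivity theorem and its consequences for chambers -/

section Tits

variable {B : Type*} {M : CoxeterMatrix B} {W : Type*} [Group W] (cs : CoxeterSystem M W)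
variable {V : Type*} [AddCommGroup V] [Module ℝ V]

/-- A family of vectors realising the Coxeter matrix `M` as a matrix of inner products. -/
structure RootFamily (M : CoxeterMatrix B) (φ : LinearMap.BilinForm ℝ V) (α : B → V) : Prop where
  symm : ∀ x y, φ x y = φ y x
  unit : ∀ i, φ (α i) (α i) = 1
  finite : ∀ i j, i ≠ j → M i j ≠ 0 → φ (α i) (α j) = -Real.cos (Real.pi / M i j)
  infinite : ∀ i j, M i j = 0 → φ (α i) (α j) ≤ -1

/-- Membership in the bidual of the cone spanned by the simple roots. -/
def Pos (φ : LinearMap.BilinForm ℝ V) (α : B → V) (x : V) : Prop :=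
  ∀ p, (∀ j, 0 ≤ φ p (α j)) → 0 ≤ φ p x

theorem Pos.comb {φ : LinearMap.BilinForm ℝ V} {α : B → V} {x y : V} (hx : Pos φ α x)
    (hy : Pos φ α y) {a b : ℝ} (ha : 0 ≤ a) (hb : 0 ≤ b) : Pos φ α (a • x + b • y) := by
  intro p hp
  have := hx p hp
  have := hy p hp
  simp only [map_add, map_smul, smul_eq_mul]
  positivity

/-- The coefficients of the roots of a dihedral group. -/
def dihCoeff (c : ℝ) : ℕ → ℝ
  | 0 => 0
  | 1 => 1
  | n + 2 => 2 * c * dihCoeff c (n + 1) - dihCoeff c n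

/-- The recurrence is that of sin(kθ), so the coefficients are Chebyshev polynomials of the second
kind. Nonnegativity for k ≤ m then follows from kπ/m ≤ π. -/
theorem dihCoeff_cos (θ : ℝ) (k : ℕ) :
    dihCoeff (Real.cos θ) k * Real.sin θ = Real.sin (k * θ) := by
  induction k using Nat.strong_induction_on with
  | _ k ih =>
    match k with
    | 0 => simp [dihCoeff]
    | 1 => simp [dihCoeff]
    | n + 2 =>
      have h1 := ih (n + 1) (by omega)
      have h0 := ih n (by omega)
      rw [dihCoeff, sub_mul, mul_assoc, h1, h0]
      push_cast
      have e1 : ((n : ℝ) + 2) * θ = (n + 1) * θ + θ := by ring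
      have e2 : (n : ℝ) * θ = (n + 1) * θ - θ := by ring
      rw [e1, e2, Real.sin_add, Real.sin_sub]
      ring

theorem dihCoeff_nonneg_of_cos {m k : ℕ} (hm : 2 ≤ m) (hk : k ≤ m) :
    0 ≤ dihCoeff (Real.cos (Real.pi / m)) k := by
  have hm0 : (0 : ℝ) < m := by positivity
  have hs : 0 < Real.sin (Real.pi / m) := by
    apply Real.sin_pos_of_pos_of_lt_pi (by positivity)
    rw [div_lt_iff₀ hm0]
    have : (2 : ℝ) ≤ m := by exact_mod_cast hm
    nlinarith [Real.pi_pos]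
  have h := dihCoeff_cos (Real.pi / m) k
  have h2 : 0 ≤ Real.sin (k * (Real.pi / m)) := by
    apply Real.sin_nonneg_of_nonneg_of_le_pi (by positivity)
    rw [mul_div_assoc', div_le_iff₀ hm0]
    have : (k : ℝ) ≤ m := by exact_mod_cast hk
    nlinarith [Real.pi_pos]
  rw [← h] at h2
  exact nonneg_of_mul_nonneg_left h2 hs

/-- When 2c ≥ 2 each increment is at least the previous one. This covers infinite dihedral
subgroups, where no sine is available. -/
theorem dihCoeff_mono {c : ℝ} (hc : 1 ≤ c) (k : ℕ) :
    0 ≤ dihCoeff c k ∧ dihCoeff c k ≤ dihCoeff c (k + 1) := by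
  induction k with
  | zero => simp [dihCoeff]
  | succ k ih =>
    refine ⟨ih.1.trans ih.2, ?_⟩
    rw [dihCoeff]
    nlinarith

/-- The alternating product of `k` letters ending in the second letter. -/
def altProd (s t : W) : ℕ → W
  | 0 => 1
  | k + 1 => altProd t s k * t

theorem wordProd_alternatingWord (i j : B) (k : ℕ) :
    cs.wordProd (CoxeterSystem.alternatingWord i j k) =
      altProd (cs.simple i) (cs.simple j) k := by
  induction k generalizing i j with
  | zero => simp [CoxeterSystem.alternatingWord, altProd]
  | succ k ih => rw [CoxeterSystem.alternatingWord_succ, cs.wordProd_concat, ih, altProd]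

theorem length_altProd_le (i j : B) (k : ℕ) :
    cs.length (altProd (cs.simple i) (cs.simple j) k) ≤ k := by
  rw [← wordProd_alternatingWord]
  exact (cs.length_wordProd_le _).trans (by simp)

/-- The definition peels off the last letter; here the first one is peeled off, and parity decides
which letter it is. -/
theorem altProd_succ' (s t : W) (k : ℕ) :
    altProd s t (k + 1) = (if Even k then t else s) * altProd s t k := by
  induction k generalizing s t with
  | zero => simp [altProd]
  | succ k ih =>
    rw [altProd, ih t s, mul_assoc]
    congr 1
    rcases Nat.even_or_odd k with h | h
    · rw [if_pos h, if_neg (by simpa [Nat.even_add_one] using h)]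
    · rw [if_neg (by simpa using h), if_pos (by simpa [Nat.even_add_one] using h)]

theorem altProd_add (s t : W) (k l : ℕ) :
    ∃ i : Bool, altProd s t (k + l) = (if i then altProd s t k else altProd t s k) *
      altProd s t l := by
  induction l generalizing s t with
  | zero => exact ⟨true, by simp [altProd]⟩
  | succ l ih =>
    obtain ⟨i, hi⟩ := ih t s
    refine ⟨!i, ?_⟩
    rw [← add_assoc, altProd, hi, altProd, mul_assoc]
    cases i <;> rfl

theorem altProd_braid (i j : B) :
    altProd (cs.simple i) (cs.simple j) (M i j) = altProd (cs.simple j) (cs.simple i) (M i j) := by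
  rw [← wordProd_alternatingWord, ← wordProd_alternatingWord]
  have := cs.wordProd_braidWord_eq i j
  rw [CoxeterSystem.braidWord, CoxeterSystem.braidWord, M.symmetric j i] at this
  exact this

variable {cs} {φ : LinearMap.BilinForm ℝ V} {α : B → V}
variable {σ : W →* Module.End ℝ V}

/-- Each further reflection changes only one of the two coordinates in the plane of the two roots,
and the new coordinate obeys the recurrence of `dihCoeff`. -/
theorem altProd_apply_root (hα : RootFamily M φ α)
    (hσ : ∀ i, σ (cs.simple i) = formRefl φ (α i)) (k : ℕ) (i j : B) :
    σ (altProd (cs.simple i) (cs.simple j) k) (α i) =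
      if Even k then
        dihCoeff (-φ (α i) (α j)) (k + 1) • α i + dihCoeff (-φ (α i) (α j)) k • α j
      else dihCoeff (-φ (α i) (α j)) k • α i + dihCoeff (-φ (α i) (α j)) (k + 1) • α j := by
  induction k with
  | zero => simp [altProd, dihCoeff]
  | succ k ih =>
    rw [altProd_succ', map_mul, Module.End.mul_apply, ih]
    have h1 : dihCoeff (-φ (α i) (α j)) (k + 1 + 1) =
      2 * (-φ (α i) (α j)) * dihCoeff (-φ (α i) (α j)) (k + 1) - dihCoeff (-φ (α i) (α j)) k := rfl
    rw [h1]
    by_cases hk : Even k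
    · have hk' : ¬ Even (k + 1) := by simpa [Nat.even_add_one] using hk
      rw [if_pos hk, if_pos hk, if_neg hk', hσ, formRefl_apply]
      simp only [map_add, map_smul, smul_eq_mul, hα.unit, hα.symm (α j) (α i)]
      module
    · have hk' : Even (k + 1) := by simpa [Nat.even_add_one] using hk
      rw [if_neg hk, if_neg hk, if_pos hk', hσ, formRefl_apply]
      simp only [map_add, map_smul, smul_eq_mul, hα.unit]
      module

theorem form_apply_apply (hα : RootFamily M φ α)
    (hσ : ∀ i, σ (cs.simple i) = formRefl φ (α i)) (w : W) (x y : V) :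
    φ (σ w x) (σ w y) = φ x y := by
  induction w using cs.simple_induction_left generalizing x y with
  | one => simp
  | mul_simple_left w i ih =>
    rw [map_mul, Module.End.mul_apply, Module.End.mul_apply, ← ih x y, hσ]
    simp only [formRefl_apply, map_sub, map_smul, LinearMap.sub_apply, LinearMap.smul_apply,
      smul_eq_mul, hα.unit, hα.symm _ (α i)]
    ring

theorem form_apply_left (hα : RootFamily M φ α)
    (hσ : ∀ i, σ (cs.simple i) = formRefl φ (α i)) (w : W) (x y : V) :
    φ (σ w x) y = φ x (σ w⁻¹ y) := by
  have h := form_apply_apply hα hσ w x (σ w⁻¹ y)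
  rwa [← Module.End.mul_apply, ← map_mul, mul_inv_cancel, map_one, Module.End.one_apply] at h

/-- **Positivity theorem**: an ascent of `w` is sent by `w` to a positive root. -/
theorem pos_of_ascent (hα : RootFamily M φ α)
    (hσ : ∀ i, σ (cs.simple i) = formRefl φ (α i)) (w : W) (i : B)
    (h : cs.length w < cs.length (w * cs.simple i)) : Pos φ α (σ w (α i)) := by
  induction hn : cs.length w using Nat.strong_induction_on generalizing w i with
  | _ n ih =>
  subst hn
  by_cases hw : w = 1
  · subst hw
    intro p hp
    simpa using hp i
  obtain ⟨j, hj⟩ := cs.exists_rightDescent_of_ne_one hw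
  rw [CoxeterSystem.IsRightDescent] at hj
  set s := cs.simple i with hs
  set t := cs.simple j with ht
  have hs2 : s * s = 1 := cs.simple_mul_simple_self i
  have ht2 : t * t = 1 := cs.simple_mul_simple_self j
  have hst : i ≠ j := by
    rintro rfl
    exact lt_asymm h hj
  -- A longest alternating suffix that can be split off reducedly is removed. What remains ascends
  -- under both letters, so the induction applies to it for i and for j.
  let Good : ℕ → Prop := fun k => ∃ v, w = v * altProd s t k ∧ cs.length v + k = cs.length w
  have hG1 : Good 1 := by
    refine ⟨w * t, by simp [altProd, mul_assoc, ht2], ?_⟩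
    have := (cs.isRightDescent_iff (w := w) (i := j)).1 hj
    exact this
  have hbound : ∀ k, Good k → k ≤ cs.length w := by
    rintro k ⟨v, -, h2⟩
    omega
  classical
  obtain ⟨k, hk, hmax⟩ : ∃ k, Good k ∧ ∀ l, Good l → l ≤ k := by
    refine ⟨Nat.findGreatest Good (cs.length w), ?_, ?_⟩
    · exact Nat.findGreatest_spec (m := 1) (hbound 1 hG1) hG1
    · intro l hl
      exact Nat.le_findGreatest (hbound l hl) hl
  have hk1 : 1 ≤ k := hmax 1 hG1
  obtain ⟨v, hv, hlen⟩ := hk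
  have hvlt : cs.length v < cs.length w := by omega
  -- the first letter of the alternating product, and the other one
  obtain ⟨l, rfl⟩ : ∃ l, k = l + 1 := ⟨k - 1, by omega⟩
  have hlt : ∀ x : B, (x = i ∨ x = j) → cs.length v < cs.length (v * cs.simple x) := by
    intro x hx
    by_contra hcon
    have hdesc : cs.IsRightDescent v x := by
      rcases cs.length_mul_simple v x with h1 | h1
      · omega
      · rw [CoxeterSystem.IsRightDescent]; omega
    have hd := cs.isRightDescent_iff.1 hdesc
    by_cases hxl : cs.simple x = (if Even l then t else s)
    · have : w = (v * cs.simple x) * altProd s t l := by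
        rw [hv, altProd_succ', ← hxl, mul_assoc]
      have h1 := cs.length_mul_le (v * cs.simple x) (altProd s t l)
      rw [← this] at h1
      have h2 : cs.length (altProd s t l) ≤ l := length_altProd_le cs i j l
      omega
    -- A descent of v at the other letter would prolong the alternating suffix, against maximality;
    -- at the same letter it would shorten w.
    · have hx2 : cs.simple x = (if Even (l + 1) then t else s) := by
        rcases hx with rfl | rfl
        · by_cases he : Even l
          · simp [Nat.even_add_one, he]
            rfl
          · simp [he] at hxl
            exact absurd rfl hxl
        · by_cases he : Even l
          · simp [he] at hxl
            exact absurd rfl hxl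
          · simp [Nat.even_add_one, he]
            rfl
      have hG : Good (l + 1 + 1) := by
        refine ⟨v * cs.simple x, ?_, by omega⟩
        rw [altProd_succ' s t (l + 1), ← hx2, mul_assoc, ← mul_assoc (cs.simple x),
          cs.simple_mul_simple_self, one_mul, hv]
      have := hmax _ hG
      omega
  have hvi := ih _ hvlt v i (hlt i (Or.inl rfl)) rfl
  have hvj := ih _ hvlt v j (hlt j (Or.inr rfl)) rfl
  -- nonnegativity of the coefficients
  have hcoef : 0 ≤ dihCoeff (-φ (α i) (α j)) (l + 1) ∧ 0 ≤ dihCoeff (-φ (α i) (α j)) (l + 1 + 1) := by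
    by_cases hm : M i j = 0
    · have := hα.infinite i j hm
      exact ⟨(dihCoeff_mono (by linarith) _).1, (dihCoeff_mono (by linarith) _).1⟩
    · have hm1 : M i j ≠ 1 := M.off_diagonal i j hst
      -- If the suffix had at least M i j letters, the braid relation would let it end in s, and w *
      -- s would be shorter than w. Hence the dihedral coefficients stay in the nonnegative range.
      have hml : l + 1 + 1 ≤ M i j := by
        by_contra hcon
        obtain ⟨e, he⟩ : ∃ e, l + 1 = e + M i j := ⟨l + 1 - M i j, by omega⟩
        obtain ⟨b, hb⟩ := altProd_add s t e (M i j)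
        obtain ⟨m', hm'⟩ : ∃ m', M i j = m' + 1 := ⟨M i j - 1, by omega⟩
        have h1 : altProd s t (M i j) * s = altProd s t m' := by
          rw [altProd_braid cs i j, hm', altProd, mul_assoc, hs2, mul_one]
        have h2 : w * s = v * ((if b then altProd s t e else altProd t s e) * altProd s t m') := by
          rw [hv, he, hb, mul_assoc, mul_assoc, h1]
        have h3 := cs.length_mul_le v ((if b then altProd s t e else altProd t s e) *
          altProd s t m')
        have h4 := cs.length_mul_le (if b then altProd s t e else altProd t s e) (altProd s t m')
        have h5 : cs.length (if b then altProd s t e else altProd t s e) ≤ e := by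
          cases b
          · exact length_altProd_le cs j i e
          · exact length_altProd_le cs i j e
        have h6 : cs.length (altProd s t m') ≤ m' := length_altProd_le cs i j m'
        rw [← h2] at h3
        omega
      rw [hα.finite i j hst hm, neg_neg]
      exact ⟨dihCoeff_nonneg_of_cos (by omega) (by omega),
        dihCoeff_nonneg_of_cos (by omega) hml⟩
  rw [hv, map_mul, Module.End.mul_apply, altProd_apply_root hα hσ]
  split_ifs
  · rw [map_add, map_smul, map_smul]
    exact hvi.comb hvj hcoef.2 hcoef.1
  · rw [map_add, map_smul, map_smul]
    exact hvi.comb hvj hcoef.1 hcoef.2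

/-- A descent of w is an ascent of w * sᵢ, and sᵢ negates its own root. -/
theorem neg_of_descent (hα : RootFamily M φ α)
    (hσ : ∀ i, σ (cs.simple i) = formRefl φ (α i)) (w : W) (i : B)
    (h : cs.IsRightDescent w i) : Pos φ α (-σ w (α i)) := by
  have h1 : cs.length (w * cs.simple i) < cs.length (w * cs.simple i * cs.simple i) := by
    rw [cs.simple_mul_simple_cancel_right]
    exact h
  have h2 := pos_of_ascent hα hσ _ i h1
  rw [map_mul, Module.End.mul_apply, hσ, formRefl_apply, hα.unit] at h2
  convert h2 using 1
  rw [← map_neg]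
  congr 1
  module

/-- The chambers of distinct elements are disjoint. -/
theorem eq_one_of_chamber (hα : RootFamily M φ α)
    (hσ : ∀ i, σ (cs.simple i) = formRefl φ (α i)) {p : V} (hp : ∀ i, 0 < φ p (α i))
    {w : W} (hw : ∀ i, 0 < φ (σ w p) (α i)) : w = 1 := by
  by_contra hne
  obtain ⟨i, hi⟩ := cs.exists_leftDescent_of_ne_one hne
  have h1 := neg_of_descent hα hσ w⁻¹ i (cs.isRightDescent_inv_iff.2 hi) p (fun j => (hp j).le)
  have h2 := hw i
  rw [form_apply_left hα hσ] at h2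
  rw [map_neg] at h1
  linarith

theorem faithful_of_chamber (hα : RootFamily M φ α)
    (hσ : ∀ i, σ (cs.simple i) = formRefl φ (α i)) {p : V} (hp : ∀ i, 0 < φ p (α i)) :
    Function.Injective σ := by
  rw [injective_iff_map_eq_one]
  intro w hw
  apply eq_one_of_chamber hα hσ hp
  rw [hw]
  exact hp

/-- Two dominant vectors in the same orbit are equal. -/
theorem dominant_unique (hα : RootFamily M φ α)
    (hσ : ∀ i, σ (cs.simple i) = formRefl φ (α i)) (w : W) {x : V} (hx : ∀ i, 0 ≤ φ x (α i))
    (hw : ∀ i, 0 ≤ φ (σ w x) (α i)) : σ w x = x := by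
  induction hn : cs.length w using Nat.strong_induction_on generalizing w with
  | _ n ih =>
  subst hn
  by_cases h1 : w = 1
  · simp [h1]
  obtain ⟨i, hi⟩ := cs.exists_leftDescent_of_ne_one h1
  have h2 := neg_of_descent hα hσ w⁻¹ i (cs.isRightDescent_inv_iff.2 hi) x hx
  rw [map_neg, ← form_apply_left hα hσ] at h2
  -- The descent makes this product nonpositive and dominance makes it nonnegative, so the
  -- reflection fixes the image and w can be shortened.
  have h3 : φ (σ w x) (α i) = 0 := le_antisymm (by linarith) (hw i)
  have h4 : σ (cs.simple i * w) x = σ w x := by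
    rw [map_mul, Module.End.mul_apply, hσ, formRefl_apply, hα.symm, h3]
    simp
  rw [← h4]
  exact ih _ hi _ (by rw [h4]; exact hw) rfl

end Tits

/-! ### The Lorentzian product -/

/-- Vectors of Lorentzian 4-space. -/
abbrev Vec4 := Fin 4 → ℝ

/-- The Lorentzian product as a bilinear form. -/
def lor : LinearMap.BilinForm ℝ Vec4 := Matrix.toBilin' Q

theorem lor_apply (x y : Vec4) : lor x y = x 0 * y 0 + x 1 * y 1 + x 2 * y 2 - x 3 * y 3 := by
  simp [lor, Matrix.toBilin'_apply, Fin.sum_univ_four, Q]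
  ring

theorem lor_comm (x y : Vec4) : lor x y = lor y x := by
  simp only [lor_apply]; ring

theorem reflMat_mulVec (x y : Vec4) : reflMat x *ᵥ y = y - (2 * lor x y) • x := by
  ext i
  fin_cases i <;>
  · simp [reflMat, Matrix.mulVec, dotProduct, Fin.sum_univ_four, Q, Matrix.vecMulVec, lor_apply,
      Matrix.sub_apply, Matrix.one_apply]
    ring

theorem toLin'_reflMat (x : Vec4) : Matrix.toLin' (reflMat x) = formRefl lor x := by
  refine LinearMap.ext fun y => ?_
  rw [Matrix.toLin'_apply, reflMat_mulVec, formRefl_apply]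

theorem preserves_iff (A : Mat4) :
    A.transpose * Q * A = Q ↔ ∀ x y, lor (A *ᵥ x) (A *ᵥ y) = lor x y := by
  constructor
  · intro h x y
    have := LinearMap.BilinForm.toMatrix'_comp lor (Matrix.toLin' A) (Matrix.toLin' A)
    have h2 : (lor.comp (Matrix.toLin' A) (Matrix.toLin' A)) = lor := by
      apply LinearMap.BilinForm.toMatrix'.injective
      rw [this]
      simp [lor, h]
    have h3 := congrArg (fun f => f x y) h2
    simpa using h3
  · intro h
    have := LinearMap.BilinForm.toMatrix'_comp lor (Matrix.toLin' A) (Matrix.toLin' A)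
    have h2 : (lor.comp (Matrix.toLin' A) (Matrix.toLin' A)) = lor := by
      refine LinearMap.ext fun x => LinearMap.ext fun y => ?_
      simp [h]
    rw [h2] at this
    simpa [lor] using this.symm

theorem mem_lorentz_iff (A : Mat4) :
    A ∈ lorentz ↔ (∀ x y, lor (A *ᵥ x) (A *ᵥ y) = lor x y) ∧ 0 < A 3 3 := by
  rw [← preserves_iff]; rfl

theorem preserves_mul {A B : Mat4} (hA : ∀ x y, lor (A *ᵥ x) (A *ᵥ y) = lor x y)
    (hB : ∀ x y, lor (B *ᵥ x) (B *ᵥ y) = lor x y) (x y : Vec4) :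
    lor ((A * B) *ᵥ x) ((A * B) *ᵥ y) = lor x y := by
  rw [← Matrix.mulVec_mulVec, ← Matrix.mulVec_mulVec, hA, hB]

theorem preserves_reflMat {x : Vec4} (hx : lor x x = 1) (y z : Vec4) :
    lor (reflMat x *ᵥ y) (reflMat x *ᵥ z) = lor y z := by
  simp only [reflMat_mulVec, map_sub, map_smul, LinearMap.sub_apply, LinearMap.smul_apply,
    smul_eq_mul, hx, lor_comm _ x]
  ring

/-! ### Null vectors, disks and inversions -/

/-- The null vector of a point of the extended plane. -/
def nullVec : Rhat → Vec4
  | none => ![0, 0, 1, 1]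
  | some x => ![2 * x 0, 2 * x 1, ‖x‖ ^ 2 - 1, ‖x‖ ^ 2 + 1]

theorem norm_sq_E2 (x : E2) : ‖x‖ ^ 2 = x 0 ^ 2 + x 1 ^ 2 := by
  rw [EuclideanSpace.norm_sq_eq]; simp

theorem nullVec_infty : nullVec OnePoint.infty = ![0, 0, 1, 1] := rfl

theorem nullVec_coe (x : E2) :
    nullVec (x : Rhat) = ![2 * x 0, 2 * x 1, ‖x‖ ^ 2 - 1, ‖x‖ ^ 2 + 1] := rfl

theorem nullVec_three_pos (X : Rhat) : 0 < nullVec X 3 := by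
  induction X using OnePoint.rec with
  | infty => simp [nullVec_infty]
  | coe x => simp [nullVec_coe]; positivity

/-- The last coordinate minus the third is 2 at finite points and 0 at ∞, which recovers the scale.
-/
theorem nullVec_injective_ray {X Y : Rhat} {c d : ℝ} (hc : 0 < c) (hd : 0 < d)
    (h : c • nullVec X = d • nullVec Y) : X = Y := by
  induction X using OnePoint.rec with
  | infty =>
    induction Y using OnePoint.rec with
    | infty => rfl
    | coe y =>
      rw [nullVec_infty, nullVec_coe] at h
      have h2 := congrFun h 2
      have h3 := congrFun h 3
      simp at h2 h3
      nlinarith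
  | coe x =>
    induction Y using OnePoint.rec with
    | infty =>
      rw [nullVec_infty, nullVec_coe] at h
      have h2 := congrFun h 2
      have h3 := congrFun h 3
      simp at h2 h3
      nlinarith
    | coe y =>
      rw [nullVec_coe, nullVec_coe] at h
      have h0 := congrFun h 0
      have h1 := congrFun h 1
      have h2 := congrFun h 2
      have h3 := congrFun h 3
      simp at h0 h1 h2 h3
      have hcd : c = d := by nlinarith
      subst hcd
      congr 1
      ext i
      fin_cases i
      · simpa [hc.ne'] using h0
      · simpa [hc.ne'] using h1

/-- The set of points of the extended plane on the positive side of a vector. -/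
def posSide (y : Vec4) : Set Rhat := {X | 0 ≤ lor (nullVec X) y}

/-- The vector of affine coordinates of a point of 3-space. -/
def aff (u : E3) : Vec4 := ![u 0, u 1, u 2, 1]

/-- The null vector of a point is a positive multiple of its stereographic image completed by 1. -/
theorem illum_eq (u : E3) : illum u = posSide (aff u) := by
  ext X
  induction X using OnePoint.rec with
  | infty =>
    change 1 ≤ inner ℝ (!₂[0, 0, 1] : E3) u ↔ 0 ≤ lor ![0, 0, 1, 1] (aff u)
    simp [lor_apply, aff, EuclideanSpace.inner_eq_star_dotProduct, dotProduct, Fin.sum_univ_three]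
  | coe x =>
    change 1 ≤ inner ℝ (!₂[2 * x 0 / (‖x‖ ^ 2 + 1), 2 * x 1 / (‖x‖ ^ 2 + 1),
      (‖x‖ ^ 2 - 1) / (‖x‖ ^ 2 + 1)] : E3) u ↔ 0 ≤ lor (nullVec (x : Rhat)) (aff u)
    have hp : 0 < ‖x‖ ^ 2 + 1 := by positivity
    have e : inner ℝ (!₂[2 * x 0 / (‖x‖ ^ 2 + 1), 2 * x 1 / (‖x‖ ^ 2 + 1),
      (‖x‖ ^ 2 - 1) / (‖x‖ ^ 2 + 1)] : E3) u =
      (2 * x 0 * u 0 + 2 * x 1 * u 1 + (‖x‖ ^ 2 - 1) * u 2) / (‖x‖ ^ 2 + 1) := by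
      simp [EuclideanSpace.inner_eq_star_dotProduct, dotProduct, Fin.sum_univ_three]
      field_simp
    rw [e, le_div_iff₀ hp, nullVec_coe]
    simp [lor_apply, aff]

theorem lor_vec_self (D : Disk) : lor D.vec D.vec = 1 := by
  cases D with
  | round c κ hκ =>
    simp only [Disk.vec, lor_apply, norm_sq_E2]
    simp
    field_simp
    ring
  | half n δ hn =>
    have h := norm_sq_E2 n
    rw [hn] at h
    simp only [Disk.vec, lor_apply]
    simp
    linarith

/-- The curvature must be x 3 - x 2; if it vanishes, the vector is that of a half-plane. -/
theorem exists_disk {x : Vec4} (hx : lor x x = 1) : ∃ D : Disk, D.vec = x := by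
  rw [lor_apply] at hx
  by_cases h : x 3 = x 2
  · have hn : ‖(!₂[x 0, x 1] : E2)‖ = 1 := by
      have : ‖(!₂[x 0, x 1] : E2)‖ ^ 2 = 1 := by
        rw [norm_sq_E2]; simp; rw [h] at hx; linarith
      nlinarith [norm_nonneg (!₂[x 0, x 1] : E2)]
    refine ⟨.half !₂[x 0, x 1] (x 2) hn, ?_⟩
    ext i
    fin_cases i <;> simp [Disk.vec, h]
  · have hκ : x 3 - x 2 ≠ 0 := sub_ne_zero.2 h
    refine ⟨.round !₂[x 0 / (x 3 - x 2), x 1 / (x 3 - x 2)] (x 3 - x 2) hκ, ?_⟩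
    ext i
    fin_cases i
    · simp [Disk.vec]; field_simp
    · simp [Disk.vec]; field_simp
    · simp [Disk.vec, norm_sq_E2]; field_simp; nlinarith
    · simp [Disk.vec, norm_sq_E2]; field_simp; nlinarith

/-- The product with the null vector is κ(κ⁻² - |x - c|²) at a finite point and -κ at ∞; for a
half-plane it is 2(⟨n, x⟩ - δ), and 0 at ∞. -/
theorem carrier_eq (D : Disk) : D.carrier = posSide D.vec := by
  ext X
  cases D with
  | round c κ hκ =>
    have key : ∀ x : E2, lor (nullVec (x : Rhat)) (Disk.round c κ hκ).vec =
        κ * (κ⁻¹ ^ 2 - dist x c ^ 2) := by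
      intro x
      rw [dist_eq_norm, norm_sq_E2, nullVec_coe]
      simp only [Disk.vec, lor_apply, norm_sq_E2]
      simp
      field_simp
      ring
    have hinf : lor (nullVec OnePoint.infty) (Disk.round c κ hκ).vec = -κ := by
      rw [nullVec_infty]
      simp only [Disk.vec, lor_apply]
      simp
      ring
    change X ∈ (if 0 < κ then (fun x : E2 => (x : Rhat)) '' Metric.closedBall c κ⁻¹
      else ((fun x : E2 => (x : Rhat)) '' Metric.ball c (-κ⁻¹))ᶜ) ↔ 0 ≤ lor (nullVec X) _
    split_ifs with hpos
    · have hi : 0 < κ⁻¹ := by positivity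
      induction X using OnePoint.rec with
      | infty => rw [hinf]; simp [hpos]
      | coe x =>
        rw [key]
        simp only [Set.mem_image, OnePoint.coe_eq_coe, exists_eq_right, Metric.mem_closedBall]
        rw [mul_nonneg_iff_of_pos_left hpos, sub_nonneg]
        exact (sq_le_sq₀ dist_nonneg hi.le).symm
    · have hneg : κ < 0 := lt_of_le_of_ne (not_lt.1 hpos) hκ
      have hi : 0 < -κ⁻¹ := by rw [neg_pos]; exact inv_lt_zero.2 hneg
      induction X using OnePoint.rec with
      | infty => rw [hinf]; simp; exact hneg.le
      | coe x =>
        rw [key]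
        simp only [Set.mem_compl_iff, Set.mem_image, OnePoint.coe_eq_coe, exists_eq_right,
          Metric.mem_ball, not_lt]
        rw [← sq_le_sq₀ hi.le dist_nonneg, neg_sq]
        constructor
        · intro h; nlinarith
        · intro h; by_contra hc; push Not at hc; nlinarith
  | half n δ hn =>
    change X ∈ insert OnePoint.infty ((fun x : E2 => (x : Rhat)) '' {x | δ ≤ inner ℝ n x}) ↔
      0 ≤ lor (nullVec X) _
    induction X using OnePoint.rec with
    | infty => simp [nullVec_infty, lor_apply, Disk.vec]
    | coe x =>
      rw [nullVec_coe]
      simp [lor_apply, Disk.vec, EuclideanSpace.inner_eq_star_dotProduct, dotProduct]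
      constructor <;> intro h <;> nlinarith

theorem inversion_apply (c x : E2) (r : ℝ) (i : Fin 2) :
    EuclideanGeometry.inversion c r x i =
      r ^ 2 / ((x 0 - c 0) ^ 2 + (x 1 - c 1) ^ 2) * (x i - c i) + c i := by
  have h : dist x c ^ 2 = (x 0 - c 0) ^ 2 + (x 1 - c 1) ^ 2 := by
    rw [dist_eq_norm, norm_sq_E2]; simp
  simp [EuclideanGeometry.inversion, div_pow, h]

/-- The positive factor is explicit, for instance κ²|x - c|² at a finite point other than the
centre. Its positivity shows that the future cone is preserved. -/
theorem reflMat_nullVec (D : Disk) (X : Rhat) :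
    ∃ c : ℝ, 0 < c ∧ reflMat D.vec *ᵥ nullVec X = c • nullVec (D.invPerm X) := by
  cases D with
  | round c κ hκ =>
    have hp : ∀ X, (Disk.round c κ hκ).invPerm X = circleInv c κ⁻¹ X := fun _ => rfl
    rw [hp]
    induction X using OnePoint.rec with
    | infty =>
      refine ⟨κ ^ 2, by positivity, ?_⟩
      rw [show circleInv c κ⁻¹ OnePoint.infty = (c : Rhat) from rfl, reflMat_mulVec, lor_apply,
        nullVec_coe, nullVec_infty]
      ext i
      fin_cases i <;> simp [Disk.vec] <;> field_simp <;> ring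
    | coe x =>
      have h1 : circleInv c κ⁻¹ (x : Rhat) = if x = c then OnePoint.infty else
          ((EuclideanGeometry.inversion c κ⁻¹ x : E2) : Rhat) := by
        rw [show circleInv c κ⁻¹ (x : Rhat) = circleInv c κ⁻¹ (some x) from rfl, circleInv]
      rw [h1]
      split_ifs with hx
      · subst hx
        refine ⟨(κ ^ 2)⁻¹, by positivity, ?_⟩
        rw [reflMat_mulVec, lor_apply, nullVec_coe, nullVec_infty]
        ext i
        fin_cases i <;> simp [Disk.vec, norm_sq_E2] <;> field_simp <;> ring
      · have hδ : 0 < (x 0 - c 0) ^ 2 + (x 1 - c 1) ^ 2 := by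
          have : 0 < ‖x - c‖ ^ 2 := by
            have := norm_pos_iff.2 (sub_ne_zero.2 hx)
            positivity
          rw [norm_sq_E2] at this
          simpa using this
        refine ⟨κ ^ 2 * ((x 0 - c 0) ^ 2 + (x 1 - c 1) ^ 2), by positivity, ?_⟩
        rw [reflMat_mulVec, lor_apply, nullVec_coe, nullVec_coe]
        generalize hδ' : (x 0 - c 0) ^ 2 + (x 1 - c 1) ^ 2 = δ at hδ
        have hδ0 := hδ.ne'
        ext i
        fin_cases i <;> simp [Disk.vec, norm_sq_E2, inversion_apply, hδ'] <;> field_simp <;>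
          rw [← hδ'] <;> ring
  | half n δ hn =>
    have hp : ∀ X, (Disk.half n δ hn).invPerm X = lineRefl n δ X := fun _ => rfl
    rw [hp]
    refine ⟨1, one_pos, ?_⟩
    have h := norm_sq_E2 n
    rw [hn] at h
    induction X using OnePoint.rec with
    | infty =>
      rw [show lineRefl n δ OnePoint.infty = OnePoint.infty from rfl, reflMat_mulVec, lor_apply,
        nullVec_infty]
      ext i
      fin_cases i <;> simp [Disk.vec]
    | coe x =>
      rw [show lineRefl n δ (x : Rhat) = ((x - (2 * (inner ℝ n x - δ)) • n : E2) : Rhat) from rfl,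
        reflMat_mulVec, lor_apply, nullVec_coe, nullVec_coe]
      ext i
      fin_cases i <;> simp [Disk.vec, norm_sq_E2, EuclideanSpace.inner_eq_star_dotProduct,
        dotProduct]
      · ring
      · ring
      · linear_combination (4 * (x 0 * n 0 + x 1 * n 1 - δ) ^ 2) * h
      · linear_combination (4 * (x 0 * n 0 + x 1 * n 1 - δ) ^ 2) * h

/-! ### The matrix representation of the Möbius group -/

/-- The matrix `A` preserves the Lorentzian product and induces `μ` on null rays. -/
def Represents (μ : Equiv.Perm Rhat) (A : Mat4) : Prop :=
  (∀ x y, lor (A *ᵥ x) (A *ᵥ y) = lor x y) ∧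
    ∀ X, ∃ c : ℝ, 0 < c ∧ A *ᵥ nullVec X = c • nullVec (μ X)

theorem represents_one : Represents 1 1 :=
  ⟨fun x y => by simp, fun X => ⟨1, one_pos, by simp⟩⟩

theorem Represents.mul {μ ν : Equiv.Perm Rhat} {A B : Mat4} (hA : Represents μ A)
    (hB : Represents ν B) : Represents (μ * ν) (A * B) := by
  refine ⟨preserves_mul hA.1 hB.1, fun X => ?_⟩
  obtain ⟨c, hc, h1⟩ := hB.2 X
  obtain ⟨d, hd, h2⟩ := hA.2 (ν X)
  refine ⟨c * d, by positivity, ?_⟩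
  rw [← Matrix.mulVec_mulVec, h1, Matrix.mulVec_smul, h2, smul_smul]
  rfl

theorem Q_mul_Q : Q * Q = 1 := by
  rw [Q, Matrix.diagonal_mul_diagonal, ← Matrix.diagonal_one]
  congr 1
  ext i
  fin_cases i <;> simp

/-- The inverse of a matrix preserving the Lorentzian product. -/
def lorInv (A : Mat4) : Mat4 := Q * A.transpose * Q

theorem lorInv_mul {A : Mat4} (hA : ∀ x y, lor (A *ᵥ x) (A *ᵥ y) = lor x y) :
    lorInv A * A = 1 := by
  rw [lorInv, Matrix.mul_assoc Q, Matrix.mul_assoc Q, (preserves_iff A).2 hA, Q_mul_Q]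

theorem mul_lorInv {A : Mat4} (hA : ∀ x y, lor (A *ᵥ x) (A *ᵥ y) = lor x y) :
    A * lorInv A = 1 := mul_eq_one_comm.1 (lorInv_mul hA)

theorem preserves_lorInv {A : Mat4} (hA : ∀ x y, lor (A *ᵥ x) (A *ᵥ y) = lor x y) (x y : Vec4) :
    lor (lorInv A *ᵥ x) (lorInv A *ᵥ y) = lor x y := by
  rw [← hA, Matrix.mulVec_mulVec, Matrix.mulVec_mulVec, mul_lorInv hA, Matrix.one_mulVec,
    Matrix.one_mulVec]

theorem Represents.inv {μ : Equiv.Perm Rhat} {A : Mat4} (hA : Represents μ A) :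
    Represents μ⁻¹ (lorInv A) := by
  refine ⟨preserves_lorInv hA.1, fun X => ?_⟩
  obtain ⟨c, hc, h⟩ := hA.2 (μ⁻¹ X)
  refine ⟨c⁻¹, by positivity, ?_⟩
  have h2 := congrArg (fun v => c⁻¹ • (lorInv A *ᵥ v)) h
  simp only [Matrix.mulVec_mulVec, lorInv_mul hA.1, Matrix.one_mulVec, Matrix.mulVec_smul,
    smul_smul, inv_mul_cancel₀ hc.ne', one_smul] at h2
  rw [h2]
  simp

theorem represents_disk (D : Disk) : Represents D.invPerm (reflMat D.vec) :=
  ⟨preserves_reflMat (lor_vec_self D), reflMat_nullVec D⟩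

theorem exists_represents (μ : Mob) : ∃ A, Represents (μ : Equiv.Perm Rhat) A := by
  obtain ⟨μ, hμ⟩ := μ
  induction hμ using Subgroup.closure_induction with
  | mem x hx =>
    obtain ⟨D, rfl⟩ := hx
    exact ⟨_, represents_disk D⟩
  | one => exact ⟨1, represents_one⟩
  | mul x y _ _ hx hy =>
    obtain ⟨A, hA⟩ := hx
    obtain ⟨B, hB⟩ := hy
    exact ⟨A * B, hA.mul hB⟩
  | inv x _ hx =>
    obtain ⟨A, hA⟩ := hx
    exact ⟨_, hA.inv⟩

/-- Two matrices inducing the same map differ on each null vector by a positive factor, and factors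
at non-orthogonal null vectors are reciprocal. Comparing ∞, 0, e₁, e₂ forces all factors to be 1,
and these four null vectors span. -/
theorem Represents.unique {μ : Equiv.Perm Rhat} {A B : Mat4} (hA : Represents μ A)
    (hB : Represents μ B) : A = B := by
  have key : ∀ X, ∃ t : ℝ, 0 < t ∧ B *ᵥ nullVec X = t • (A *ᵥ nullVec X) := by
    intro X
    obtain ⟨c, hc, h1⟩ := hA.2 X
    obtain ⟨d, hd, h2⟩ := hB.2 X
    refine ⟨d / c, by positivity, ?_⟩
    rw [h1, h2, smul_smul, div_mul_cancel₀ _ hc.ne']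
  have prod : ∀ (X Y : Rhat) (s t : ℝ), lor (nullVec X) (nullVec Y) ≠ 0 →
      B *ᵥ nullVec X = s • (A *ᵥ nullVec X) → B *ᵥ nullVec Y = t • (A *ᵥ nullVec Y) →
      s * t = 1 := by
    intro X Y s t hne h1 h2
    have h := hB.1 (nullVec X) (nullVec Y)
    rw [h1, h2] at h
    simp only [map_smul, LinearMap.smul_apply, smul_eq_mul, hA.1] at h
    have : (s * t - 1) * lor (nullVec X) (nullVec Y) = 0 := by linarith
    rcases mul_eq_zero.1 this with h | h
    · linarith
    · exact absurd h hne
  have hn0 : nullVec ((0 : E2) : Rhat) = ![0, 0, -1, 1] := by simp [nullVec_coe]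
  have hn1 : nullVec ((!₂[1, 0] : E2) : Rhat) = ![2, 0, 0, 2] := by
    rw [nullVec_coe, norm_sq_E2]
    ext i; fin_cases i <;> simp; norm_num
  have hn2 : nullVec ((!₂[0, 1] : E2) : Rhat) = ![0, 2, 0, 2] := by
    rw [nullVec_coe, norm_sq_E2]
    ext i; fin_cases i <;> simp; norm_num
  obtain ⟨t, ht, h⟩ := key OnePoint.infty
  obtain ⟨t0, ht0, h0⟩ := key ((0 : E2) : Rhat)
  obtain ⟨t1, ht1, h1⟩ := key ((!₂[1, 0] : E2) : Rhat)
  obtain ⟨t2, ht2, h2⟩ := key ((!₂[0, 1] : E2) : Rhat)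
  have e1 := prod OnePoint.infty ((0 : E2) : Rhat) _ _ (by rw [nullVec_infty, hn0]; simp [lor_apply]; norm_num) h h0
  have e2 := prod OnePoint.infty ((!₂[1, 0] : E2) : Rhat) _ _ (by rw [nullVec_infty, hn1]; simp [lor_apply]) h h1
  have e3 := prod OnePoint.infty ((!₂[0, 1] : E2) : Rhat) _ _ (by rw [nullVec_infty, hn2]; simp [lor_apply]) h h2
  have e4 := prod ((0 : E2) : Rhat) ((!₂[1, 0] : E2) : Rhat) _ _ (by rw [hn0, hn1]; simp [lor_apply]) h0 h1
  have f1 : t0 = t1 := by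
    have : t * (t0 - t1) = 0 := by linarith
    rcases mul_eq_zero.1 this with h | h <;> linarith
  have f2 : t0 = t2 := by
    have : t * (t0 - t2) = 0 := by linarith
    rcases mul_eq_zero.1 this with h | h <;> linarith
  have f3 : t0 = 1 := by rw [← f1] at e4; nlinarith
  have f4 : t = 1 := by rw [f3] at e1; linarith
  rw [f4, one_smul, nullVec_infty] at h
  rw [f3, one_smul, hn0] at h0
  rw [← f1, f3, one_smul, hn1] at h1
  rw [← f2, f3, one_smul, hn2] at h2
  ext i j
  have h' := congrFun h i
  have h0' := congrFun h0 i
  have h1' := congrFun h1 i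
  have h2' := congrFun h2 i
  simp [Matrix.mulVec, dotProduct, Fin.sum_univ_four] at h' h0' h1' h2'
  fin_cases j <;> simp <;> linarith

/-- The matrix representation of the Möbius group. -/
def rho : Mob →* Mat4 where
  toFun μ := (exists_represents μ).choose
  map_one' := (exists_represents 1).choose_spec.unique represents_one
  map_mul' μ ν := (exists_represents (μ * ν)).choose_spec.unique
    ((exists_represents μ).choose_spec.mul (exists_represents ν).choose_spec)

theorem rho_spec (μ : Mob) : Represents (μ : Equiv.Perm Rhat) (rho μ) :=
  (exists_represents μ).choose_spec

theorem rho_inv_disk (D : Disk) : rho D.inv = reflMat D.vec :=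
  (rho_spec D.inv).unique (represents_disk D)

theorem rho_preserves (μ : Mob) (x y : Vec4) : lor (rho μ *ᵥ x) (rho μ *ᵥ y) = lor x y :=
  (rho_spec μ).1 x y

theorem rho_mul_inv (μ : Mob) : rho μ * rho μ⁻¹ = 1 := by
  rw [← map_mul, mul_inv_cancel, map_one]

theorem rho_inv_mul (μ : Mob) : rho μ⁻¹ * rho μ = 1 := by
  rw [← map_mul, inv_mul_cancel, map_one]

/-- The null vectors of ∞ and 0 add up to twice the time direction, and both have future images. -/
theorem rho_mem_lorentz (μ : Mob) : rho μ ∈ lorentz := by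
  rw [mem_lorentz_iff]
  refine ⟨rho_preserves μ, ?_⟩
  obtain ⟨c, hc, h1⟩ := (rho_spec μ).2 OnePoint.infty
  obtain ⟨d, hd, h2⟩ := (rho_spec μ).2 ((0 : E2) : Rhat)
  have e1 := congrFun h1 3
  have e2 := congrFun h2 3
  have p1 := mul_pos hc (nullVec_three_pos ((μ : Equiv.Perm Rhat) OnePoint.infty))
  have p2 := mul_pos hd (nullVec_three_pos ((μ : Equiv.Perm Rhat) ((0 : E2) : Rhat)))
  rw [nullVec_infty] at e1
  simp only [nullVec_coe] at e2
  simp [Matrix.mulVec, dotProduct, Fin.sum_univ_four] at e1 e2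
  rw [← e1] at p1
  rw [← e2] at p2
  linarith

theorem rho_injective : Function.Injective rho := by
  intro μ ν h
  apply Subtype.ext
  ext1 X
  obtain ⟨c, hc, h1⟩ := (rho_spec μ).2 X
  obtain ⟨d, hd, h2⟩ := (rho_spec ν).2 X
  rw [h, h2] at h1
  exact (nullVec_injective_ray hd hc h1).symm

/-- This turns images of disks into images of vectors; it holds because the matrix is an isometry
inducing μ on null rays with positive factors. -/
theorem image_posSide (μ : Mob) (y : Vec4) :
    (μ : Equiv.Perm Rhat) '' posSide y = posSide (rho μ *ᵥ y) := by
  have key : ∀ X, (μ : Equiv.Perm Rhat) X ∈ posSide (rho μ *ᵥ y) ↔ X ∈ posSide y := by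
    intro X
    obtain ⟨c, hc, h⟩ := (rho_spec μ).2 X
    change 0 ≤ lor _ _ ↔ 0 ≤ lor _ _
    rw [← rho_preserves μ (nullVec X) y, h]
    simp only [map_smul, LinearMap.smul_apply, smul_eq_mul]
    rw [mul_nonneg_iff_of_pos_left hc]
  ext X
  constructor
  · rintro ⟨Y, hY, rfl⟩
    exact (key Y).2 hY
  · intro hX
    refine ⟨(μ : Equiv.Perm Rhat).symm X, ?_, by simp⟩
    rw [← key]
    simpa using hX

theorem posSide_smul {c : ℝ} (hc : 0 < c) (y : Vec4) : posSide (c • y) = posSide y := by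
  ext X
  simp only [posSide, Set.mem_ofPred_eq, map_smul, smul_eq_mul]
  rw [mul_nonneg_iff_of_pos_left hc]

/-! ### Surjectivity of the representation -/

theorem exists_rho_eq_reflMat {x : Vec4} (hx : lor x x = 1) : ∃ μ, rho μ = reflMat x := by
  obtain ⟨D, rfl⟩ := exists_disk hx
  exact ⟨D.inv, rho_inv_disk D⟩

/-- The inversion whose matrix is the reflection in `x`. -/
def reflMob (x : Vec4) (hx : lor x x = 1) : Mob := (exists_disk hx).choose.inv

theorem rho_reflMob (x : Vec4) (hx : lor x x = 1) : rho (reflMob x hx) = reflMat x := by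
  rw [reflMob, rho_inv_disk, (exists_disk hx).choose_spec]

/-- If two vectors of equal norm have spacelike difference, then the reflection in the normalised
difference exchanges them. -/
theorem exists_rho_swap {u e : Vec4} (h : lor u u = lor e e) (hw : 0 < lor (u - e) (u - e)) :
    ∃ μ, rho μ *ᵥ u = e ∧ ∀ s, lor s (u - e) = 0 → rho μ *ᵥ s = s := by
  set r := Real.sqrt (lor (u - e) (u - e)) with hr
  have hr0 : 0 < r := Real.sqrt_pos.2 hw
  have hr2 : r * r = lor (u - e) (u - e) := Real.mul_self_sqrt hw.le
  have hx : lor (r⁻¹ • (u - e)) (r⁻¹ • (u - e)) = 1 := by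
    simp only [map_smul, LinearMap.smul_apply, smul_eq_mul]
    rw [← hr2]
    field_simp
  obtain ⟨μ, hμ⟩ := exists_rho_eq_reflMat hx
  refine ⟨μ, ?_, ?_⟩
  · rw [hμ, reflMat_mulVec]
    have h1 : lor (u - e) u = r * r / 2 := by
      rw [hr2]
      simp only [map_sub, LinearMap.sub_apply, ← h, lor_comm e u]
      ring
    simp only [map_smul, LinearMap.smul_apply, smul_eq_mul, h1, smul_smul]
    have : 2 * (r⁻¹ * (r * r / 2)) * r⁻¹ = 1 := by field_simp
    rw [this]
    module
  · intro s hs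
    rw [hμ, reflMat_mulVec]
    simp only [map_smul, LinearMap.smul_apply, smul_eq_mul, lor_comm _ s, hs]
    simp

/-- One step of the reduction of a Lorentz matrix by reflections. -/
theorem exists_rho_fix {A : Mat4} (hA : ∀ x y, lor (A *ᵥ x) (A *ᵥ y) = lor x y) (e : Vec4)
    (hw : A *ᵥ e ≠ e → 0 < lor (A *ᵥ e - e) (A *ᵥ e - e)) :
    ∃ μ, (rho μ * A) *ᵥ e = e ∧ ∀ s, A *ᵥ s = s → (rho μ * A) *ᵥ s = s := by
  by_cases h : A *ᵥ e = e
  · exact ⟨1, by simpa using h, fun s hs => by simpa using hs⟩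
  · obtain ⟨μ, h1, h2⟩ := exists_rho_swap (hA e e) (hw h)
    refine ⟨μ, by rw [← Matrix.mulVec_mulVec, h1], fun s hs => ?_⟩
    rw [← Matrix.mulVec_mulVec, hs]
    apply h2
    rw [map_sub, sub_eq_zero]
    nth_rewrite 1 [← hs]
    exact hA s e

/-- Cartan–Dieudonné: reflections bring the images of the time vector and then of the space vectors
back one at a time. Each nonzero difference met on the way is spacelike, so its reflection is an
inversion. -/
theorem exists_rho_eq {A : Mat4} (hA : A ∈ lorentz) : ∃ μ, rho μ = A := by
  rw [mem_lorentz_iff] at hA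
  obtain ⟨hA, hpos⟩ := hA
  have prod : ∀ μ : Mob, ∀ B : Mat4, (∀ x y, lor (B *ᵥ x) (B *ᵥ y) = lor x y) →
      ∀ x y, lor ((rho μ * B) *ᵥ x) ((rho μ * B) *ᵥ y) = lor x y :=
    fun μ B hB => preserves_mul (rho_preserves μ) hB
  let e : Fin 4 → Vec4 := fun i => Pi.single i 1
  have col : ∀ (B : Mat4) i j, (B *ᵥ e i) j = B j i := by
    intro B i j
    simp [e]
  -- the timelike vector
  obtain ⟨μ₃, h3, -⟩ := exists_rho_fix hA (e 3) (by
    intro hne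
    have hn := hA (e 3) (e 3)
    rw [lor_apply, lor_apply] at hn
    have he : ∀ i, e 3 i = if i = 3 then 1 else 0 := fun i => by simp [e, Pi.single_apply]
    simp only [he] at hn
    simp at hn
    replace hpos : 0 < (A *ᵥ e 3) 3 := by rw [col]; exact hpos
    generalize hu : A *ᵥ e 3 = u at *
    rw [lor_apply]
    simp only [Pi.sub_apply, he]
    simp
    by_contra hcon
    -- The difference of u and the time vector has norm 2(u 3 - 1), while u lies on the future sheet
    -- of the hyperboloid, where u 3 ≥ 1 with equality only at the time vector.
    have h1 : u 3 ≤ 1 := by nlinarith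
    have h00 : u 0 = 0 := by nlinarith [sq_nonneg (u 0), sq_nonneg (u 1), sq_nonneg (u 2)]
    have h11 : u 1 = 0 := by nlinarith [sq_nonneg (u 0), sq_nonneg (u 1), sq_nonneg (u 2)]
    have h22 : u 2 = 0 := by nlinarith [sq_nonneg (u 0), sq_nonneg (u 1), sq_nonneg (u 2)]
    apply hne
    ext i
    fin_cases i <;> simp [he, h00, h11, h22]
    nlinarith)
  set A₃ := rho μ₃ * A with hA₃
  have hA₃' := prod μ₃ A hA
  -- the spacelike vectors
  have step : ∀ (B : Mat4), (∀ x y, lor (B *ᵥ x) (B *ᵥ y) = lor x y) → B *ᵥ e 3 = e 3 →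
      ∀ k : Fin 3, B *ᵥ e (Fin.castSucc k) ≠ e (Fin.castSucc k) →
      0 < lor (B *ᵥ e (Fin.castSucc k) - e (Fin.castSucc k))
        (B *ᵥ e (Fin.castSucc k) - e (Fin.castSucc k)) := by
    intro B hB hB3 k hne
    have hu3 : (B *ᵥ e (Fin.castSucc k)) 3 = 0 := by
      have := hB (e (Fin.castSucc k)) (e 3)
      rw [hB3, lor_apply, lor_apply] at this
      fin_cases k <;> simp [e] at this ⊢ <;> linarith
    rw [lor_apply]
    have hek : e (Fin.castSucc k) 3 = 0 := by fin_cases k <;> simp [e]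
    simp only [Pi.sub_apply, hu3, hek]
    by_contra hcon
    apply hne
    generalize B *ᵥ e (Fin.castSucc k) = u at *
    generalize e (Fin.castSucc k) = d at *
    have h00 : u 0 - d 0 = 0 := by
      nlinarith [sq_nonneg (u 0 - d 0), sq_nonneg (u 1 - d 1), sq_nonneg (u 2 - d 2)]
    have h11 : u 1 - d 1 = 0 := by
      nlinarith [sq_nonneg (u 0 - d 0), sq_nonneg (u 1 - d 1), sq_nonneg (u 2 - d 2)]
    have h22 : u 2 - d 2 = 0 := by
      nlinarith [sq_nonneg (u 0 - d 0), sq_nonneg (u 1 - d 1), sq_nonneg (u 2 - d 2)]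
    ext i
    fin_cases i <;> simp <;> linarith
  obtain ⟨μ₀, h0, k0⟩ := exists_rho_fix hA₃' (e (Fin.castSucc 0)) (step A₃ hA₃' h3 0)
  have hA₀' := prod μ₀ A₃ hA₃'
  obtain ⟨μ₁, h1, k1⟩ := exists_rho_fix hA₀' (e (Fin.castSucc 1))
    (step _ hA₀' (k0 _ h3) 1)
  have hA₁' := prod μ₁ _ hA₀'
  obtain ⟨μ₂, h2, k2⟩ := exists_rho_fix hA₁' (e (Fin.castSucc 2))
    (step _ hA₁' (k1 _ (k0 _ h3)) 2)
  have hone : rho μ₂ * (rho μ₁ * (rho μ₀ * (rho μ₃ * A))) = 1 := by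
    have g0 := k2 _ (k1 _ h0)
    have g1 := k2 _ h1
    have g3 := k2 _ (k1 _ (k0 _ h3))
    ext i j
    have hj : (rho μ₂ * (rho μ₁ * (rho μ₀ * A₃))) *ᵥ e j = e j := by
      fin_cases j
      · exact g0
      · exact g1
      · exact h2
      · exact g3
    refine (col _ j i).symm.trans ?_
    rw [hj]
    simp [e, Pi.single_apply, Matrix.one_apply]
  refine ⟨(μ₂ * μ₁ * μ₀ * μ₃)⁻¹, ?_⟩
  have h4 : rho (μ₂ * μ₁ * μ₀ * μ₃) * A = 1 := by
    rw [map_mul, map_mul, map_mul, ← hone]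
    simp only [mul_assoc]
  calc rho (μ₂ * μ₁ * μ₀ * μ₃)⁻¹ = rho (μ₂ * μ₁ * μ₀ * μ₃)⁻¹ * (rho (μ₂ * μ₁ * μ₀ * μ₃) * A) := by
        rw [h4, mul_one]
    _ = A := by rw [← mul_assoc, rho_inv_mul, one_mul]

/-! ### Disks are determined by their vectors -/

/-- The norms of x - e and x + e add up to 4, so one is positive and its reflection takes x to e or
to -e. A last reflection in e corrects the sign. -/
theorem exists_rho_to_first {x : Vec4} (hx : lor x x = 1) :
    ∃ μ, rho μ *ᵥ x = ![1, 0, 0, 0] := by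
  have he : lor ![1, 0, 0, 0] ![1, 0, 0, 0] = 1 := by simp [lor_apply]
  have hsum : lor (x - ![1, 0, 0, 0]) (x - ![1, 0, 0, 0]) +
      lor (x - -![1, 0, 0, 0]) (x - -![1, 0, 0, 0]) = 4 := by
    simp only [map_sub, map_neg, LinearMap.sub_apply, LinearMap.neg_apply, hx, he,
      lor_comm _ x]
    ring
  by_cases h : 0 < lor (x - ![1, 0, 0, 0]) (x - ![1, 0, 0, 0])
  · obtain ⟨μ, h1, -⟩ := exists_rho_swap (hx.trans he.symm) h
    exact ⟨μ, h1⟩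
  · have he' : lor (-![1, 0, 0, 0]) (-![1, 0, 0, 0]) = 1 := by
      simp only [map_neg, LinearMap.neg_apply, he]; norm_num
    obtain ⟨μ, h1, -⟩ := exists_rho_swap (hx.trans he'.symm) (by linarith)
    obtain ⟨ν, hν⟩ := exists_rho_eq_reflMat he
    refine ⟨ν * μ, ?_⟩
    rw [map_mul, ← Matrix.mulVec_mulVec, h1, hν, reflMat_mulVec, map_neg, he]
    module

/-- The functional y must vanish on the boundary line a = 0, for a positive value there would
persist slightly to the left. Vanishing on that line leaves only the first coordinate. -/
theorem eq_of_posSide_first {y : Vec4} (h : posSide y = posSide ![1, 0, 0, 0]) :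
    ∃ t : ℝ, 0 < t ∧ y = t • ![1, 0, 0, 0] := by
  have key : ∀ a b : ℝ, 0 ≤ 2 * a * y 0 + 2 * b * y 1 + (a ^ 2 + b ^ 2 - 1) * y 2 -
      (a ^ 2 + b ^ 2 + 1) * y 3 ↔ 0 ≤ a := by
    intro a b
    have h1 := Set.ext_iff.1 h ((!₂[a, b] : E2) : Rhat)
    simp only [posSide, Set.mem_ofPred_eq, nullVec_coe, lor_apply, norm_sq_E2] at h1
    simpa using h1
  have hz : ∀ b : ℝ, 2 * b * y 1 + (b ^ 2 - 1) * y 2 - (b ^ 2 + 1) * y 3 = 0 := by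
    intro b
    have h1 := (key 0 b).2 le_rfl
    set v := 2 * b * y 1 + (b ^ 2 - 1) * y 2 - (b ^ 2 + 1) * y 3 with hv
    have hv0 : 0 ≤ v := by rw [hv]; linarith
    by_contra hne
    have hvp : 0 < v := lt_of_le_of_ne hv0 (Ne.symm hne)
    -- K bounds the rate of decrease when moving left by at most 1, and ε = v / (v + K + 1) makes
    -- the total loss smaller than v.
    set K := 2 * |y 0| + |y 2 - y 3| with hK
    have hK0 : 0 ≤ K := by positivity
    set ε := v / (v + K + 1) with hε
    have hε0 : 0 < ε := by positivity
    have hε1 : ε ≤ 1 := by rw [hε, div_le_one (by positivity)]; linarith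
    have hεv : ε * (v + K + 1) = v := div_mul_cancel₀ _ (by positivity)
    have h2 : ¬ (0 ≤ 2 * (-ε) * y 0 + 2 * b * y 1 + ((-ε) ^ 2 + b ^ 2 - 1) * y 2 -
      ((-ε) ^ 2 + b ^ 2 + 1) * y 3) := by
      rw [key]; linarith
    apply h2
    have e : 2 * (-ε) * y 0 + 2 * b * y 1 + ((-ε) ^ 2 + b ^ 2 - 1) * y 2 -
      ((-ε) ^ 2 + b ^ 2 + 1) * y 3 = v - 2 * (ε * y 0) + ε ^ 2 * (y 2 - y 3) := by
      rw [hv]; ring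
    rw [e]
    have b1 : ε * y 0 ≤ ε * |y 0| := mul_le_mul_of_nonneg_left (le_abs_self _) hε0.le
    have b2 : -(ε * |y 2 - y 3|) ≤ ε ^ 2 * (y 2 - y 3) := by
      have c1 : ε ^ 2 * |y 2 - y 3| ≤ ε * |y 2 - y 3| := by
        apply mul_le_mul_of_nonneg_right _ (abs_nonneg _)
        nlinarith
      have c2 : ε ^ 2 * (-|y 2 - y 3|) ≤ ε ^ 2 * (y 2 - y 3) :=
        mul_le_mul_of_nonneg_left (neg_abs_le _) (by positivity)
      linarith
    have b3 : ε * K = 2 * (ε * |y 0|) + ε * |y 2 - y 3| := by rw [hK]; ring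
    nlinarith [mul_pos hε0 hvp]
  have h0 := hz 0
  have h1 := hz 1
  have h2 := hz (-1)
  norm_num at h0 h1 h2
  have k1 : y 1 = 0 := by linarith
  have k3 : y 3 = 0 := by linarith
  have k2 : y 2 = 0 := by linarith
  have hm := (key (-1) 0).not.2 (by norm_num)
  rw [k1, k2, k3] at hm
  refine ⟨y 0, by linarith, ?_⟩
  ext i
  fin_cases i <;> simp [k1, k2, k3]

/-- Only x is assumed spacelike; this lets apices be compared before their vectors are normalised.
-/
theorem eq_smul_of_posSide {x y : Vec4} (hx : lor x x = 1) (h : posSide y = posSide x) :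
    ∃ t : ℝ, 0 < t ∧ y = t • x := by
  obtain ⟨μ, hμ⟩ := exists_rho_to_first hx
  have h1 : posSide (rho μ *ᵥ y) = posSide ![1, 0, 0, 0] := by
    rw [← hμ, ← image_posSide, ← image_posSide, h]
  obtain ⟨t, ht, h2⟩ := eq_of_posSide_first h1
  refine ⟨t, ht, ?_⟩
  rw [← hμ, ← Matrix.mulVec_smul] at h2
  have h3 := congrArg (fun v => rho μ⁻¹ *ᵥ v) h2
  simpa only [Matrix.mulVec_mulVec, rho_inv_mul, Matrix.one_mulVec] using h3

theorem eq_of_posSide {x y : Vec4} (hx : lor x x = 1) (hy : lor y y = 1)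
    (h : posSide y = posSide x) : y = x := by
  obtain ⟨t, ht, rfl⟩ := eq_smul_of_posSide hx h
  simp only [map_smul, LinearMap.smul_apply, smul_eq_mul, hx, mul_one] at hy
  have : t = 1 := by nlinarith
  rw [this, one_smul]

/-! ### Families with equal Gram matrices -/

/-- The Gram matrix of four vectors is nondegenerate. -/
def GramNondeg (c : Fin 4 → Vec4) : Prop :=
  ∀ t : Fin 4 → ℝ, (∀ i, ∑ j, t j * lor (c i) (c j) = 0) → t = 0

/-- The matrix with given columns. -/
def colMat (c : Fin 4 → Vec4) : Mat4 := Matrix.of fun i j => c j i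

theorem colMat_mulVec (c : Fin 4 → Vec4) (t : Vec4) : colMat c *ᵥ t = ∑ j, t j • c j := by
  ext i
  simp [colMat, Matrix.mulVec, dotProduct, mul_comm]

theorem GramNondeg.isUnit {c : Fin 4 → Vec4} (h : GramNondeg c) : IsUnit (colMat c) := by
  rw [← Matrix.mulVec_injective_iff_isUnit, ← Matrix.coe_mulVecLin,
    ← LinearMap.ker_eq_bot, LinearMap.ker_eq_bot']
  intro t ht
  apply h
  intro i
  rw [Matrix.mulVecLin_apply, colMat_mulVec] at ht
  have := congrArg (lor (c i)) ht
  simpa [map_sum] using this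

theorem GramNondeg.exists_comb {c : Fin 4 → Vec4} (h : GramNondeg c) (v : Vec4) :
    ∃ t : Fin 4 → ℝ, v = ∑ j, t j • c j := by
  refine ⟨(colMat c)⁻¹ *ᵥ v, ?_⟩
  rw [← colMat_mulVec, Matrix.mulVec_mulVec, Matrix.mul_nonsing_inv, Matrix.one_mulVec]
  exact (Matrix.isUnit_iff_isUnit_det _).1 h.isUnit

theorem GramNondeg.eq_zero {c : Fin 4 → Vec4} (h : GramNondeg c) {v : Vec4}
    (hv : ∀ i, lor (c i) v = 0) : v = 0 := by
  obtain ⟨t, rfl⟩ := h.exists_comb v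
  have : t = 0 := h t fun i => by simpa [map_sum] using hv i
  simp [this]

theorem GramNondeg.congr {c d : Fin 4 → Vec4} (h : GramNondeg c)
    (hcd : ∀ i j, lor (c i) (c j) = lor (d i) (d j)) : GramNondeg d := by
  intro t ht
  exact h t fun i => by simpa only [hcd] using ht i

/-- Both families are bases, and the change of basis preserves the form because the Gram matrices
agree. -/
theorem exists_matrix_of_gram {c d : Fin 4 → Vec4} (h : GramNondeg c)
    (hcd : ∀ i j, lor (c i) (c j) = lor (d i) (d j)) :
    ∃ A : Mat4, (∀ x y, lor (A *ᵥ x) (A *ᵥ y) = lor x y) ∧ ∀ i, A *ᵥ c i = d i := by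
  have hu := (Matrix.isUnit_iff_isUnit_det _).1 h.isUnit
  have hA : ∀ i, (colMat d * (colMat c)⁻¹) *ᵥ c i = d i := by
    intro i
    have e1 : c i = colMat c *ᵥ Pi.single i 1 := by
      ext j; simp [colMat]
    have e2 : d i = colMat d *ᵥ Pi.single i 1 := by
      ext j; simp [colMat]
    rw [e1, e2, Matrix.mulVec_mulVec, Matrix.mul_assoc, Matrix.nonsing_inv_mul _ hu,
      Matrix.mul_one]
  refine ⟨colMat d * (colMat c)⁻¹, ?_, hA⟩
  intro x y
  obtain ⟨s, rfl⟩ := h.exists_comb x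
  obtain ⟨t, rfl⟩ := h.exists_comb y
  simp only [Matrix.mulVec_sum, Matrix.mulVec_smul, hA, map_sum, map_smul, LinearMap.sum_apply,
    LinearMap.smul_apply, smul_eq_mul, hcd]

theorem apply_eq_of_gram {c d : Fin 4 → Vec4} (h : GramNondeg c)
    (hcd : ∀ i j, lor (c i) (c j) = lor (d i) (d j)) {A : Mat4}
    (hA : ∀ x y, lor (A *ᵥ x) (A *ᵥ y) = lor x y) (hAc : ∀ i, A *ᵥ c i = d i) {v w : Vec4}
    (hvw : ∀ i, lor (c i) v = lor (d i) w) : A *ᵥ v = w := by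
  rw [← sub_eq_zero]
  apply (h.congr hcd).eq_zero
  intro i
  rw [map_sub, ← hvw, ← hAc, hA, sub_self]

/-- A matrix preserving the Lorentzian product and the direction of time on one null vector. -/
theorem mem_lorentz_of_null {A : Mat4} (hA : ∀ x y, lor (A *ᵥ x) (A *ᵥ y) = lor x y) {z : Vec4}
    (hz : lor z z = 0) (hz3 : 0 < z 3) (hAz : 0 < (A *ᵥ z) 3) : A ∈ lorentz := by
  rw [mem_lorentz_iff]
  refine ⟨hA, ?_⟩
  have h1 := hA (Pi.single 3 1) (Pi.single 3 1)
  have h2 := hA (Pi.single 3 1) z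
  have h3 := hA z z
  have hcol : ∀ j, (A *ᵥ Pi.single 3 1) j = A j 3 := by intro j; simp
  rw [hz] at h3
  simp only [lor_apply, hcol] at h1 h2
  simp at h1 h2
  rw [lor_apply] at h3
  generalize A *ᵥ z = y at *
  generalize A 0 3 = a at *
  generalize A 1 3 = b at *
  generalize A 2 3 = c at *
  generalize A 3 3 = d at *
  by_contra hd
  push Not at hd
  have hd1 : 0 ≤ -d * y 3 := mul_nonneg (by linarith) hAz.le
  have hle : a * y 0 + b * y 1 + c * y 2 < -(-d * y 3) := by nlinarith
  have hsq : (-d * y 3) ^ 2 < (a * y 0 + b * y 1 + c * y 2) ^ 2 := by nlinarith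
  have hcs : (a * y 0 + b * y 1 + c * y 2) ^ 2 ≤
      (a ^ 2 + b ^ 2 + c ^ 2) * (y 0 ^ 2 + y 1 ^ 2 + y 2 ^ 2) := by
    nlinarith [sq_nonneg (a * y 1 - b * y 0), sq_nonneg (a * y 2 - c * y 0),
      sq_nonneg (b * y 2 - c * y 1)]
  have e1 : a ^ 2 + b ^ 2 + c ^ 2 = d ^ 2 - 1 := by linarith
  have e2 : y 0 ^ 2 + y 1 ^ 2 + y 2 ^ 2 = y 3 ^ 2 := by linarith
  rw [e1, e2] at hcs
  nlinarith [sq_nonneg (y 3)]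

/-- Two future null vectors have nonpositive product, and are proportional if it vanishes. -/
theorem lor_null_nonpos {z w : Vec4} (hz : lor z z = 0) (hw : lor w w = 0) (hz3 : 0 < z 3)
    (hw3 : 0 < w 3) : lor z w ≤ 0 := by
  rw [lor_apply] at *
  have hcs : (z 0 * w 0 + z 1 * w 1 + z 2 * w 2) ^ 2 ≤ (z 3 * w 3) ^ 2 := by
    have : (z 0 ^ 2 + z 1 ^ 2 + z 2 ^ 2) * (w 0 ^ 2 + w 1 ^ 2 + w 2 ^ 2) = (z 3 * w 3) ^ 2 := by
      rw [show z 0 ^ 2 + z 1 ^ 2 + z 2 ^ 2 = z 3 ^ 2 by linarith,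
        show w 0 ^ 2 + w 1 ^ 2 + w 2 ^ 2 = w 3 ^ 2 by linarith]
      ring
    rw [← this]
    nlinarith [sq_nonneg (z 0 * w 1 - z 1 * w 0), sq_nonneg (z 0 * w 2 - z 2 * w 0),
      sq_nonneg (z 1 * w 2 - z 2 * w 1)]
  have := abs_le_of_sq_le_sq' hcs (by positivity)
  linarith [this.2]

/-- The equality case of Cauchy–Schwarz, written as a vanishing sum of three squares. -/
theorem eq_smul_of_lor_null {z w : Vec4} (hz : lor z z = 0) (hw : lor w w = 0) (hz3 : 0 < z 3)
    (hzw : lor z w = 0) : w = (w 3 / z 3) • z := by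
  rw [lor_apply] at *
  have key : (w 0 * z 3 - w 3 * z 0) ^ 2 + (w 1 * z 3 - w 3 * z 1) ^ 2 +
      (w 2 * z 3 - w 3 * z 2) ^ 2 = 0 := by
    linear_combination (z 3 ^ 2) * hw - 2 * (w 3 * z 3) * hzw + (w 3 ^ 2) * hz
  have k0 : w 0 * z 3 - w 3 * z 0 = 0 := by
    nlinarith [sq_nonneg (w 0 * z 3 - w 3 * z 0), sq_nonneg (w 1 * z 3 - w 3 * z 1),
      sq_nonneg (w 2 * z 3 - w 3 * z 2)]
  have k1 : w 1 * z 3 - w 3 * z 1 = 0 := by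
    nlinarith [sq_nonneg (w 0 * z 3 - w 3 * z 0), sq_nonneg (w 1 * z 3 - w 3 * z 1),
      sq_nonneg (w 2 * z 3 - w 3 * z 2)]
  have k2 : w 2 * z 3 - w 3 * z 2 = 0 := by
    nlinarith [sq_nonneg (w 0 * z 3 - w 3 * z 0), sq_nonneg (w 1 * z 3 - w 3 * z 1),
      sq_nonneg (w 2 * z 3 - w 3 * z 2)]
  ext i
  fin_cases i <;> simp <;> field_simp <;> linarith

/-! ### Flag families and their rigidity -/

/-- Unit vectors `x w`, `y w` attached to the vertex and the facet of the flag `w` of an edge-scribed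
polyhedron; the flags adjacent to `w` are `w * s₁`, `w * s₂`, `w * s₃`. -/
structure IsFamily {G : Type*} [Group G] (s₁ s₂ s₃ : G) (x y : G → Vec4) : Prop where
  unit_x : ∀ w, lor (x w) (x w) = 1
  unit_y : ∀ w, lor (y w) (y w) = 1
  x_two : ∀ w, x (w * s₂) = x w
  x_three : ∀ w, x (w * s₃) = x w
  y_one : ∀ w, y (w * s₁) = y w
  y_two : ∀ w, y (w * s₂) = y w
  edge : ∀ w, lor (x w) (x (w * s₁)) = -1
  future : ∀ w, 0 < (x w + x (w * s₁)) 3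
  incident : ∀ w, lor (x w) (y w) = 0
  nonpos : ∀ u w, lor (x u) (y w) ≤ 0
  neg : ∀ w, lor (x (w * s₃ * s₂ * s₁)) (y w) < 0

/-- Coxeter relations between the generators of the flag group which do not depend on the type. -/
structure FlagGroup {G : Type*} [Group G] (s₁ s₂ s₃ : G) : Prop where
  sq_one : s₁ * s₁ = 1
  sq_two : s₂ * s₂ = 1
  sq_three : s₃ * s₃ = 1
  comm : s₁ * s₃ = s₃ * s₁

theorem FlagGroup.reverse {G : Type*} [Group G] {s₁ s₂ s₃ : G} (h : FlagGroup s₁ s₂ s₃) :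
    FlagGroup s₃ s₂ s₁ := ⟨h.sq_three, h.sq_two, h.sq_one, h.comm.symm⟩

/-- Product -1 expresses external tangency of two disks, and the null vector a + b represents the
point of contact. -/
theorem lor_add_null {a b : Vec4} (ha : lor a a = 1) (hb : lor b b = 1) (hab : lor a b = -1) :
    lor (a + b) (a + b) = 0 := by
  simp only [map_add, LinearMap.add_apply, ha, hb, hab, lor_comm b a]; norm_num

namespace IsFamily

variable {G : Type*} [Group G] {s₁ s₂ s₃ : G} {x y : G → Vec4}

theorem right_incident (h : IsFamily s₁ s₂ s₃ x y) (w : G) : lor (x (w * s₁)) (y w) = 0 := by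
  rw [← h.y_one w]; exact h.incident _

theorem left_incident (h : IsFamily s₁ s₂ s₃ x y) (w : G) :
    lor (x (w * s₂ * s₁)) (y w) = 0 := by
  rw [← h.y_two w]; exact h.right_incident _

theorem null_future (h : IsFamily s₁ s₂ s₃ x y) (w : G) :
    lor (x w + x (w * s₁)) (x w + x (w * s₁)) = 0 :=
  lor_add_null (h.unit_x _) (h.unit_x _) (h.edge w)

/-- The neighbours of a vertex along the two edges of a facet. -/
theorem corner (h : IsFamily s₁ s₂ s₃ x y) (g : FlagGroup s₁ s₂ s₃) (w : G) :
    lor (x (w * s₁)) (x (w * s₂ * s₁)) < 1 := by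
  have e0 : x (w * s₂) = x w := h.x_two w
  have n1 := h.null_future w
  have n2 := h.null_future (w * s₂)
  have f1 := h.future w
  have f2 := h.future (w * s₂)
  rw [e0] at n2 f2
  have k := lor_null_nonpos n1 n2 f1 f2
  have ee := h.edge (w * s₂)
  rw [e0] at ee
  have key : lor (x w + x (w * s₁)) (x w + x (w * s₂ * s₁)) =
      lor (x (w * s₁)) (x (w * s₂ * s₁)) - 1 := by
    simp only [map_add, LinearMap.add_apply, h.unit_x, h.edge w, ee, lor_comm (x (w * s₁)) (x w)]
    ring
  rcases k.lt_or_eq with k | k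
  · linarith
  -- Otherwise the tangency points of the two edges coincide. The facet across the first edge
  -- contains that point, yet the other neighbour lies strictly inside it.
  exfalso
  have p := eq_smul_of_lor_null n1 n2 f1 k
  -- pair with the other facet on the first edge
  have a1 : lor (x w) (y (w * s₃)) = 0 := by
    have := h.incident (w * s₃)
    rwa [h.x_three] at this
  have a2 : lor (x (w * s₁)) (y (w * s₃)) = 0 := by
    have := h.right_incident (w * s₃)
    rwa [mul_assoc, ← g.comm, ← mul_assoc, h.x_three] at this
  have a3 : lor (x (w * s₂ * s₁)) (y (w * s₃)) < 0 := by
    have := h.neg (w * s₃)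
    rwa [mul_assoc w, g.sq_three, mul_one] at this
  have := congrArg (fun v => lor v (y (w * s₃))) p
  simp only [map_add, map_smul, LinearMap.add_apply, LinearMap.smul_apply, a1, a2] at this
  simp at this
  linarith

/-- The facets on both sides of an edge. -/
theorem dual_aux (h : IsFamily s₁ s₂ s₃ x y) (g : FlagGroup s₁ s₂ s₃) (w : G) :
    ∃ a : ℝ, 0 < a ∧ y w + y (w * s₃) = a • (x w + x (w * s₁)) := by
  have e0 : x (w * s₂) = x w := h.x_two w
  have c := h.corner g w
  have ee := h.edge (w * s₂)
  rw [e0] at ee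
  have a1 : lor (x w) (y (w * s₃)) = 0 := by
    have := h.incident (w * s₃)
    rwa [h.x_three] at this
  have a2 : lor (x (w * s₁)) (y (w * s₃)) = 0 := by
    have := h.right_incident (w * s₃)
    rwa [mul_assoc, ← g.comm, ← mul_assoc, h.x_three] at this
  have a3 : lor (x (w * s₂ * s₁)) (y (w * s₃)) < 0 := by
    have := h.neg (w * s₃)
    rwa [mul_assoc w, g.sq_three, mul_one] at this
  have a4 : lor (x (w * s₃ * s₂ * s₁)) (y (w * s₃)) = 0 := h.left_incident (w * s₃)
  have b3 := h.neg w
  have n3 := h.null_future (w * s₃ * s₂)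
  have f3 := h.future (w * s₃ * s₂)
  rw [h.x_two, h.x_three] at n3 f3
  have k3 := lor_null_nonpos (h.null_future w) n3 (h.future w) f3
  have ee3 := h.edge (w * s₃ * s₂)
  rw [h.x_two, h.x_three] at ee3
  have u := h.unit_y (w * s₃)
  have nd : GramNondeg ![x w, x (w * s₁), x (w * s₂ * s₁), y w] := by
    intro t ht
    have t0 := ht 0
    have t1 := ht 1
    have t2 := ht 2
    have t3 := ht 3
    simp [Fin.sum_univ_four, h.unit_x, h.unit_y, h.edge, ee, h.incident, h.right_incident,
      h.left_incident, lor_comm (x (w * s₁)) (x w), lor_comm (x (w * s₂ * s₁)) (x w),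
      lor_comm (x (w * s₂ * s₁)) (x (w * s₁)), lor_comm (y w)] at t0 t1 t2 t3
    set e := lor (x (w * s₁)) (x (w * s₂ * s₁))
    have z2 : t 2 * (e - 1) = 0 := by linarith
    have z2' : t 2 = 0 := by
      rcases mul_eq_zero.1 z2 with z | z
      · exact z
      · linarith
    have z1 : t 1 * (e - 1) = 0 := by rw [z2'] at t2 t0; linarith
    have z1' : t 1 = 0 := by
      rcases mul_eq_zero.1 z1 with z | z
      · exact z
      · linarith
    ext i
    fin_cases i
    · simp; linarith
    · simpa using z1'
    · simpa using z2'
    · simpa using t3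
  -- Orthogonality to the two edge vertices leaves t₀(x w + x (w s₁)) + t₃ y w. The third vertex of
  -- the facet gives t₀ > 0, unit length gives t₃² = 1, and the vertex across the edge excludes t₃ =
  -- 1.
  obtain ⟨t, ht⟩ := nd.exists_comb (y (w * s₃))
  simp [Fin.sum_univ_four] at ht
  have q0 := congrArg (lor (x w)) ht
  have q1 := congrArg (lor (x (w * s₁))) ht
  have q2 := congrArg (lor (x (w * s₂ * s₁))) ht
  have q3 := congrArg (lor (x (w * s₃ * s₂ * s₁))) ht
  simp only [map_add, map_smul, smul_eq_mul, h.unit_x, h.edge, ee, h.incident, h.right_incident,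
      h.left_incident, lor_comm (x (w * s₁)) (x w), lor_comm (x (w * s₂ * s₁)) (x w),
      lor_comm (x (w * s₂ * s₁)) (x (w * s₁)), a1, a2, LinearMap.add_apply] at q0 q1 q2 q3 k3
  simp only [ee3] at k3
  set e := lor (x (w * s₁)) (x (w * s₂ * s₁))
  have z2 : t 2 * (e - 1) = 0 := by linarith
  have z2' : t 2 = 0 := by
    rcases mul_eq_zero.1 z2 with z | z
    · exact z
    · linarith
  have z01 : t 0 = t 1 := by linarith
  rw [z2', ← z01] at ht q2 q3
  have q2' : t 0 * (e - 1) < 0 := by linarith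
  have pos : 0 < t 0 := by nlinarith
  have u' := u
  rw [ht] at u'
  simp only [map_add, map_smul, smul_eq_mul, h.unit_x, h.edge, h.incident, h.right_incident,
      lor_comm (x (w * s₁)) (x w), LinearMap.add_apply, LinearMap.smul_apply,
      h.unit_y, lor_comm (y w), zero_smul, map_zero, LinearMap.zero_apply] at u'
  have d1 : t 3 ^ 2 = 1 := by linarith
  have d2 : t 3 ≤ 0 := by
    rw [lor_comm (x (w * s₃ * s₂ * s₁)) (x w), ee3,
      lor_comm (x (w * s₃ * s₂ * s₁)) (x (w * s₁))] at q3
    have r : t 0 * (lor (x (w * s₁)) (x (w * s₃ * s₂ * s₁)) - 1) ≤ 0 := by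
      apply mul_nonpos_of_nonneg_of_nonpos pos.le
      linarith
    nlinarith
  have d3 : t 3 = -1 := by nlinarith
  refine ⟨t 0, pos, ?_⟩
  rw [ht, d3]
  module

/-- The circles of the two facets at an edge touch where the two vertex caps touch: by `dual_aux`,
the two contact vectors are positive multiples of each other. The tangency axioms for facets follow
from those for vertices. -/
theorem dual (h : IsFamily s₁ s₂ s₃ x y) (g : FlagGroup s₁ s₂ s₃) : IsFamily s₃ s₂ s₁ y x where
  unit_x := h.unit_y
  unit_y := h.unit_x
  x_two := h.y_two
  x_three := h.y_one
  y_one := h.x_three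
  y_two := h.x_two
  edge w := by
    obtain ⟨a, ha, e⟩ := h.dual_aux g w
    have := congrArg (lor (y w)) e
    simp only [map_add, map_smul, h.unit_y, lor_comm (y w) (x _), h.incident,
      h.right_incident] at this
    simp at this
    linarith
  future w := by
    obtain ⟨a, ha, e⟩ := h.dual_aux g w
    rw [e]
    exact mul_pos ha (h.future w)
  incident w := by rw [lor_comm]; exact h.incident w
  nonpos u w := by rw [lor_comm]; exact h.nonpos w u
  neg w := by
    have := h.neg (w * s₁ * s₂ * s₃)
    rw [lor_comm]
    have e : w * s₁ * s₂ * s₃ * s₃ * s₂ * s₁ = w := by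
      rw [mul_assoc _ s₃ s₃, g.sq_three, mul_one, mul_assoc _ s₂ s₂, g.sq_two, mul_one,
        mul_assoc _ s₁ s₁, g.sq_one, mul_one]
    rwa [e] at this

end IsFamily

/-- Ptolemy's relation for four null vectors of a three-dimensional space, in convex position. -/
theorem ptolemy {z₀ z₁ z₂ z₃ y₁ y₂ : Vec4} {p q r a b c : ℝ} (hz : z₃ = a • z₀ + b • z₁ + c • z₂)
    (h00 : lor z₀ z₀ = 0) (h11 : lor z₁ z₁ = 0) (h22 : lor z₂ z₂ = 0) (h33 : lor z₃ z₃ = 0)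
    (h01 : lor z₀ z₁ = -2) (h12 : lor z₁ z₂ = -2) (h23 : lor z₂ z₃ = -2)
    (h02 : lor z₀ z₂ = -2 * p ^ 2) (h13 : lor z₁ z₃ = -2 * q ^ 2) (h03 : lor z₀ z₃ = -2 * r ^ 2)
    (hp : 0 < p) (hq : 0 < q) (hr : 0 < r)
    (y12 : lor z₁ y₁ = 0 ∧ lor z₂ y₁ = 0 ∧ lor z₀ y₁ < 0 ∧ lor z₃ y₁ < 0)
    (y23 : lor z₂ y₂ = 0 ∧ lor z₃ y₂ = 0 ∧ lor z₀ y₂ ≤ 0 ∧ lor z₁ y₂ < 0) :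
    p * q = 1 + r := by
  have k1 := congrArg (fun v => lor v y₁) hz
  have k2 := congrArg (fun v => lor v y₂) hz
  simp only [map_add, map_smul, LinearMap.add_apply, LinearMap.smul_apply, smul_eq_mul, y12.1,
    y12.2.1, y23.1, y23.2.1] at k1 k2
  -- The functionals y₁ and y₂ encode convex position: y₁ vanishes on the side z₁z₂ and is negative
  -- on both other points, and similarly for y₂. This fixes the signs of a and b.
  have ha : 0 < a := by
    by_contra ha
    have := mul_nonneg_of_nonpos_of_nonpos (not_lt.1 ha) y12.2.2.1.le
    linarith [y12.2.2.2]
  have hb : b ≤ 0 := by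
    by_contra hb
    push Not at hb
    have k3 := mul_neg_of_pos_of_neg hb y23.2.2.2
    have k4 := mul_nonpos_of_nonneg_of_nonpos ha.le y23.2.2.1
    linarith
  have e0 := congrArg (lor z₀) hz
  have e1 := congrArg (lor z₁) hz
  have e2 := congrArg (lor z₂) hz
  have e3 := congrArg (lor z₃) hz
  simp only [map_add, map_smul, smul_eq_mul, h00, h01, h02, h03, h11, h12, h13, h22, h23, h33,
    lor_comm z₁ z₀, lor_comm z₂ z₀, lor_comm z₂ z₁, lor_comm z₃ z₀, lor_comm z₃ z₁,
    lor_comm z₃ z₂] at e0 e1 e2 e3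
  have f0 : b + c * p ^ 2 = r ^ 2 := by linarith
  have f1 : a + c = q ^ 2 := by linarith
  have f2 : a * p ^ 2 + b = 1 := by linarith
  have f3 : a * r ^ 2 + b * q ^ 2 + c = 0 := by linarith
  -- Nullity of z₃ gives only |b| = r; convex position then selects b = -r, that is, Ptolemy's
  -- equality for this cyclic order.
  have hb2 : b ^ 2 = r ^ 2 := by
    have e4 : p ^ 2 * q ^ 2 = 1 - b + r ^ 2 - b := by
      rw [← f1]; linear_combination f0 + f2
    have e5 : a * p ^ 2 = 1 - b := by linarith
    have e6 : c * p ^ 2 = r ^ 2 - b := by linarith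
    have e7 : (a * p ^ 2) * r ^ 2 + b * (p ^ 2 * q ^ 2) + c * p ^ 2 = 0 := by
      linear_combination p ^ 2 * f3
    rw [e4, e5, e6] at e7
    linarith [e7]
  have hbr : b = -r := by
    rcases sq_eq_sq_iff_eq_or_eq_neg.1 hb2 with h | h
    · linarith
    · exact h
  have fin : (p * q) ^ 2 = (1 + r) ^ 2 := by
    rw [mul_pow, ← f1]
    linear_combination f2 + f0 - 2 * hbr
  exact (sq_eq_sq₀ (by positivity) (by positivity)).1 fin

namespace IsFamily

variable {G : Type*} [Group G] {s₁ s₂ s₃ : G} {x y : G → Vec4}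

/-! ### Families with triangular facets -/

/-- The neighbours along the two edges of a triangular facet are adjacent. -/
theorem adj (h : IsFamily s₁ s₂ s₃ x y) (hb : s₁ * s₂ * s₁ = s₂ * s₁ * s₂) (w : G) :
    lor (x (w * s₁)) (x (w * s₂ * s₁)) = -1 := by
  have e := h.edge (w * s₁ * s₂)
  have e1 : w * s₁ * s₂ * s₁ = w * s₂ * s₁ * s₂ := by
    simp only [mul_assoc] at hb ⊢
    rw [hb]
  rwa [h.x_two, e1, h.x_two] at e

theorem edge_two (h : IsFamily s₁ s₂ s₃ x y) (w : G) : lor (x w) (x (w * s₂ * s₁)) = -1 := by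
  rw [← h.x_two w]; exact h.edge _

theorem edge_three (h : IsFamily s₁ s₂ s₃ x y) (w : G) :
    lor (x w) (x (w * s₃ * s₂ * s₁)) = -1 := by
  rw [← h.x_three w]; exact h.edge_two _

theorem future_two (h : IsFamily s₁ s₂ s₃ x y) (w : G) : 0 < (x w + x (w * s₂ * s₁)) 3 := by
  rw [← h.x_two w]; exact h.future _

theorem future_three (h : IsFamily s₁ s₂ s₃ x y) (w : G) :
    0 < (x w + x (w * s₃ * s₂ * s₁)) 3 := by
  rw [← h.x_three w]; exact h.future_two _

/-- If the product were 1, the tangency points on the two outer edges would coincide and lie on the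
facet of w, contradicting strictness at the vertex across the edge. -/
theorem cross_lt (h : IsFamily s₁ s₂ s₃ x y) (w : G) :
    lor (x (w * s₃ * s₂ * s₁)) (x (w * s₂ * s₁)) < 1 := by
  have n1 := lor_add_null (h.unit_x w) (h.unit_x _) (h.edge_two w)
  have n2 := lor_add_null (h.unit_x w) (h.unit_x _) (h.edge_three w)
  have k := lor_null_nonpos n1 n2 (h.future_two w) (h.future_three w)
  have key : lor (x w + x (w * s₂ * s₁)) (x w + x (w * s₃ * s₂ * s₁)) =
      lor (x (w * s₃ * s₂ * s₁)) (x (w * s₂ * s₁)) - 1 := by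
    simp only [map_add, LinearMap.add_apply, h.unit_x, h.edge_two w, h.edge_three w,
      lor_comm (x (w * s₂ * s₁))]
    ring
  rcases k.lt_or_eq with k | k
  · linarith
  exfalso
  have p := eq_smul_of_lor_null n1 n2 (h.future_two w) k
  have := congrArg (fun v => lor v (y w)) p
  simp only [map_add, map_smul, LinearMap.add_apply, LinearMap.smul_apply, h.incident,
    h.left_incident] at this
  simp at this
  linarith [h.neg w]

variable (s₁ s₂ s₃ x) in
/-- The parameter of an edge, measuring the separation of the two opposite vertices. -/
def sep (w : G) : ℝ :=
  Real.sqrt ((1 - lor (x (w * s₃ * s₂ * s₁)) (x (w * s₂ * s₁))) / 2)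

theorem sep_pos (h : IsFamily s₁ s₂ s₃ x y) (w : G) : 0 < sep s₁ s₂ s₃ x w := by
  apply Real.sqrt_pos.2
  linarith [h.cross_lt w]

theorem cross_eq (h : IsFamily s₁ s₂ s₃ x y) (w : G) :
    lor (x (w * s₃ * s₂ * s₁)) (x (w * s₂ * s₁)) = 1 - 2 * sep s₁ s₂ s₃ x w ^ 2 := by
  rw [sep, Real.sq_sqrt]
  · ring
  · linarith [h.cross_lt w]

/-- With `sep_one` this shows that the parameter belongs to the edge: s₁ and s₃ move among the flags
of one edge. -/
theorem sep_three (g : FlagGroup s₁ s₂ s₃) (w : G) :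
    sep s₁ s₂ s₃ x (w * s₃) = sep s₁ s₂ s₃ x w := by
  rw [sep, sep, mul_assoc w s₃ s₃, g.sq_three, mul_one, lor_comm]

theorem sep_one (h : IsFamily s₁ s₂ s₃ x y) (g : FlagGroup s₁ s₂ s₃)
    (hb : s₁ * s₂ * s₁ = s₂ * s₁ * s₂) (w : G) :
    sep s₁ s₂ s₃ x (w * s₁) = sep s₁ s₂ s₃ x w := by
  have e1 : w * s₁ * s₂ * s₁ = w * s₂ * s₁ * s₂ := by
    simp only [mul_assoc] at hb ⊢
    rw [hb]
  have e2 : w * s₁ * s₃ * s₂ * s₁ = w * s₃ * s₂ * s₁ * s₂ := by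
    have c := g.comm
    simp only [mul_assoc] at hb ⊢
    rw [← mul_assoc s₁ s₃, c, mul_assoc, hb]
  rw [sep, sep, e1, e2, h.x_two, h.x_two]

/-- The tangency points with four consecutive neighbours lie on the boundary circle of the vertex
cap. Consecutive neighbours touch, so three sides are 1, the two diagonals are edge parameters and
the fourth side is r; `ptolemy` applies. -/
theorem sep_mul (h : IsFamily s₁ s₂ s₃ x y) (g : FlagGroup s₁ s₂ s₃)
    (hb : s₁ * s₂ * s₁ = s₂ * s₁ * s₂) (w : G) {r : ℝ} (hr : 0 < r)
    (hrr : lor (x (w * s₃ * s₂ * s₁)) (x (w * s₂ * s₃ * s₂ * s₁)) = 1 - 2 * r ^ 2) :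
    sep s₁ s₂ s₃ x w * sep s₁ s₂ s₃ x (w * s₂) = 1 + r := by
  have x22 : x (w * s₂ * s₃) = x w := by rw [h.x_three, h.x_two]
  have s23 : sep s₁ s₂ s₃ x (w * s₂ * s₃) = sep s₁ s₂ s₃ x (w * s₂) := sep_three g _
  -- the four neighbours
  have E0 := h.edge_three w
  have E1 := h.edge w
  have E2 := h.edge_two w
  have E3 := h.edge_two (w * s₂ * s₃)
  rw [x22] at E3
  have A01 : lor (x (w * s₃ * s₂ * s₁)) (x (w * s₁)) = -1 := by
    have := h.adj hb (w * s₃)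
    rw [mul_assoc w s₃ s₁, ← g.comm, ← mul_assoc, h.x_three] at this
    rwa [lor_comm]
  have A12 := h.adj hb w
  have A23 : lor (x (w * s₂ * s₁)) (x (w * s₂ * s₃ * s₂ * s₁)) = -1 := by
    have := h.adj hb (w * s₂ * s₃)
    rwa [mul_assoc (w * s₂) s₃ s₁, ← g.comm, ← mul_assoc, h.x_three] at this
  have A02 := h.cross_eq w
  have A13 : lor (x (w * s₁)) (x (w * s₂ * s₃ * s₂ * s₁)) =
      1 - 2 * sep s₁ s₂ s₃ x (w * s₂) ^ 2 := by
    have := h.cross_eq (w * s₂)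
    rw [mul_assoc w s₂ s₂, g.sq_two, mul_one] at this
    rwa [lor_comm]
  have hp := h.sep_pos w
  have hq := h.sep_pos (w * s₂)
  have I0 := h.neg w
  have I1 := h.right_incident w
  have I2 := h.left_incident w
  have I3 : lor (x (w * s₂ * s₃ * s₂ * s₁)) (y w) < 0 := by
    have := h.neg (w * s₂)
    rwa [h.y_two] at this
  have J2 : lor (x (w * s₂ * s₁)) (y (w * s₂ * s₃)) = 0 := by
    have := h.right_incident (w * s₂ * s₃)
    rwa [mul_assoc (w * s₂) s₃ s₁, ← g.comm, ← mul_assoc, h.x_three] at this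
  have J3 : lor (x (w * s₂ * s₃ * s₂ * s₁)) (y (w * s₂ * s₃)) = 0 :=
    h.left_incident (w * s₂ * s₃)
  have J0 : lor (x (w * s₃ * s₂ * s₁)) (y (w * s₂ * s₃)) ≤ 0 := h.nonpos _ _
  have J1 : lor (x (w * s₁)) (y (w * s₂ * s₃)) < 0 := by
    have := h.neg (w * s₂ * s₃)
    rwa [mul_assoc (w * s₂) s₃ s₃, g.sq_three, mul_one, mul_assoc w s₂ s₂, g.sq_two,
      mul_one] at this
  have K0 := h.incident w
  have K1 : lor (x w) (y (w * s₂ * s₃)) = 0 := by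
    have := h.incident (w * s₂ * s₃)
    rwa [x22] at this
  have ux := h.unit_x w
  have u0 := h.unit_x (w * s₃ * s₂ * s₁)
  have u1 := h.unit_x (w * s₁)
  have u2 := h.unit_x (w * s₂ * s₁)
  have u3 := h.unit_x (w * s₂ * s₃ * s₂ * s₁)
  generalize sep s₁ s₂ s₃ x w = p at *
  generalize sep s₁ s₂ s₃ x (w * s₂) = q at *
  generalize x (w * s₃ * s₂ * s₁) = n₀ at *
  generalize x (w * s₁) = n₁ at *
  generalize x (w * s₂ * s₁) = n₂ at *
  generalize x (w * s₂ * s₃ * s₂ * s₁) = n₃ at *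
  generalize y (w * s₂ * s₃) = y₂ at *
  generalize y w = y₁ at *
  generalize x w = v at *
  have B : ∀ a b, lor v a = -1 → lor v b = -1 → lor (v + a) (v + b) = lor a b - 1 := by
    intro a b ha hb
    simp only [map_add, LinearMap.add_apply, ux, ha, hb, lor_comm a v]
    ring
  have B' : ∀ a, lor v a = -1 → lor v (v + a) = 0 := by
    intro a ha
    rw [map_add, ux, ha]; norm_num
  have nd : GramNondeg ![v, v + n₀, v + n₁, v + n₂] := by
    intro t ht
    have t0 := ht 0
    have t1 := ht 1
    have t2 := ht 2
    have t3 := ht 3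
    simp only [Fin.sum_univ_four, Matrix.cons_val, lor_comm (v + _) v, B' _ E0, B' _ E1, B' _ E2,
      ux, B _ _ E0 E0, B _ _ E0 E1, B _ _ E0 E2, B _ _ E1 E0, B _ _ E1 E1, B _ _ E1 E2,
      B _ _ E2 E0, B _ _ E2 E1, B _ _ E2 E2, u0, u1, u2, A01, A12, A02, lor_comm n₁ n₀,
      lor_comm n₂ n₀, lor_comm n₂ n₁] at t0 t1 t2 t3
    have c0 : t 0 = 0 := by linarith
    have c31 : t 3 = -t 1 := by linarith
    rw [c31] at t1 t3
    have c1 : t 1 * p ^ 2 = 0 := by linarith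
    have c1' : t 1 = 0 := by
      rcases mul_eq_zero.1 c1 with z | z
      · exact z
      · exact absurd z (by positivity)
    rw [c1'] at t1 c31
    ext i
    fin_cases i
    · exact c0
    · exact c1'
    · simp; linarith
    · simpa using c31
  obtain ⟨t, ht⟩ := nd.exists_comb (v + n₃)
  simp only [Fin.sum_univ_four, Matrix.cons_val] at ht
  -- All four tangency vectors are orthogonal to v, so the coefficient of v vanishes and the
  -- relation lives in three dimensions.
  have c0 := congrArg (lor v) ht
  simp only [map_add _ (t 0 • v + _ + _) _, map_add _ (t 0 • v + _) _, map_add _ (t 0 • v) _,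
    map_smul, B' _ E0, B' _ E1, B' _ E2, B' _ E3, ux] at c0
  simp at c0
  rw [← c0, zero_smul, zero_add] at ht
  have D : ∀ a b, lor v b = 0 → lor (v + a) b = lor a b := by
    intro a b hb
    rw [map_add, LinearMap.add_apply, hb, zero_add]
  refine ptolemy (y₁ := y₁) (y₂ := y₂) ht ?_ ?_ ?_ ?_ ?_ ?_ ?_ ?_ ?_ ?_ hp hq hr ⟨?_, ?_, ?_, ?_⟩
    ⟨?_, ?_, ?_, ?_⟩
  · rw [B _ _ E0 E0, u0]; norm_num
  · rw [B _ _ E1 E1, u1]; norm_num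
  · rw [B _ _ E2 E2, u2]; norm_num
  · rw [B _ _ E3 E3, u3]; norm_num
  · rw [B _ _ E0 E1, A01]; norm_num
  · rw [B _ _ E1 E2, A12]; norm_num
  · rw [B _ _ E2 E3, A23]; norm_num
  · rw [B _ _ E0 E2, A02]; ring
  · rw [B _ _ E1 E3, A13]; ring
  · rw [B _ _ E0 E3, hrr]; ring
  · rw [D _ _ K0, I1]
  · rw [D _ _ K0, I2]
  · rw [D _ _ K0]; exact I0
  · rw [D _ _ K0]; exact I3
  · rw [D _ _ K1, J2]
  · rw [D _ _ K1, J3]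
  · rw [D _ _ K1]; exact J0
  · rw [D _ _ K1]; exact J1

/-- Three triangles at each vertex. -/
theorem sep_of_three (h : IsFamily s₁ s₂ s₃ x y) (g : FlagGroup s₁ s₂ s₃)
    (hb : s₁ * s₂ * s₁ = s₂ * s₁ * s₂) (hq : (s₂ * s₃) ^ 3 = 1) (w : G) :
    sep s₁ s₂ s₃ x w = 1 := by
  have e : s₃ * s₂ * s₃ = s₂ * s₃ * s₂ := by
    have h1 : s₂ * s₃ * (s₂ * s₃) * (s₂ * s₃) = 1 := by rw [← hq]; simp [pow_succ]
    have h2 : s₃ * s₂ * s₃ = s₃ * s₂ * s₃ * (s₃ * s₂ * s₃ * (s₂ * s₃ * s₂))⁻¹ *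
        (s₃ * s₂ * s₃ * (s₂ * s₃ * s₂)) := by group
    have h3 : s₃ * s₂ * s₃ * (s₂ * s₃ * s₂) = 1 := by
      have : s₃ * s₂ * s₃ * (s₂ * s₃ * s₂) = s₂⁻¹ * (s₂ * s₃ * (s₂ * s₃) * (s₂ * s₃)) * s₂ := by
        group
      rw [this, h1]; group
    have h4 : s₂ * s₃ * s₂ * (s₂ * s₃ * s₂) = 1 := by
      rw [mul_assoc (s₂ * s₃), ← mul_assoc s₂ (s₂ * s₃), ← mul_assoc s₂ s₂, g.sq_two, one_mul,
        mul_assoc, ← mul_assoc s₃ s₃, g.sq_three, one_mul, g.sq_two]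
    exact mul_right_cancel (h3.trans h4.symm)
  -- After three facets the circuit around the vertex closes, so the two neighbours opposite the
  -- edge touch and 1 - 2d² = -1.
  have e2 : x (w * s₃ * s₂ * s₁) = x (w * s₂ * s₃ * s₂ * s₁) := by
    have : w * s₃ * s₂ * s₁ * s₃ = w * s₂ * s₃ * s₂ * s₁ := by
      simp only [mul_assoc] at e ⊢
      rw [g.comm, ← mul_assoc s₂ s₃, ← mul_assoc s₃ (s₂ * s₃), e]
      simp only [mul_assoc]
    rw [← h.x_three, this]
  have A23 : lor (x (w * s₂ * s₁)) (x (w * s₂ * s₃ * s₂ * s₁)) = -1 := by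
    have := h.adj hb (w * s₂ * s₃)
    rwa [mul_assoc (w * s₂) s₃ s₁, ← g.comm, ← mul_assoc, h.x_three] at this
  have c := h.cross_eq w
  rw [e2, lor_comm, A23] at c
  nlinarith [h.sep_pos w]

/-- Four triangles at each vertex. -/
theorem sep_of_four (h : IsFamily s₁ s₂ s₃ x y) (g : FlagGroup s₁ s₂ s₃)
    (hb : s₁ * s₂ * s₁ = s₂ * s₁ * s₂) (hq : (s₂ * s₃) ^ 4 = 1) (w : G) :
    sep s₁ s₂ s₃ x w = Real.sqrt 2 := by
  have e : s₂ * s₃ * s₂ * s₃ = s₃ * s₂ * s₃ * s₂ := by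
    have h1 : s₂ * s₃ * (s₂ * s₃) * (s₂ * s₃) * (s₂ * s₃) = 1 := by rw [← hq]; simp [pow_succ]
    have i2 : s₂⁻¹ = s₂ := inv_eq_of_mul_eq_one_left g.sq_two
    have i3 : s₃⁻¹ = s₃ := inv_eq_of_mul_eq_one_left g.sq_three
    have h2 : s₂ * s₃ * s₂ * s₃ = s₃⁻¹ * s₂⁻¹ * s₃⁻¹ * s₂⁻¹ := by
      calc s₂ * s₃ * s₂ * s₃ = s₂ * s₃ * (s₂ * s₃) * (s₂ * s₃) * (s₂ * s₃) *
            (s₃⁻¹ * s₂⁻¹ * s₃⁻¹ * s₂⁻¹) := by group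
        _ = _ := by rw [h1, one_mul]
    rwa [i2, i3] at h2
  have rel : ∀ u, sep s₁ s₂ s₃ x u * sep s₁ s₂ s₃ x (u * s₂) = 2 := by
    intro u
    -- With four neighbours the first and the last touch, so the fourth side is 1 and two
    -- consecutive edges have product 2.
    have A : lor (x (u * s₃ * s₂ * s₁)) (x (u * s₂ * s₃ * s₂ * s₁)) = 1 - 2 * (1 : ℝ) ^ 2 := by
      have h1 := h.adj hb (u * s₃ * s₂ * s₃)
      have h2 : x (u * s₃ * s₂ * s₃ * s₁) = x (u * s₃ * s₂ * s₁) := by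
        rw [mul_assoc _ s₃ s₁, ← g.comm, ← mul_assoc, h.x_three]
      have h3 : x (u * s₃ * s₂ * s₃ * s₂ * s₁) = x (u * s₂ * s₃ * s₂ * s₁) := by
        have : u * s₃ * s₂ * s₃ * s₂ * s₁ = u * s₂ * s₃ * s₂ * s₁ * s₃ := by
          simp only [mul_assoc] at e ⊢
          rw [g.comm]
          have e' : s₃ * (s₂ * (s₃ * (s₂ * s₁))) = s₂ * (s₃ * (s₂ * (s₃ * s₁))) := by
            have := congrArg (· * s₁) e
            simpa only [mul_assoc] using this.symm
          rw [e']
        rw [this, h.x_three]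
      rw [h2, h3] at h1
      rw [h1]; norm_num
    rw [h.sep_mul g hb u one_pos A]; norm_num
  have p0 := h.sep_pos w
  have p1 := h.sep_pos (w * s₂)
  have p2 := h.sep_pos (w * s₁ * s₂)
  have r0 := rel w
  have r1 := rel (w * s₁)
  have r2 := rel (w * s₂ * s₁)
  have hbw : w * s₂ * s₁ * s₂ = w * s₁ * s₂ * s₁ := by
    simp only [mul_assoc] at hb ⊢
    rw [hb]
  rw [h.sep_one g hb] at r1
  rw [h.sep_one g hb, hbw, h.sep_one g hb] at r2
  set A := sep s₁ s₂ s₃ x w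
  set B := sep s₁ s₂ s₃ x (w * s₂)
  set C := sep s₁ s₂ s₃ x (w * s₁ * s₂)
  -- A, B, C belong to the three sides of one triangle; as all pairwise products are 2, they are
  -- equal.
  have hBC : B = C := by
    have : A * (B - C) = 0 := by linarith
    rcases mul_eq_zero.1 this with z | z <;> linarith
  have hAB : A = B := by
    have : B * (A - B) = 0 := by rw [← hBC] at r2; linarith
    rcases mul_eq_zero.1 this with z | z <;> linarith
  rw [← hAB] at r0
  rw [eq_comm, Real.sqrt_eq_iff_mul_self_eq (by norm_num) p0.le]
  linarith

end IsFamily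

/-! ### Five triangles at each vertex -/

theorem pentagon_ge {a b d : ℝ} (h : a * b = 1 + d) (ha : Real.goldenRatio ≤ a)
    (hb : Real.goldenRatio ≤ b) : Real.goldenRatio ≤ d := by
  have h2 := Real.goldenRatio_sq
  have h0 := Real.goldenRatio_pos
  nlinarith [mul_le_mul ha hb h0.le (h0.le.trans ha)]

theorem pentagon_lt {a b d : ℝ} (h : a * b = 1 + d) (ha0 : 0 < a) (ha : a < Real.goldenRatio)
    (hb0 : 0 < b) (hb : b < Real.goldenRatio) : d < Real.goldenRatio := by
  have h2 := Real.goldenRatio_sq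
  have : a * b < Real.goldenRatio * Real.goldenRatio := mul_lt_mul'' ha hb ha0.le hb0.le
  nlinarith

/-- In terms of the excesses over φ, the sum of the relations reads (2φ - 1)·(sum of excesses) +
(nonnegative products) = 0. -/
theorem pentagon_all_ge {a b c d e : ℝ} (h0 : a * b = 1 + d) (h1 : b * c = 1 + e)
    (h2 : c * d = 1 + a) (h3 : d * e = 1 + b) (h4 : e * a = 1 + c)
    (ha : Real.goldenRatio ≤ a) (hb : Real.goldenRatio ≤ b) (hc : Real.goldenRatio ≤ c)
    (hd : Real.goldenRatio ≤ d) (he : Real.goldenRatio ≤ e) :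
    a = Real.goldenRatio ∧ b = Real.goldenRatio := by
  have hs := Real.goldenRatio_sq
  have hg := Real.one_lt_goldenRatio
  set φ := Real.goldenRatio
  obtain ⟨a', rfl⟩ : ∃ t, a = φ + t := ⟨a - φ, by ring⟩
  obtain ⟨b', rfl⟩ : ∃ t, b = φ + t := ⟨b - φ, by ring⟩
  obtain ⟨c', rfl⟩ : ∃ t, c = φ + t := ⟨c - φ, by ring⟩
  obtain ⟨d', rfl⟩ : ∃ t, d = φ + t := ⟨d - φ, by ring⟩
  obtain ⟨e', rfl⟩ : ∃ t, e = φ + t := ⟨e - φ, by ring⟩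
  have A : 0 ≤ a' := by linarith
  have B : 0 ≤ b' := by linarith
  have C : 0 ≤ c' := by linarith
  have D : 0 ≤ d' := by linarith
  have E : 0 ≤ e' := by linarith
  have S : (2 * φ - 1) * (a' + b' + c' + d' + e') +
      (a' * b' + b' * c' + c' * d' + d' * e' + e' * a') = 0 := by
    linear_combination h0 + h1 + h2 + h3 + h4 - 5 * hs
  have S2 : 0 ≤ a' * b' + b' * c' + c' * d' + d' * e' + e' * a' := by positivity
  have S3 : a' + b' + c' + d' + e' ≤ 0 := by nlinarith
  constructor <;> linarith

/-- If b ≤ a, then 1 + a = cd < φd = φ(ab - 1) ≤ φ(a² - 1), which forces a > 1 + 1/φ = φ. The case a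
≤ b is the same with de in place of cd. -/
theorem pentagon_not_all_lt {a b c d e : ℝ} (h0 : a * b = 1 + d)
    (h2 : c * d = 1 + a) (h3 : d * e = 1 + b)
    (ha0 : 0 < a) (hb0 : 0 < b) (hc0 : 0 < c) (hd0 : 0 < d) (he0 : 0 < e)
    (ha : a < Real.goldenRatio) (hb : b < Real.goldenRatio) (hc : c < Real.goldenRatio)
    (hd : d < Real.goldenRatio) (he : e < Real.goldenRatio) : False := by
  have hs := Real.goldenRatio_sq
  have hg := Real.one_lt_goldenRatio
  set φ := Real.goldenRatio
  have k0 : a * b < φ * b := mul_lt_mul_of_pos_right ha hb0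
  have k1 : b * c < φ * c := mul_lt_mul_of_pos_right hb hc0
  have k2 : c * d < φ * d := mul_lt_mul_of_pos_right hc hd0
  have k3 : d * e < φ * e := mul_lt_mul_of_pos_right hd he0
  have k4 : e * a < φ * a := mul_lt_mul_of_pos_right he ha0
  have hsum : a + b + c + d + e < 5 * φ := by linarith
  nlinarith

/-- In a cyclic sequence of five signs subject to the pentagon rule and not constant, at most one
pair of consecutive signs agrees. -/
theorem pentagon_signs : ∀ a b c d e : Bool, (a = b → d = a) → (b = c → e = b) → (c = d → a = c) →
    (d = e → b = d) → (e = a → c = e) → ¬ (a = b ∧ b = c ∧ c = d ∧ d = e) →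
    (if a = b then 1 else 0) + (if b = c then 1 else 0) + (if c = d then 1 else 0) +
      (if d = e then 1 else 0) + (if e = a then 1 else 0) ≤ 1 := by decide

theorem triangle_signs : ∀ a b c : Bool,
    1 ≤ (if a = b then 1 else 0) + (if a = c then 1 else 0) + (if b = c then 1 else 0) := by decide

namespace IsFamily

variable {G : Type*} [Group G] {s₁ s₂ s₃ : G} {x y : G → Vec4}

/-- With five neighbours, the first and the fourth are also two steps apart the other way round, so
the fourth side in `sep_mul` is itself an edge parameter. -/
theorem sep_pentagon (h : IsFamily s₁ s₂ s₃ x y) (g : FlagGroup s₁ s₂ s₃)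
    (hb : s₁ * s₂ * s₁ = s₂ * s₁ * s₂) (hq : (s₂ * s₃) ^ 5 = 1) (u : G) :
    sep s₁ s₂ s₃ x u * sep s₁ s₂ s₃ x (u * s₂) =
      1 + sep s₁ s₂ s₃ x (u * (s₂ * s₃) ^ 3) := by
  have i2 : s₂⁻¹ = s₂ := inv_eq_of_mul_eq_one_left g.sq_two
  have i3 : s₃⁻¹ = s₃ := inv_eq_of_mul_eq_one_left g.sq_three
  have e3 : (s₂ * s₃) ^ 3 = s₃ * s₂ * s₃ * s₂ := by
    calc (s₂ * s₃) ^ 3 = (s₂ * s₃) ^ 5 * (s₃⁻¹ * s₂⁻¹ * s₃⁻¹ * s₂⁻¹) := by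
          simp only [pow_succ, pow_zero]; group
      _ = _ := by rw [hq, one_mul, i2, i3]
  have e3' : (s₂ * s₃) ^ 3 * s₃ * s₂ = s₂ * s₃ * s₂ * s₃ := by
    calc (s₂ * s₃) ^ 3 * s₃ * s₂ = (s₂ * s₃) ^ 3 * s₃⁻¹ * s₂⁻¹ := by rw [i2, i3]
      _ = _ := by simp only [pow_succ, pow_zero]; group
  apply h.sep_mul g hb u (h.sep_pos _)
  have c := h.cross_eq (u * (s₂ * s₃) ^ 3)
  have f1 : x (u * (s₂ * s₃) ^ 3 * s₃ * s₂ * s₁) = x (u * s₂ * s₃ * s₂ * s₁) := by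
    rw [mul_assoc u, mul_assoc u, e3', ← h.x_three (u * s₂ * s₃ * s₂ * s₁)]
    simp only [mul_assoc, g.comm]
  have f2 : x (u * (s₂ * s₃) ^ 3 * s₂ * s₁) = x (u * s₃ * s₂ * s₁) := by
    rw [e3, ← h.x_three (u * s₃ * s₂ * s₁)]
    have : u * (s₃ * s₂ * s₃ * s₂) * s₂ * s₁ = u * s₃ * s₂ * s₁ * s₃ := by
      rw [← mul_assoc, mul_assoc _ s₂ s₂, g.sq_two, mul_one, mul_assoc _ s₁ s₃, g.comm]
      simp only [mul_assoc]
    rw [this]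
  rw [f1, f2, lor_comm] at c
  exact c

theorem sep_two (g : FlagGroup s₁ s₂ s₃) (w : G) :
    sep s₁ s₂ s₃ x (w * s₂) = sep s₁ s₂ s₃ x (w * (s₂ * s₃)) := by
  rw [← mul_assoc, sep_three g]

theorem sep_pentagon_all (h : IsFamily s₁ s₂ s₃ x y) (g : FlagGroup s₁ s₂ s₃)
    (hb : s₁ * s₂ * s₁ = s₂ * s₁ * s₂) (hq : (s₂ * s₃) ^ 5 = 1) (w : G) (k : ℕ) :
    sep s₁ s₂ s₃ x (w * (s₂ * s₃) ^ k) * sep s₁ s₂ s₃ x (w * (s₂ * s₃) ^ (k + 1)) =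
      1 + sep s₁ s₂ s₃ x (w * (s₂ * s₃) ^ (k + 3)) := by
  have := h.sep_pentagon g hb hq (w * (s₂ * s₃) ^ k)
  rwa [sep_two g, mul_assoc, mul_assoc, ← pow_succ, ← pow_add] at this

theorem sep_pentagon_five (h : IsFamily s₁ s₂ s₃ x y) (g : FlagGroup s₁ s₂ s₃)
    (hb : s₁ * s₂ * s₁ = s₂ * s₁ * s₂) (hq : (s₂ * s₃) ^ 5 = 1) (w : G) {a b c d e : ℝ}
    (ha : sep s₁ s₂ s₃ x w = a) (hb' : sep s₁ s₂ s₃ x (w * (s₂ * s₃)) = b)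
    (hc : sep s₁ s₂ s₃ x (w * (s₂ * s₃) ^ 2) = c) (hd : sep s₁ s₂ s₃ x (w * (s₂ * s₃) ^ 3) = d)
    (he : sep s₁ s₂ s₃ x (w * (s₂ * s₃) ^ 4) = e) :
    a * b = 1 + d ∧ b * c = 1 + e ∧ c * d = 1 + a ∧ d * e = 1 + b ∧ e * a = 1 + c := by
  have r := h.sep_pentagon_all g hb hq w
  have p6 : (s₂ * s₃) ^ 6 = s₂ * s₃ := by rw [pow_succ, hq, one_mul]
  have p7 : (s₂ * s₃) ^ 7 = (s₂ * s₃) ^ 2 := by rw [pow_succ, p6, pow_two]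
  have r0 := r 0
  have r1 := r 1
  have r2 := r 2
  have r3 := r 3
  have r4 := r 4
  norm_num [hq, p6, p7, ha, hb', hc, hd, he] at r0 r1 r2 r3 r4
  exact ⟨r0, r1, r2, r3, r4⟩

/-- Either two consecutive edges at some vertex are golden, and goldenness spreads to all flags, or
no vertex has constant sign relative to φ, which a double count of corners refutes. -/
theorem sep_of_five [Finite G] (h : IsFamily s₁ s₂ s₃ x y) (g : FlagGroup s₁ s₂ s₃)
    (hgen : ∀ p : G → Prop, p 1 → (∀ w, p w → p (w * s₁) ∧ p (w * s₂) ∧ p (w * s₃)) → ∀ w, p w)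
    (hb : s₁ * s₂ * s₁ = s₂ * s₁ * s₂) (hq : (s₂ * s₃) ^ 5 = 1) (w : G) :
    sep s₁ s₂ s₃ x w = Real.goldenRatio := by
  have hs := Real.goldenRatio_sq
  have hg := Real.one_lt_goldenRatio
  have hbw : ∀ u : G, u * s₂ * s₁ * s₂ = u * s₁ * s₂ * s₁ := by
    intro u
    simp only [mul_assoc] at hb ⊢
    rw [hb]
  have hc5 : (s₂ * s₃) ^ 4 = s₃ * s₂ := by
    have : (s₂ * s₃) ^ 4 * (s₂ * s₃) = s₃ * s₂ * (s₂ * s₃) := by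
      rw [← pow_succ, hq, mul_assoc, ← mul_assoc s₂ s₂, g.sq_two, one_mul, g.sq_three]
    exact mul_right_cancel this
  set D := sep s₁ s₂ s₃ x with hD
  have pos : ∀ u, 0 < D u := h.sep_pos
  have D1 : ∀ u, D (u * s₁) = D u := h.sep_one g hb
  have D2 : ∀ u, D (u * s₂) = D (u * (s₂ * s₃)) := sep_two g
  have D3 : ∀ u, D (u * s₃) = D u := sep_three g
  let Z : G → Prop := fun u => D u = Real.goldenRatio ∧ D (u * s₂) = Real.goldenRatio
  by_cases hZ : ∃ u, Z u
  · obtain ⟨u, hu⟩ := hZ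
    have Z2 : ∀ v, Z v → Z (v * s₂) := by
      rintro v ⟨h1, h2⟩
      exact ⟨h2, by rw [mul_assoc, g.sq_two, mul_one]; exact h1⟩
    have Z3 : ∀ v, Z v → Z (v * s₃) := by
      rintro v ⟨h1, h2⟩
      refine ⟨by rw [D3]; exact h1, ?_⟩
      rw [D2] at h2
      obtain ⟨r0, -, r2, r3, -⟩ := h.sep_pentagon_five g hb hq v h1 h2 rfl rfl rfl
      rw [hc5, ← mul_assoc] at r3
      set φ := Real.goldenRatio
      change _ * D (v * s₃ * s₂) = _ at r3
      have e1 : sep s₁ s₂ s₃ x (v * (s₂ * s₃) ^ 3) = φ := by nlinarith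
      rw [e1] at r3
      have : φ * (D (v * s₃ * s₂) - φ) = 0 := by linarith
      rcases mul_eq_zero.1 this with z | z <;> linarith
    have Zc : ∀ (k : ℕ) v, Z v → Z (v * (s₂ * s₃) ^ k) := by
      intro k
      induction k with
      | zero => intro v hv; simpa using hv
      | succ k ih =>
        intro v hv
        rw [pow_succ, ← mul_assoc, ← mul_assoc]
        exact Z3 _ (Z2 _ (ih v hv))
    -- the edges of the link of a vertex all of whose edges are golden
    have L : ∀ v, Z v → (D (v * s₁ * s₂) - (Real.goldenRatio - 1)) *
        (D (v * s₃ * s₁ * s₂) - (Real.goldenRatio - 1)) = 1 := by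
      rintro v ⟨h1, -⟩
      have h1' : D (v * s₁) = Real.goldenRatio := by rw [D1]; exact h1
      obtain ⟨r0, r1, r2, r3, r4⟩ := h.sep_pentagon_five g hb hq (v * s₁) h1' rfl rfl rfl rfl
      have hE : v * s₁ * (s₂ * s₃) ^ 4 = v * s₃ * s₁ * s₂ := by
        rw [hc5, ← mul_assoc, mul_assoc v s₁ s₃, g.comm, ← mul_assoc]
      rw [hE] at r1 r3 r4
      change _ * D (v * s₃ * s₁ * s₂) = _ at r3
      change D (v * s₃ * s₁ * s₂) * _ = _ at r4
      change D (v * s₁ * (s₂ * s₃)) * _ = 1 + D (v * s₃ * s₁ * s₂) at r1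
      change _ * D (v * s₁ * (s₂ * s₃)) = _ at r0
      change _ = 1 + D (v * s₁ * (s₂ * s₃)) at r3
      rw [← D2] at r0 r1 r3
      set φ := Real.goldenRatio
      set B := D (v * s₁ * s₂)
      set E := D (v * s₃ * s₁ * s₂)
      set C := sep s₁ s₂ s₃ x (v * s₁ * (s₂ * s₃) ^ 2)
      set D' := sep s₁ s₂ s₃ x (v * s₁ * (s₂ * s₃) ^ 3)
      have hC : C = E * φ - 1 := by linarith
      rw [hC] at r1
      have : φ * ((B - (φ - 1)) * (E - (φ - 1)) - 1) = 0 := by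
        linear_combination r1 + (φ - 1 - B - E) * hs
      rcases mul_eq_zero.1 this with z | z <;> linarith
    have L2 : ∀ v, D (v * s₂ * s₁ * s₂) = D (v * s₁ * s₂) := by
      intro v
      rw [hbw, D1]
    have Z1 : ∀ v, Z v → Z (v * s₁) := by
      intro v hv
      refine ⟨by rw [D1]; exact hv.1, ?_⟩
      -- The five edges opposite a golden vertex, shifted by φ - 1, have consecutive products 1. The
      -- cycle has odd length, so each shifted value is ±1, and -1 would give the negative parameter
      -- φ - 2.
      have st : ∀ k : ℕ, (D (v * (s₂ * s₃) ^ k * s₁ * s₂) - (Real.goldenRatio - 1)) *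
          (D (v * (s₂ * s₃) ^ (k + 1) * s₁ * s₂) - (Real.goldenRatio - 1)) = 1 := by
        intro k
        have := L _ (Z2 _ (Zc k v hv))
        have e : v * (s₂ * s₃) ^ k * s₂ * s₃ = v * (s₂ * s₃) ^ (k + 1) := by
          rw [mul_assoc (v * _), mul_assoc v, ← pow_succ]
        rwa [L2, e] at this
      have t0 := st 0
      have t1 := st 1
      have t2 := st 2
      have t3 := st 3
      have t4 := st 4
      norm_num [hq] at t0 t1 t2 t3 t4
      have pp := pos (v * s₁ * s₂)
      set φ := Real.goldenRatio
      generalize hA0 : D (v * s₁ * s₂) - (φ - 1) = A0 at *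
      have hφ : φ < 2 := Real.goldenRatio_lt_two
      generalize D (v * (s₂ * s₃) * s₁ * s₂) - (φ - 1) = A1 at *
      generalize D (v * (s₂ * s₃) ^ 2 * s₁ * s₂) - (φ - 1) = A2 at *
      generalize D (v * (s₂ * s₃) ^ 3 * s₁ * s₂) - (φ - 1) = A3 at *
      generalize D (v * (s₂ * s₃) ^ 4 * s₁ * s₂) - (φ - 1) = A4 at *
      have a2 : A2 = A0 := by linear_combination A0 * t1 - A2 * t0
      have a4 : A4 = A2 := by linear_combination A2 * t3 - A4 * t2
      have h0 : (A0 - 1) * (A0 + 1) = 0 := by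
        rw [a4, a2] at t4
        linear_combination t4
      rcases mul_eq_zero.1 h0 with z | z
      · linarith
      · linarith
    have all : ∀ v, Z (u * v) := by
      apply hgen
      · simpa using hu
      · intro v hv
        rw [← mul_assoc, ← mul_assoc, ← mul_assoc]
        exact ⟨Z1 _ hv, Z2 _ hv, Z3 _ hv⟩
    have := (all (u⁻¹ * w)).1
    rwa [mul_inv_cancel_left] at this
  · exfalso
    push Not at hZ
    classical
    have := Fintype.ofFinite G
    -- m marks the corners whose two edges have equal sign. Each triangle has at least one of three
    -- corners marked, and each vertex at most one of five, so summing over flags gives |G| ≤ 3 Σ m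
    -- and 5 Σ m ≤ |G|.
    let σ : G → Bool := fun u => decide (Real.goldenRatio ≤ D u)
    let m : G → ℕ := fun u => if σ u = σ (u * s₂) then 1 else 0
    have σ1 : ∀ u, σ (u * s₁) = σ u := fun u => by simp only [σ, D1]
    have σ3 : ∀ u, σ (u * s₃) = σ u := fun u => by simp only [σ, D3]
    have tri : ∀ u, 1 ≤ m u + m (u * s₁) + m (u * s₂ * s₁) := by
      intro u
      have := triangle_signs (σ u) (σ (u * s₂)) (σ (u * s₁ * s₂))
      simp only [m]
      rwa [hbw, σ1, σ1, σ1]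
    have pent : ∀ u, m u + m (u * (s₂ * s₃)) + m (u * (s₂ * s₃) ^ 2) + m (u * (s₂ * s₃) ^ 3) +
        m (u * (s₂ * s₃) ^ 4) ≤ 1 := by
      intro u
      obtain ⟨r0, r1, r2, r3, r4⟩ := h.sep_pentagon_five g hb hq u rfl rfl rfl rfl rfl
      have rule : ∀ v v' v'' : G, D v * D v' = 1 + D v'' → (σ v = σ v' → σ v'' = σ v) := by
        intro v v' v'' hv hσ
        by_cases h1 : Real.goldenRatio ≤ D v
        · have h2 : Real.goldenRatio ≤ D v' := by
            have : σ v' = true := by rw [← hσ]; simpa [σ] using h1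
            simpa [σ] using this
          have := pentagon_ge hv h1 h2
          simp [σ, h1, this]
        · have h2 : ¬ Real.goldenRatio ≤ D v' := by
            have : σ v' = false := by rw [← hσ]; simpa [σ] using h1
            simpa [σ] using this
          have := pentagon_lt hv (pos _) (not_le.1 h1) (pos _) (not_le.1 h2)
          simp [σ, h1, this]
      have := pentagon_signs (σ u) (σ (u * (s₂ * s₃))) (σ (u * (s₂ * s₃) ^ 2))
        (σ (u * (s₂ * s₃) ^ 3)) (σ (u * (s₂ * s₃) ^ 4)) (rule _ _ _ r0) (rule _ _ _ r1)
        (rule _ _ _ r2) (rule _ _ _ r3) (rule _ _ _ r4) (by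
          rintro ⟨k0, k1, k2, k3⟩
          by_cases h1 : Real.goldenRatio ≤ D u
          · have t0 : σ u = true := by simpa [σ] using h1
            rw [t0] at k0
            rw [← k0] at k1
            rw [← k1] at k2
            rw [← k2] at k3
            replace k0 := of_decide_eq_true k0.symm
            replace k1 := of_decide_eq_true k1.symm
            replace k2 := of_decide_eq_true k2.symm
            replace k3 := of_decide_eq_true k3.symm
            obtain ⟨f1, f2⟩ := pentagon_all_ge r0 r1 r2 r3 r4 h1 k0 k1 k2 k3
            exact hZ u ⟨f1, by rw [D2]; exact f2⟩
          · have t0 : σ u = false := by simpa [σ] using h1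
            rw [t0] at k0
            rw [← k0] at k1
            rw [← k1] at k2
            rw [← k2] at k3
            replace k0 := not_le.1 (of_decide_eq_false k0.symm)
            replace k1 := not_le.1 (of_decide_eq_false k1.symm)
            replace k2 := not_le.1 (of_decide_eq_false k2.symm)
            replace k3 := not_le.1 (of_decide_eq_false k3.symm)
            exact pentagon_not_all_lt r0 r2 r3 (pos _) (pos _) (pos _) (pos _) (pos _)
              (not_le.1 h1) k0 k1 k2 k3)
      have mk : ∀ k : ℕ, m (u * (s₂ * s₃) ^ k) =
          if σ (u * (s₂ * s₃) ^ k) = σ (u * (s₂ * s₃) ^ (k + 1)) then 1 else 0 := by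
        intro k
        simp only [m]
        rw [← σ3 (u * (s₂ * s₃) ^ k * s₂), mul_assoc (u * _) s₂ s₃, mul_assoc u, ← pow_succ]
      have m0 := mk 0
      have m1 := mk 1
      have m2 := mk 2
      have m3 := mk 3
      have m4 := mk 4
      norm_num [hq] at m0 m1 m2 m3 m4
      rw [m0, m1, m2, m3, m4]
      exact this
    -- Right translation permutes the flags, so each term in the local inequalities contributes the
    -- same total.
    have shift : ∀ v : G, ∑ u, m (u * v) = ∑ u, m u := fun v =>
      Fintype.sum_equiv (Equiv.mulRight v) _ _ fun u => rfl
    have c1 : Fintype.card G ≤ 3 * ∑ u, m u := by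
      have h1 : ∑ _u : G, 1 ≤ ∑ u, (m u + m (u * s₁) + m (u * s₂ * s₁)) :=
        Finset.sum_le_sum fun u _ => tri u
      have h2 : ∑ u, m (u * s₂ * s₁) = ∑ u, m u := by
        simp only [mul_assoc]; exact shift _
      rw [Finset.sum_add_distrib, Finset.sum_add_distrib, shift, h2] at h1
      simp at h1
      omega
    have c2 : 5 * ∑ u, m u ≤ Fintype.card G := by
      have h1 : ∑ u, (m u + m (u * (s₂ * s₃)) + m (u * (s₂ * s₃) ^ 2) + m (u * (s₂ * s₃) ^ 3) +
        m (u * (s₂ * s₃) ^ 4)) ≤ ∑ _u : G, 1 := Finset.sum_le_sum fun u _ => pent u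
      rw [Finset.sum_add_distrib, Finset.sum_add_distrib, Finset.sum_add_distrib,
        Finset.sum_add_distrib, shift, shift, shift, shift] at h1
      simp at h1
      omega
    have c3 : 0 < Fintype.card G := Fintype.card_pos
    omega

end IsFamily

namespace IsFamily

variable {G : Type*} [Group G] {s₁ s₂ s₃ : G} {x y x' y' : G → Vec4}

/-! ### Rigidity -/

theorem sep_apex (h : IsFamily s₁ s₂ s₃ x y) (g : FlagGroup s₁ s₂ s₃)
    (hb : s₁ * s₂ * s₁ = s₂ * s₁ * s₂) (w : G) :
    lor (x (w * s₁)) (x (w * s₃ * s₂ * s₁)) = -1 := by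
  have := h.adj hb (w * s₃)
  rwa [mul_assoc w s₃ s₁, ← g.comm, ← mul_assoc, h.x_three] at this

variable (s₁ s₂ x y) in
/-- The three vertices and the normal of the facet of a flag. -/
def facetFrame (w : G) : Fin 4 → Vec4 := ![x w, x (w * s₁), x (w * s₂ * s₁), y w]

/-- A triangular facet is rigid: its three caps touch pairwise and its normal is orthogonal to them.
This constant Gram matrix starts the comparison of two families. -/
theorem lor_facetFrame (h : IsFamily s₁ s₂ s₃ x y) (hb : s₁ * s₂ * s₁ = s₂ * s₁ * s₂) (w : G)
    (i j : Fin 4) : lor (facetFrame s₁ s₂ x y w i) (facetFrame s₁ s₂ x y w j) =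
      !![1, -1, -1, 0; -1, 1, -1, 0; -1, -1, 1, 0; 0, 0, 0, 1] i j := by
  have c1 := h.edge w
  have c2 := h.edge_two w
  have c3 := h.adj hb w
  have c4 := h.incident w
  have c5 := h.right_incident w
  have c6 := h.left_incident w
  fin_cases i <;> fin_cases j <;>
    simp [facetFrame, h.unit_x, h.unit_y, c1, c2, c3, c4, c5, c6, lor_comm _ (x w),
      lor_comm (y w), lor_comm (x (w * s₂ * s₁)) (x (w * s₁))]

theorem gramNondeg_facetFrame (h : IsFamily s₁ s₂ s₃ x y) (hb : s₁ * s₂ * s₁ = s₂ * s₁ * s₂)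
    (w : G) : GramNondeg (facetFrame s₁ s₂ x y w) := by
  intro t ht
  simp only [h.lor_facetFrame hb] at ht
  have h0 := ht 0
  have h1 := ht 1
  have h2 := ht 2
  have h3 := ht 3
  simp [Fin.sum_univ_four] at h0 h1 h2 h3
  ext i
  fin_cases i <;> simp <;> linarith

variable (s₁ s₂ s₃ x) in
/-- The vertices of the two facets at an edge, completed by the normal of the second one. -/
def hingeFrame (y : G → Vec4) (w : G) : Fin 4 → Vec4 :=
  ![x w, x (w * s₁), x (w * s₃ * s₂ * s₁), y (w * s₃)]

theorem hingeFrame_eq (h : IsFamily s₁ s₂ s₃ x y) (g : FlagGroup s₁ s₂ s₃) (w : G) :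
    hingeFrame s₁ s₂ s₃ x y w = facetFrame s₁ s₂ x y (w * s₃) := by
  have : x (w * s₃ * s₁) = x (w * s₁) := by
    rw [mul_assoc w s₃ s₁, ← g.comm, ← mul_assoc, h.x_three]
  rw [hingeFrame, facetFrame, h.x_three, this]

/-- The products with the three vertices of the facet, one of them given by the edge parameter, and
unit length leave two candidates exchanged by the reflection in the facet plane; `neg` selects one.
-/
theorem step_vertex (h : IsFamily s₁ s₂ s₃ x y) (h' : IsFamily s₁ s₂ s₃ x' y')
    (g : FlagGroup s₁ s₂ s₃) (hb : s₁ * s₂ * s₁ = s₂ * s₁ * s₂) (w : G)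
    (hsep : sep s₁ s₂ s₃ x w = sep s₁ s₂ s₃ x' w) {A : Mat4}
    (hA : ∀ x y, lor (A *ᵥ x) (A *ᵥ y) = lor x y)
    (hw : ∀ i, A *ᵥ facetFrame s₁ s₂ x y w i = facetFrame s₁ s₂ x' y' w i) :
    A *ᵥ x (w * s₃ * s₂ * s₁) = x' (w * s₃ * s₂ * s₁) := by
  have a0 : A *ᵥ x w = x' w := hw 0
  have a1 : A *ᵥ x (w * s₁) = x' (w * s₁) := hw 1
  have a2 : A *ᵥ x (w * s₂ * s₁) = x' (w * s₂ * s₁) := hw 2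
  have a3 : A *ᵥ y w = y' w := hw 3
  set c := A *ᵥ x (w * s₃ * s₂ * s₁) with hc
  have k0 : lor (x' w) c = -1 := by rw [← a0, hA, h.edge_three]
  have k1 : lor (x' (w * s₁)) c = -1 := by rw [← a1, hA, h.sep_apex g hb]
  have k2 : lor (x' (w * s₂ * s₁)) c = lor (x' (w * s₂ * s₁)) (x' (w * s₃ * s₂ * s₁)) := by
    rw [← a2, hA, lor_comm, h.cross_eq, a2, lor_comm, h'.cross_eq, hsep]
  have k3 : lor (y' w) c < 0 := by rw [← a3, hA, lor_comm]; exact h.neg w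
  have k4 : lor c c = 1 := by rw [hc, hA, h.unit_x]
  set t := lor (y' w) c - lor (y' w) (x' (w * s₃ * s₂ * s₁)) with ht
  have hd : c - x' (w * s₃ * s₂ * s₁) - t • y' w = 0 := by
    apply (h'.gramNondeg_facetFrame hb w).eq_zero
    intro i
    fin_cases i
    · simp [facetFrame, k0, h'.edge_three, h'.incident]
    · simp [facetFrame, k1, h'.sep_apex g hb, h'.right_incident]
    · simp [facetFrame, k2, h'.left_incident]
    · simp [facetFrame, h'.unit_y, ht]
  have hd' : c = x' (w * s₃ * s₂ * s₁) + t • y' w := by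
    rw [sub_sub, sub_eq_zero] at hd; exact hd
  have n' : lor (y' w) (x' (w * s₃ * s₂ * s₁)) < 0 := by rw [lor_comm]; exact h'.neg w
  rw [hd'] at k4
  simp only [map_add, map_smul, LinearMap.add_apply, LinearMap.smul_apply, smul_eq_mul,
    h'.unit_x, h'.unit_y, lor_comm _ (y' w)] at k4
  have : t * (2 * lor (y' w) (x' (w * s₃ * s₂ * s₁)) + t) = 0 := by linarith
  rcases mul_eq_zero.1 this with z | z
  · rw [hd', z, zero_smul, add_zero]
  · exfalso; linarith

/-- The new normal is the unit vector orthogonal to three known vertices, with its sign fixed by a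
fourth. -/
theorem step_normal (h : IsFamily s₁ s₂ s₃ x y) (h' : IsFamily s₁ s₂ s₃ x' y')
    (g : FlagGroup s₁ s₂ s₃) (hb : s₁ * s₂ * s₁ = s₂ * s₁ * s₂) (w : G) {A : Mat4}
    (hA : ∀ x y, lor (A *ᵥ x) (A *ᵥ y) = lor x y)
    (hw : ∀ i, A *ᵥ facetFrame s₁ s₂ x y w i = facetFrame s₁ s₂ x' y' w i)
    (hv : A *ᵥ x (w * s₃ * s₂ * s₁) = x' (w * s₃ * s₂ * s₁)) :
    A *ᵥ y (w * s₃) = y' (w * s₃) := by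
  have a0 : A *ᵥ x w = x' w := hw 0
  have a1 : A *ᵥ x (w * s₁) = x' (w * s₁) := hw 1
  have a2 : A *ᵥ x (w * s₂ * s₁) = x' (w * s₂ * s₁) := hw 2
  have e : ∀ {x y : G → Vec4}, IsFamily s₁ s₂ s₃ x y → lor (x w) (y (w * s₃)) = 0 ∧
      lor (x (w * s₁)) (y (w * s₃)) = 0 ∧ lor (x (w * s₃ * s₂ * s₁)) (y (w * s₃)) = 0 ∧
      lor (x (w * s₂ * s₁)) (y (w * s₃)) < 0 := by
    intro x y h
    have b0 := h.incident (w * s₃)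
    have b1 := h.right_incident (w * s₃)
    have b2 := h.neg (w * s₃)
    rw [h.x_three] at b0
    rw [mul_assoc w s₃ s₁, ← g.comm, ← mul_assoc, h.x_three] at b1
    rw [mul_assoc w s₃ s₃, g.sq_three, mul_one] at b2
    exact ⟨b0, b1, h.left_incident _, b2⟩
  obtain ⟨b0, b1, b2, b3⟩ := e h
  obtain ⟨b0', b1', b2', b3'⟩ := e h'
  set c := A *ᵥ y (w * s₃) with hc
  have c0 : lor (x' w) c = 0 := by rw [← a0, hc, hA, b0]
  have c1 : lor (x' (w * s₁)) c = 0 := by rw [← a1, hc, hA, b1]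
  have c2 : lor (x' (w * s₃ * s₂ * s₁)) c = 0 := by rw [← hv, hc, hA, b2]
  set t := lor (y' (w * s₃)) c with ht
  have hd : c - t • y' (w * s₃) = 0 := by
    apply (h'.gramNondeg_facetFrame hb (w * s₃)).eq_zero
    rw [← h'.hingeFrame_eq g]
    intro i
    fin_cases i
    · simp [hingeFrame, b0', c0]
    · simp [hingeFrame, b1', c1]
    · simp [hingeFrame, b2', c2]
    · simp [hingeFrame, h'.unit_y, ht]
  rw [sub_eq_zero] at hd
  have u : lor c c = 1 := by rw [hc, hA, h.unit_y]
  have n : lor (x' (w * s₂ * s₁)) c < 0 := by rw [← a2, hc, hA]; exact b3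
  rw [hd] at u n
  simp only [map_smul, LinearMap.smul_apply, smul_eq_mul, h'.unit_y] at u n
  have tp : 0 < t := by nlinarith
  have t1 : t = 1 := by nlinarith
  rw [hd, t1, one_smul]

/-- An isometry matching one facet frame is propagated over all flags: s₁ and s₂ permute the
vertices of the frame, and s₃ crosses an edge by `step_vertex` and `step_normal`. -/
theorem exists_lorentz_of_sep (h : IsFamily s₁ s₂ s₃ x y) (h' : IsFamily s₁ s₂ s₃ x' y')
    (g : FlagGroup s₁ s₂ s₃)
    (hgen : ∀ p : G → Prop, p 1 → (∀ w, p w → p (w * s₁) ∧ p (w * s₂) ∧ p (w * s₃)) → ∀ w, p w)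
    (hb : s₁ * s₂ * s₁ = s₂ * s₁ * s₂)
    (hsep : ∀ w, sep s₁ s₂ s₃ x w = sep s₁ s₂ s₃ x' w) :
    ∃ A ∈ lorentz, ∀ w, A *ᵥ x w = x' w ∧ A *ᵥ y w = y' w := by
  obtain ⟨A, hA, hA1⟩ := exists_matrix_of_gram (h.gramNondeg_facetFrame hb 1)
    (d := facetFrame s₁ s₂ x' y' 1)
    fun i j => by rw [h.lor_facetFrame hb, h'.lor_facetFrame hb]
  have all : ∀ w, ∀ i, A *ᵥ facetFrame s₁ s₂ x y w i = facetFrame s₁ s₂ x' y' w i := by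
    refine hgen (fun w => ∀ i, A *ᵥ facetFrame s₁ s₂ x y w i = facetFrame s₁ s₂ x' y' w i) hA1 ?_
    intro w hw
    have a0 : A *ᵥ x w = x' w := hw 0
    have a1 : A *ᵥ x (w * s₁) = x' (w * s₁) := hw 1
    have a2 : A *ᵥ x (w * s₂ * s₁) = x' (w * s₂ * s₁) := hw 2
    have a3 : A *ᵥ y w = y' w := hw 3
    have hv := h.step_vertex h' g hb w (hsep w) hA hw
    have hn := h.step_normal h' g hb w hA hw hv
    have e1 : w * s₁ * s₁ = w := by rw [mul_assoc, g.sq_one, mul_one]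
    have e2 : w * s₂ * s₂ = w := by rw [mul_assoc, g.sq_two, mul_one]
    have e3 : w * s₁ * s₂ * s₁ = w * s₂ * s₁ * s₂ := by
      simp only [mul_assoc] at hb ⊢
      rw [hb]
    refine ⟨fun i => ?_, fun i => ?_, fun i => ?_⟩
    · fin_cases i
      · exact a1
      · simpa [facetFrame, e1] using a0
      · simpa [facetFrame, e3, h.x_two, h'.x_two] using a2
      · simpa [facetFrame, h.y_one, h'.y_one] using a3
    · fin_cases i
      · simpa [facetFrame, h.x_two, h'.x_two] using a0
      · exact a2
      · simpa [facetFrame, e2] using a1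
      · simpa [facetFrame, h.y_two, h'.y_two] using a3
    · rw [← h.hingeFrame_eq g, ← h'.hingeFrame_eq g]
      fin_cases i
      · exact a0
      · exact a1
      · exact hv
      · exact hn
  refine ⟨A, ?_, fun w => ⟨all w 0, all w 3⟩⟩
  apply mem_lorentz_of_null hA (h.null_future 1) (h.future 1)
  have e : A *ᵥ (x 1 + x (1 * s₁)) = x' 1 + x' (1 * s₁) := by
    rw [Matrix.mulVec_add]
    exact congrArg₂ (· + ·) (all 1 0) (all 1 1)
  rw [e]
  exact h'.future 1

/-- Families of type `{3, q}` are Lorentz equivalent. -/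
theorem exists_lorentz_of_triangle [Finite G] (h : IsFamily s₁ s₂ s₃ x y)
    (h' : IsFamily s₁ s₂ s₃ x' y') (g : FlagGroup s₁ s₂ s₃)
    (hgen : ∀ p : G → Prop, p 1 → (∀ w, p w → p (w * s₁) ∧ p (w * s₂) ∧ p (w * s₃)) → ∀ w, p w)
    (hb : s₁ * s₂ * s₁ = s₂ * s₁ * s₂) {q : ℕ} (hq : (s₂ * s₃) ^ q = 1)
    (hq' : q = 3 ∨ q = 4 ∨ q = 5) :
    ∃ A ∈ lorentz, ∀ w, A *ᵥ x w = x' w ∧ A *ᵥ y w = y' w := by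
  apply h.exists_lorentz_of_sep h' g hgen hb
  intro w
  rcases hq' with rfl | rfl | rfl
  · rw [h.sep_of_three g hb hq, h'.sep_of_three g hb hq]
  · rw [h.sep_of_four g hb hq, h'.sep_of_four g hb hq]
  · rw [h.sep_of_five g hgen hb hq, h'.sep_of_five g hgen hb hq]

/-- Families of the same Platonic type are Lorentz equivalent. -/
theorem exists_lorentz [Finite G] (h : IsFamily s₁ s₂ s₃ x y)
    (h' : IsFamily s₁ s₂ s₃ x' y') (g : FlagGroup s₁ s₂ s₃)
    (hgen : ∀ p : G → Prop, p 1 → (∀ w, p w → p (w * s₁) ∧ p (w * s₂) ∧ p (w * s₃)) → ∀ w, p w)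
    {p q : ℕ} (hp : (s₁ * s₂) ^ p = 1) (hq : (s₂ * s₃) ^ q = 1)
    (hpq : p = 3 ∧ (q = 3 ∨ q = 4 ∨ q = 5) ∨ q = 3 ∧ (p = 3 ∨ p = 4 ∨ p = 5)) :
    ∃ A ∈ lorentz, ∀ w, A *ᵥ x w = x' w ∧ A *ᵥ y w = y' w := by
  have braid : ∀ {s t : G}, s * s = 1 → t * t = 1 → (s * t) ^ 3 = 1 → s * t * s = t * s * t := by
    intro s t hs ht hst
    have : (s * t) ^ 3 = (s * t * s) * (t * s * t) := by simp only [pow_succ, pow_zero]; group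
    rw [this] at hst
    have e : (t * s * t) * (t * s * t) = 1 := by
      calc (t * s * t) * (t * s * t) = t * s * (t * t) * s * t := by group
        _ = t * (s * s) * t := by rw [ht]; group
        _ = 1 := by rw [hs, mul_one, ht]
    exact mul_right_cancel (hst.trans e.symm)
  rcases hpq with ⟨rfl, hq'⟩ | ⟨rfl, hp'⟩
  · exact h.exists_lorentz_of_triangle h' g hgen (braid g.sq_one g.sq_two hp) hq hq'
  · have hp2 : (s₂ * s₁) ^ p = 1 := by
      have e : s₂ * s₁ = (s₁ * s₂)⁻¹ := by
        rw [mul_inv_rev, inv_eq_of_mul_eq_one_left g.sq_one, inv_eq_of_mul_eq_one_left g.sq_two]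
      rw [e, inv_pow, hp, inv_one]
    have hq2 : (s₃ * s₂) ^ 3 = 1 := by
      have e : s₃ * s₂ = (s₂ * s₃)⁻¹ := by
        rw [mul_inv_rev, inv_eq_of_mul_eq_one_left g.sq_three,
          inv_eq_of_mul_eq_one_left g.sq_two]
      rw [e, inv_pow, hq, inv_one]
    obtain ⟨A, hA, hA'⟩ := (h.dual g).exists_lorentz_of_triangle (h'.dual g) g.reverse
      (fun P h1 hP => hgen P h1 fun w hw => ⟨(hP w hw).2.2, (hP w hw).2.1, (hP w hw).1⟩)
      (braid g.sq_three g.sq_two hq2) hp2 hp'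
    exact ⟨A, hA, fun w => (hA' w).symm⟩

end IsFamily

/-! ### Reflection groups of regular polyhedra -/

/-- A group generated by three reflections of 3-space, with the vertex `v`, the edge midpoint `t`
and the facet centre `f` (a vertex of the polar) of a regular polyhedron with midsphere the unit
sphere; `n₁`, `n₂`, `n₃` are the normals of the walls of the chamber spanned by `v`, `t`, `f`. -/
structure Chain {G : Type*} [Group G] (s₁ s₂ s₃ : G) (σ : G →* Module.End ℝ E3)
    (n₁ n₂ n₃ t v f : E3) (a b : ℝ) : Prop where
  gen : ∀ p : G → Prop, p 1 → (∀ w, p w → p (w * s₁) ∧ p (w * s₂) ∧ p (w * s₃)) → ∀ w, p w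
  flag : FlagGroup s₁ s₂ s₃
  refl_one : ∀ x, σ s₁ x = x - (2 * ⟪n₁, x⟫) • n₁
  refl_two : ∀ x, σ s₂ x = x - (2 * ⟪n₂, x⟫) • n₂
  refl_three : ∀ x, σ s₃ x = x - (2 * ⟪n₃, x⟫) • n₃
  unit_one : ⟪n₁, n₁⟫ = 1
  unit_two : ⟪n₂, n₂⟫ = 1
  unit_three : ⟪n₃, n₃⟫ = 1
  unit_t : ⟪t, t⟫ = 1
  orth : ⟪n₁, n₃⟫ = 0
  orth_one : ⟪n₁, t⟫ = 0
  orth_three : ⟪n₃, t⟫ = 0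
  pos_t : 0 < ⟪n₂, t⟫
  a_pos : 0 < a
  b_pos : 0 < b
  v_eq : v = t + a • n₁
  f_eq : f = t + b • n₃
  two_v : ⟪n₂, v⟫ = 0
  two_f : ⟪n₂, f⟫ = 0
  dominant_unique : ∀ w x, (0 ≤ ⟪n₁, x⟫ ∧ 0 ≤ ⟪n₂, x⟫ ∧ 0 ≤ ⟪n₃, x⟫) →
    (0 ≤ ⟪n₁, σ w x⟫ ∧ 0 ≤ ⟪n₂, σ w x⟫ ∧ 0 ≤ ⟪n₃, σ w x⟫) → σ w x = x

/-- The closed chamber. -/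
def Dominant (n₁ n₂ n₃ x : E3) : Prop := 0 ≤ ⟪n₁, x⟫ ∧ 0 ≤ ⟪n₂, x⟫ ∧ 0 ≤ ⟪n₃, x⟫

theorem eq_sum_of_orthonormal {e₁ e₂ e₃ : E3} (h11 : ⟪e₁, e₁⟫ = 1) (h22 : ⟪e₂, e₂⟫ = 1)
    (h33 : ⟪e₃, e₃⟫ = 1) (h12 : ⟪e₁, e₂⟫ = 0) (h13 : ⟪e₁, e₃⟫ = 0) (h23 : ⟪e₂, e₃⟫ = 0) (x : E3) :
    x = ⟪e₁, x⟫ • e₁ + ⟪e₂, x⟫ • e₂ + ⟪e₃, x⟫ • e₃ := by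
  have ho : Orthonormal ℝ ![e₁, e₂, e₃] := by
    rw [orthonormal_iff_ite]
    intro i j
    fin_cases i <;> fin_cases j <;>
      simp [h12, h13, h23, real_inner_comm e₁ e₂, real_inner_comm e₁ e₃, real_inner_comm e₂ e₃,
        -inner_self_eq_norm_sq_to_K, h11, h22, h33]
  have hc : Fintype.card (Fin 3) = Module.finrank ℝ E3 := by simp
  let B := basisOfOrthonormalOfCardEqFinrank ho hc
  have hB : ⇑B = ![e₁, e₂, e₃] := coe_basisOfOrthonormalOfCardEqFinrank ho hc
  let O := B.toOrthonormalBasis (by rw [hB]; exact ho)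
  have hO : ⇑O = ![e₁, e₂, e₃] := by simp [O, hB]
  have := O.sum_repr' x
  rw [hO] at this
  simpa [Fin.sum_univ_three] using this.symm

namespace Chain

variable {G : Type*} [Group G] {s₁ s₂ s₃ : G} {σ : G →* Module.End ℝ E3}
  {n₁ n₂ n₃ t v f : E3} {a b : ℝ}

theorem reverse (h : Chain s₁ s₂ s₃ σ n₁ n₂ n₃ t v f a b) :
    Chain s₃ s₂ s₁ σ n₃ n₂ n₁ t f v b a where
  gen := fun P h1 hP => h.gen P h1 fun w hw => ⟨(hP w hw).2.2, (hP w hw).2.1, (hP w hw).1⟩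
  flag := h.flag.reverse
  refl_one := h.refl_three
  refl_two := h.refl_two
  refl_three := h.refl_one
  unit_one := h.unit_three
  unit_two := h.unit_two
  unit_three := h.unit_one
  unit_t := h.unit_t
  orth := by rw [real_inner_comm]; exact h.orth
  orth_one := h.orth_three
  orth_three := h.orth_one
  pos_t := h.pos_t
  a_pos := h.b_pos
  b_pos := h.a_pos
  v_eq := h.f_eq
  f_eq := h.v_eq
  two_v := h.two_f
  two_f := h.two_v
  dominant_unique := fun w x h1 h2 => h.dominant_unique w x ⟨h1.2.2, h1.2.1, h1.1⟩
    ⟨h2.2.2, h2.2.1, h2.1⟩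

theorem one_v (h : Chain s₁ s₂ s₃ σ n₁ n₂ n₃ t v f a b) : ⟪n₁, v⟫ = a := by
  rw [h.v_eq, inner_add_right, inner_smul_right, h.orth_one, h.unit_one]; ring

theorem three_v (h : Chain s₁ s₂ s₃ σ n₁ n₂ n₃ t v f a b) : ⟪n₃, v⟫ = 0 := by
  rw [h.v_eq, inner_add_right, inner_smul_right, h.orth_three, real_inner_comm, h.orth]; ring

theorem one_f (h : Chain s₁ s₂ s₃ σ n₁ n₂ n₃ t v f a b) : ⟪n₁, f⟫ = 0 := h.reverse.three_v

theorem three_f (h : Chain s₁ s₂ s₃ σ n₁ n₂ n₃ t v f a b) : ⟪n₃, f⟫ = b := h.reverse.one_v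

theorem t_v (h : Chain s₁ s₂ s₃ σ n₁ n₂ n₃ t v f a b) : ⟪t, v⟫ = 1 := by
  rw [h.v_eq, inner_add_right, inner_smul_right, h.unit_t, real_inner_comm, h.orth_one]; ring

theorem t_f (h : Chain s₁ s₂ s₃ σ n₁ n₂ n₃ t v f a b) : ⟪t, f⟫ = 1 := h.reverse.t_v

theorem v_f (h : Chain s₁ s₂ s₃ σ n₁ n₂ n₃ t v f a b) : ⟪v, f⟫ = 1 := by
  rw [h.v_eq, inner_add_left, inner_smul_left, h.t_f, h.one_f]; simp

theorem v_v (h : Chain s₁ s₂ s₃ σ n₁ n₂ n₃ t v f a b) : ⟪v, v⟫ = 1 + a ^ 2 := by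
  nth_rw 1 [h.v_eq]
  rw [inner_add_left, inner_smul_left, h.t_v, h.one_v]; simp; ring

theorem f_f (h : Chain s₁ s₂ s₃ σ n₁ n₂ n₃ t v f a b) : ⟪f, f⟫ = 1 + b ^ 2 := h.reverse.v_v

theorem one_two (h : Chain s₁ s₂ s₃ σ n₁ n₂ n₃ t v f a b) : ⟪n₁, n₂⟫ < 0 := by
  have := h.two_v
  rw [h.v_eq, inner_add_right, inner_smul_right, real_inner_comm n₁] at this
  have h1 := h.pos_t
  have h2 := h.a_pos
  nlinarith

theorem three_two (h : Chain s₁ s₂ s₃ σ n₁ n₂ n₃ t v f a b) : ⟪n₃, n₂⟫ < 0 := h.reverse.one_two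

theorem eq_zero_of_orth (h : Chain s₁ s₂ s₃ σ n₁ n₂ n₃ t v f a b)
    {x : E3} (h1 : ⟪n₁, x⟫ = 0) (h2 : ⟪n₂, x⟫ = 0) (h3 : ⟪n₃, x⟫ = 0) :
    x = 0 := by
  have e := eq_sum_of_orthonormal h.unit_one h.unit_three h.unit_t h.orth h.orth_one h.orth_three
  have e1 := e x
  rw [h1, h3, zero_smul, zero_smul, zero_add, zero_add] at e1
  rw [e1, inner_smul_right] at h2
  rcases mul_eq_zero.1 h2 with z | z
  · rw [e1, z, zero_smul]
  · exact absurd z h.pos_t.ne'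

theorem dominant_v (h : Chain s₁ s₂ s₃ σ n₁ n₂ n₃ t v f a b) : Dominant n₁ n₂ n₃ v :=
  ⟨by rw [h.one_v]; exact h.a_pos.le, h.two_v.ge, h.three_v.ge⟩

theorem dominant_f (h : Chain s₁ s₂ s₃ σ n₁ n₂ n₃ t v f a b) : Dominant n₁ n₂ n₃ f :=
  ⟨h.one_f.ge, h.two_f.ge, by rw [h.three_f]; exact h.b_pos.le⟩

theorem dominant_t (h : Chain s₁ s₂ s₃ σ n₁ n₂ n₃ t v f a b) : Dominant n₁ n₂ n₃ t :=
  ⟨h.orth_one.ge, h.pos_t.le, h.orth_three.ge⟩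

/-- The dominant cone is spanned by `v`, `t`, `f`. -/
theorem exists_nonneg_comb (h : Chain s₁ s₂ s₃ σ n₁ n₂ n₃ t v f a b)
    {x : E3} (hx : Dominant n₁ n₂ n₃ x) :
    ∃ α β γ : ℝ, 0 ≤ α ∧ 0 ≤ β ∧ 0 ≤ γ ∧ x = α • v + β • t + γ • f := by
  refine ⟨⟪n₁, x⟫ / a, ⟪n₂, x⟫ / ⟪n₂, t⟫, ⟪n₃, x⟫ / b, div_nonneg hx.1 h.a_pos.le,
    div_nonneg hx.2.1 h.pos_t.le, div_nonneg hx.2.2 h.b_pos.le, ?_⟩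
  rw [← sub_eq_zero]
  have p1 := h.a_pos.ne'
  have p2 := h.pos_t.ne'
  have p3 := h.b_pos.ne'
  apply h.eq_zero_of_orth
  · simp only [inner_sub_right, inner_add_right, inner_smul_right, h.one_v, h.orth_one, h.one_f]
    field_simp
    ring
  · simp only [inner_sub_right, inner_add_right, inner_smul_right, h.two_v, h.two_f]
    field_simp
    ring
  · simp only [inner_sub_right, inner_add_right, inner_smul_right, h.three_v, h.orth_three,
      h.three_f]
    field_simp
    ring

theorem inner_map (h : Chain s₁ s₂ s₃ σ n₁ n₂ n₃ t v f a b)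
    (w : G) (x y : E3) : ⟪σ w x, σ w y⟫ = ⟪x, y⟫ := by
  have r : ∀ n x y : E3, ⟪n, n⟫ = 1 →
      ⟪x - (2 * ⟪n, x⟫) • n, y - (2 * ⟪n, y⟫) • n⟫ = ⟪x, y⟫ := by
    intro n x y hn
    simp only [inner_sub_left, inner_sub_right, inner_smul_left, inner_smul_right, hn,
      real_inner_comm n x]
    simp
    ring
  refine h.gen (fun w => ∀ x y, ⟪σ w x, σ w y⟫ = ⟪x, y⟫) (by simp) ?_ w x y
  intro w hw
  refine ⟨fun x y => ?_, fun x y => ?_, fun x y => ?_⟩ <;>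
    rw [map_mul, Module.End.mul_apply, Module.End.mul_apply, hw]
  · rw [h.refl_one, h.refl_one, r _ _ _ h.unit_one]
  · rw [h.refl_two, h.refl_two, r _ _ _ h.unit_two]
  · rw [h.refl_three, h.refl_three, r _ _ _ h.unit_three]

theorem map_inv_map (w : G) (x : E3) : σ w⁻¹ (σ w x) = x := by
  rw [← Module.End.mul_apply, ← map_mul, inv_mul_cancel, map_one, Module.End.one_apply]

theorem map_map_inv (w : G) (x : E3) : σ w (σ w⁻¹ x) = x := by
  rw [← Module.End.mul_apply, ← map_mul, mul_inv_cancel, map_one, Module.End.one_apply]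

theorem inner_map_left (h : Chain s₁ s₂ s₃ σ n₁ n₂ n₃ t v f a b)
    (w : G) (x y : E3) : ⟪σ w x, y⟫ = ⟪x, σ w⁻¹ y⟫ := by
  rw [← h.inner_map w x, map_map_inv]

theorem fix_one (h : Chain s₁ s₂ s₃ σ n₁ n₂ n₃ t v f a b)
    {x : E3} (hx : ⟪n₁, x⟫ = 0) : σ s₁ x = x := by
  rw [h.refl_one, hx]; simp

theorem fix_two (h : Chain s₁ s₂ s₃ σ n₁ n₂ n₃ t v f a b)
    {x : E3} (hx : ⟪n₂, x⟫ = 0) : σ s₂ x = x := by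
  rw [h.refl_two, hx]; simp

theorem fix_three (h : Chain s₁ s₂ s₃ σ n₁ n₂ n₃ t v f a b)
    {x : E3} (hx : ⟪n₃, x⟫ = 0) : σ s₃ x = x := h.reverse.fix_one hx

theorem v_two (h : Chain s₁ s₂ s₃ σ n₁ n₂ n₃ t v f a b) (w : G) : σ (w * s₂) v = σ w v := by
  rw [map_mul, Module.End.mul_apply, h.fix_two h.two_v]

theorem v_three (h : Chain s₁ s₂ s₃ σ n₁ n₂ n₃ t v f a b) (w : G) : σ (w * s₃) v = σ w v := by
  rw [map_mul, Module.End.mul_apply, h.fix_three h.three_v]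

theorem f_one (h : Chain s₁ s₂ s₃ σ n₁ n₂ n₃ t v f a b)
    (w : G) : σ (w * s₁) f = σ w f := h.reverse.v_three w

theorem f_two (h : Chain s₁ s₂ s₃ σ n₁ n₂ n₃ t v f a b)
    (w : G) : σ (w * s₂) f = σ w f := h.reverse.v_two w

theorem map_one_v (h : Chain s₁ s₂ s₃ σ n₁ n₂ n₃ t v f a b) : σ s₁ v = t - a • n₁ := by
  rw [h.refl_one, h.one_v, h.v_eq]; module

/-- Reflecting in a wall that separates from the chamber increases the product with dominant
vectors. -/
theorem ascent (h : Chain s₁ s₂ s₃ σ n₁ n₂ n₃ t v f a b)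
    {x c : E3} (hc : Dominant n₁ n₂ n₃ c) (hx : ¬ Dominant n₁ n₂ n₃ x) :
    ∃ s n, (s = s₁ ∧ n = n₁ ∨ s = s₂ ∧ n = n₂ ∨ s = s₃ ∧ n = n₃) ∧ ⟪n, x⟫ < 0 ∧
      ⟪σ s x, c⟫ = ⟪x, c⟫ - 2 * ⟪n, x⟫ * ⟪n, c⟫ ∧ ⟪x, c⟫ ≤ ⟪σ s x, c⟫ := by
  have key : ∀ n, ⟪n, x⟫ < 0 → 0 ≤ ⟪n, c⟫ →
      ⟪x - (2 * ⟪n, x⟫) • n, c⟫ = ⟪x, c⟫ - 2 * ⟪n, x⟫ * ⟪n, c⟫ ∧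
        ⟪x, c⟫ ≤ ⟪x - (2 * ⟪n, x⟫) • n, c⟫ := by
    intro n h1 h2
    have : ⟪x - (2 * ⟪n, x⟫) • n, c⟫ = ⟪x, c⟫ - 2 * ⟪n, x⟫ * ⟪n, c⟫ := by
      rw [inner_sub_left, inner_smul_left]; simp
    exact ⟨this, by rw [this]; nlinarith⟩
  simp only [Dominant, not_and_or, not_le] at hx
  rcases hx with k | k | k
  · exact ⟨s₁, n₁, by simp, k, by rw [h.refl_one]; exact key _ k hc.1⟩
  · exact ⟨s₂, n₂, by simp, k, by rw [h.refl_two]; exact key _ k hc.2.1⟩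
  · exact ⟨s₃, n₃, by simp, k, by rw [h.refl_three]; exact key _ k hc.2.2⟩

theorem dominant_rho (h : Chain s₁ s₂ s₃ σ n₁ n₂ n₃ t v f a b) : Dominant n₁ n₂ n₃ (v + f + t) := by
  have h1 := h.dominant_v
  have h2 := h.dominant_f
  have h3 := h.dominant_t
  simp only [Dominant, inner_add_right] at *
  exact ⟨by linarith, by linarith, by linarith⟩

theorem rho_pos (h : Chain s₁ s₂ s₃ σ n₁ n₂ n₃ t v f a b)
    {s : G} {n : E3} (hn : s = s₁ ∧ n = n₁ ∨ s = s₂ ∧ n = n₂ ∨ s = s₃ ∧ n = n₃) :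
    0 < ⟪n, v + f + t⟫ := by
  have h1 := h.dominant_v
  have h2 := h.dominant_f
  have h3 := h.dominant_t
  simp only [Dominant, inner_add_right] at *
  rcases hn with ⟨-, rfl⟩ | ⟨-, rfl⟩ | ⟨-, rfl⟩
  · linarith [h.one_v, h.a_pos]
  · linarith [h.pos_t]
  · linarith [h.three_f, h.b_pos]

variable [Finite G]

/-- A point of the finite orbit maximising the product with the interior point v + f + t is
dominant, as otherwise a reflection would increase that product. -/
theorem exists_dominant (h : Chain s₁ s₂ s₃ σ n₁ n₂ n₃ t v f a b)
    (c : E3) : ∃ w, Dominant n₁ n₂ n₃ (σ w c) := by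
  obtain ⟨w, hw⟩ := Finite.exists_max fun w => ⟪σ w c, v + f + t⟫
  refine ⟨w, ?_⟩
  by_contra hd
  obtain ⟨s, n, hs, hn, e, -⟩ := h.ascent h.dominant_rho hd
  have k := hw (s * w)
  rw [map_mul, Module.End.mul_apply, e] at k
  nlinarith [h.rho_pos hs]

/-- A property of points of an orbit which is preserved by ascending reflections and fails at the
dominant point never holds. -/
theorem not_of_ascent (h : Chain s₁ s₂ s₃ σ n₁ n₂ n₃ t v f a b)
    {x : E3} (hx : Dominant n₁ n₂ n₃ x) (p : E3 → Prop) (hp : ¬ p x)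
    (hs : ∀ w s n, (s = s₁ ∧ n = n₁ ∨ s = s₂ ∧ n = n₂ ∨ s = s₃ ∧ n = n₃) → ⟪n, σ w x⟫ < 0 →
      p (σ w x) → p (σ s (σ w x))) (w : G) : ¬ p (σ w x) := by
  intro hw
  have : Nonempty {w // p (σ w x)} := ⟨⟨w, hw⟩⟩
  obtain ⟨⟨u, hu⟩, hmax⟩ := Finite.exists_max fun w : {w // p (σ w x)} => ⟪σ w.1 x, v + f + t⟫
  by_cases hd : Dominant n₁ n₂ n₃ (σ u x)
  · rw [h.dominant_unique u x hx hd] at hu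
    exact hp hu
  · obtain ⟨s, n, hsn, hn, e, -⟩ := h.ascent h.dominant_rho hd
    have k := hmax ⟨s * u, by rw [map_mul, Module.End.mul_apply]; exact hs u s n hsn hn hu⟩
    simp only [map_mul, Module.End.mul_apply] at k
    rw [e] at k
    nlinarith [h.rho_pos hsn]

/-- Ascending reflections never decrease the product with a dominant c, so a value above that of the
dominant point would persist up to that point. -/
theorem inner_le (h : Chain s₁ s₂ s₃ σ n₁ n₂ n₃ t v f a b)
    {x c : E3} (hx : Dominant n₁ n₂ n₃ x) (hc : Dominant n₁ n₂ n₃ c) (w : G) :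
    ⟪σ w x, c⟫ ≤ ⟪x, c⟫ := by
  have := h.not_of_ascent hx (fun y => ⟪x, c⟫ < ⟪y, c⟫) (lt_irrefl _) ?_ w
  · exact not_lt.1 this
  · intro w s n hs hn hw
    have : ⟪n, c⟫ ≥ 0 := by
      rcases hs with ⟨-, rfl⟩ | ⟨-, rfl⟩ | ⟨-, rfl⟩
      exacts [hc.1, hc.2.1, hc.2.2]
    have e : σ s (σ w x) = σ w x - (2 * ⟪n, σ w x⟫) • n := by
      rcases hs with ⟨rfl, rfl⟩ | ⟨rfl, rfl⟩ | ⟨rfl, rfl⟩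
      exacts [h.refl_one _, h.refl_two _, h.refl_three _]
    simp only [e, inner_sub_left, inner_smul_left]
    simp only [RCLike.conj_to_real]
    nlinarith

theorem inner_le' (h : Chain s₁ s₂ s₃ σ n₁ n₂ n₃ t v f a b)
    {x c : E3} (hx : Dominant n₁ n₂ n₃ x) (hc : Dominant n₁ n₂ n₃ c) (u w : G) :
    ⟪σ u x, σ w c⟫ ≤ ⟪x, c⟫ := by
  rw [real_inner_comm, h.inner_map_left, real_inner_comm, ← Module.End.mul_apply, ← map_mul]
  exact h.inner_le hx hc _

/-- The points of an orbit which are extremal in a dominant direction are obtained from the dominant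
one by the reflections fixing the direction. -/
theorem of_inner_eq (h : Chain s₁ s₂ s₃ σ n₁ n₂ n₃ t v f a b)
    {x c : E3} (hx : Dominant n₁ n₂ n₃ x) (hc : Dominant n₁ n₂ n₃ c)
    (p : E3 → Prop) (hp : p x) (h1 : ⟪n₁, c⟫ = 0 → ∀ y, p y → p (σ s₁ y))
    (h2 : ⟪n₂, c⟫ = 0 → ∀ y, p y → p (σ s₂ y)) (h3 : ⟪n₃, c⟫ = 0 → ∀ y, p y → p (σ s₃ y))
    (w : G) (hw : ⟪σ w x, c⟫ = ⟪x, c⟫) : p (σ w x) := by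
  have := h.not_of_ascent hx (fun y => ⟪y, c⟫ = ⟪x, c⟫ ∧ ¬ p y) (fun k => k.2 hp) ?_ w
  · by_contra hn
    exact this ⟨hw, hn⟩
  · rintro w s n hs hn ⟨hw, hpw⟩
    have e : σ s (σ w x) = σ w x - (2 * ⟪n, σ w x⟫) • n := by
      rcases hs with ⟨rfl, rfl⟩ | ⟨rfl, rfl⟩ | ⟨rfl, rfl⟩
      exacts [h.refl_one _, h.refl_two _, h.refl_three _]
    have e2 : ⟪σ s (σ w x), c⟫ = ⟪σ w x, c⟫ - 2 * ⟪n, σ w x⟫ * ⟪n, c⟫ := by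
      rw [e, inner_sub_left, inner_smul_left]; simp
    have hle : ⟪σ s (σ w x), c⟫ ≤ ⟪x, c⟫ := by
      rw [← Module.End.mul_apply, ← map_mul]; exact h.inner_le hx hc _
    have hnc : 0 ≤ ⟪n, c⟫ := by
      rcases hs with ⟨-, rfl⟩ | ⟨-, rfl⟩ | ⟨-, rfl⟩
      exacts [hc.1, hc.2.1, hc.2.2]
    -- An ascent at the maximal value cannot increase the product with c, so its mirror contains c.
    have hz : ⟪n, c⟫ = 0 := by nlinarith
    refine ⟨by rw [e2, hz, hw]; ring, fun hq => hpw ?_⟩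
    have inv : ∀ s : G, s * s = 1 → σ s (σ s (σ w x)) = σ w x := by
      intro s hs
      rw [← Module.End.mul_apply, ← map_mul, hs, map_one, Module.End.one_apply]
    rcases hs with ⟨rfl, rfl⟩ | ⟨rfl, rfl⟩ | ⟨rfl, rfl⟩
    · rw [← inv _ h.flag.sq_one]; exact h1 hz _ hq
    · rw [← inv _ h.flag.sq_two]; exact h2 hz _ hq
    · rw [← inv _ h.flag.sq_three]; exact h3 hz _ hq

end Chain

/-! ### The regular polyhedron of a reflection group -/

/-- The vector of the affine hyperplane `⟪n, x⟫ = d`. -/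
def planeVec (n : E3) (d : ℝ) : Vec4 := ![n 0, n 1, n 2, d]

theorem inner_eq_sum (x y : E3) : ⟪x, y⟫ = x 0 * y 0 + x 1 * y 1 + x 2 * y 2 := by
  simp [EuclideanSpace.inner_eq_star_dotProduct, dotProduct, Fin.sum_univ_three]
  ring

theorem lor_planeVec (n m : E3) (d e : ℝ) :
    lor (planeVec n d) (planeVec m e) = ⟪n, m⟫ - d * e := by
  rw [lor_apply, inner_eq_sum]; rfl

theorem aff_eq_planeVec (u : E3) : aff u = planeVec u 1 := rfl

theorem lor_aff (u w : E3) : lor (aff u) (aff w) = ⟪u, w⟫ - 1 := by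
  rw [aff_eq_planeVec, aff_eq_planeVec, lor_planeVec, mul_one]

/-- The points of a convex hull maximizing a linear function lie in the convex hull of the
maximizing generators. -/
theorem mem_convexHull_of_eq_max {V : Set E3} {c x : E3} {M : ℝ} (hV : ∀ y ∈ V, ⟪y, c⟫ ≤ M)
    (hx : x ∈ convexHull ℝ V) (hM : ⟪x, c⟫ = M) : x ∈ convexHull ℝ {y ∈ V | ⟪y, c⟫ = M} := by
  -- The bound and the conclusion are proved together so that the set is convex: a proper convex
  -- combination attains M only if both endpoints do.
  have hC : Convex ℝ {x : E3 | ⟪x, c⟫ ≤ M ∧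
      (⟪x, c⟫ = M → x ∈ convexHull ℝ {y ∈ V | ⟪y, c⟫ = M})} := by
    rintro x ⟨hx1, hx2⟩ y ⟨hy1, hy2⟩ α β hα hβ hαβ
    have e : ⟪α • x + β • y, c⟫ = α * ⟪x, c⟫ + β * ⟪y, c⟫ := by
      rw [inner_add_left, inner_smul_left, inner_smul_left]; simp
    have kx := mul_le_mul_of_nonneg_left hx1 hα
    have ky := mul_le_mul_of_nonneg_left hy1 hβ
    have kM : α * M + β * M = M := by rw [← add_mul, hαβ, one_mul]
    refine ⟨by rw [e]; linarith, fun h => ?_⟩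
    rw [e] at h
    rcases hα.eq_or_lt with rfl | hα
    · have : β = 1 := by linarith
      subst this
      simpa using hy2 (by linarith)
    rcases hβ.eq_or_lt with rfl | hβ
    · have : α = 1 := by linarith
      subst this
      simpa using hx2 (by linarith)
    exact convex_convexHull ℝ _ (hx2 (mul_left_cancel₀ hα.ne' (by linarith)))
      (hy2 (mul_left_cancel₀ hβ.ne' (by linarith))) hα.le hβ.le hαβ
  refine (convexHull_min ?_ hC hx).2 hM
  intro y hy
  exact ⟨hV y hy, fun h => subset_convexHull ℝ _ ⟨hy, h⟩⟩

theorem inner_le_of_mem_convexHull {V : Set E3} {c x : E3} {M : ℝ} (hV : ∀ y ∈ V, ⟪y, c⟫ ≤ M)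
    (hx : x ∈ convexHull ℝ V) : ⟪x, c⟫ ≤ M := by
  have hC : Convex ℝ {x : E3 | ⟪x, c⟫ ≤ M} := by
    have : {x : E3 | ⟪x, c⟫ ≤ M} = {x : E3 | ⟪c, x⟫ ≤ M} := by
      ext x; rw [Set.mem_ofPred_eq, Set.mem_ofPred_eq, real_inner_comm]
    rw [this]
    exact convex_halfSpace_le (innerₛₗ ℝ c).isLinear M
  exact convexHull_min hV hC hx

/-- The orbit of a point. -/
def orb {G : Type*} [Group G] (σ : G →* Module.End ℝ E3) (x : E3) : Set E3 :=
  Set.range fun w => σ w x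

namespace Chain

variable {G : Type*} [Group G] {s₁ s₂ s₃ : G} {σ : G →* Module.End ℝ E3}
  {n₁ n₂ n₃ t v f : E3} {a b : ℝ}

/-- The value is 1 - 8ab⟨n₁, n₂⟩⟨n₃, n₂⟩, and both cosines are negative. -/
theorem inner_opposite (h : Chain s₁ s₂ s₃ σ n₁ n₂ n₃ t v f a b) (w : G) :
    ⟪σ (w * s₃ * s₂ * s₁) v, σ w f⟫ < 1 := by
  simp only [map_mul, Module.End.mul_apply, h.inner_map]
  have e1 : ⟪n₁, n₂⟫ < 0 := h.one_two
  have e2 : ⟪n₃, n₂⟫ < 0 := h.three_two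
  rw [h.refl_one, h.refl_two, h.refl_three]
  simp only [inner_sub_left, inner_sub_right, inner_smul_left, inner_smul_right, h.one_v,
    h.two_v, h.three_v, h.one_f, h.two_f, h.three_f, h.v_f, h.orth, real_inner_comm n₁ n₂,
    real_inner_comm n₁ n₃]
  simp only [RCLike.conj_to_real]
  have : 0 < a * b * (⟪n₁, n₂⟫ * ⟪n₃, n₂⟫) :=
    mul_pos (mul_pos h.a_pos h.b_pos) (mul_pos_of_neg_of_neg e1 e2)
  nlinarith

theorem isFamily [Finite G] (h : Chain s₁ s₂ s₃ σ n₁ n₂ n₃ t v f a b) :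
    IsFamily s₁ s₂ s₃ (fun w => a⁻¹ • aff (σ w v)) (fun w => b⁻¹ • aff (σ w f)) where
  unit_x w := by
    have := h.a_pos.ne'
    simp only [map_smul, LinearMap.smul_apply, lor_aff, h.inner_map, h.v_v, smul_eq_mul]
    field_simp
    ring
  unit_y w := by
    have := h.b_pos.ne'
    simp only [map_smul, LinearMap.smul_apply, lor_aff, h.inner_map, h.f_f, smul_eq_mul]
    field_simp
    ring
  x_two w := by simp only [h.v_two]
  x_three w := by simp only [h.v_three]
  y_one w := by simp only [h.f_one]
  y_two w := by simp only [h.f_two]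
  edge w := by
    have := h.a_pos.ne'
    have e : ⟪v, σ s₁ v⟫ = 1 - a ^ 2 := by
      rw [h.map_one_v, inner_sub_right, inner_smul_right, real_inner_comm, h.t_v,
        real_inner_comm, h.one_v]
      ring
    simp only [map_smul, LinearMap.smul_apply, lor_aff, map_mul, Module.End.mul_apply, h.inner_map,
      e, smul_eq_mul]
    field_simp
    ring
  future w := by
    have := h.a_pos
    simp [aff]
    positivity
  incident w := by
    simp [lor_aff, h.inner_map, h.v_f]
  nonpos u w := by
    have h1 := h.a_pos
    have h2 := h.b_pos
    have h3 := h.inner_le' h.dominant_v h.dominant_f u w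
    rw [h.v_f] at h3
    simp only [map_smul, LinearMap.smul_apply, lor_aff, smul_eq_mul]
    have : 0 < b⁻¹ * a⁻¹ := by positivity
    nlinarith
  neg w := by
    have h1 := h.a_pos
    have h2 := h.b_pos
    have h3 := h.inner_opposite w
    simp only [map_smul, LinearMap.smul_apply, lor_aff, smul_eq_mul]
    have : 0 < b⁻¹ * a⁻¹ := by positivity
    nlinarith

/-- Averaging over a subgroup. -/
theorem exists_average [Finite G] (h : Chain s₁ s₂ s₃ σ n₁ n₂ n₃ t v f a b) (H : Subgroup G)
    (x : E3) : ∃ m ∈ convexHull ℝ (orb σ x), (∀ w ∈ H, σ w m = m) ∧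
      ∀ y, (∀ w ∈ H, σ w y = y) → ⟪m, y⟫ = ⟪x, y⟫ := by
  have := Fintype.ofFinite H
  have hc : (Fintype.card H : ℝ) ≠ 0 := by exact_mod_cast Fintype.card_ne_zero
  refine ⟨∑ w : H, (Fintype.card H : ℝ)⁻¹ • σ w x, ?_, ?_, ?_⟩
  · apply (convex_convexHull ℝ _).sum_mem
    · intro _ _; positivity
    · simp [hc]
    · intro w _
      exact subset_convexHull ℝ _ ⟨w, rfl⟩
  · intro w hw
    rw [map_sum]
    refine Fintype.sum_equiv (Equiv.mulLeft (⟨w, hw⟩ : H)) _ _ fun u => ?_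
    simp [map_smul, map_mul]
  · intro y hy
    rw [sum_inner]
    have : ∀ u : H, ⟪(Fintype.card H : ℝ)⁻¹ • σ u x, y⟫ = (Fintype.card H : ℝ)⁻¹ * ⟪x, y⟫ := by
      intro u
      rw [inner_smul_left, h.inner_map_left, hy _ (H.inv_mem u.2)]; simp
    simp only [this]
    simp

theorem map_mem_convexHull_orb (w : G) {x y : E3} (hy : y ∈ convexHull ℝ (orb σ x)) :
    σ w y ∈ convexHull ℝ (orb σ x) := by
  have h1 : (σ w) '' convexHull ℝ (orb σ x) ⊆ convexHull ℝ (orb σ x) := by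
    rw [LinearMap.image_convexHull]
    apply convexHull_mono
    rintro _ ⟨_, ⟨u, rfl⟩, rfl⟩
    exact ⟨w * u, by simp [map_mul]⟩
  exact h1 ⟨y, hy, rfl⟩

theorem zero_mem [Finite G] (h : Chain s₁ s₂ s₃ σ n₁ n₂ n₃ t v f a b) (x : E3) :
    0 ∈ convexHull ℝ (orb σ x) := by
  obtain ⟨m, hm, hm', -⟩ := h.exists_average ⊤ x
  have key : ∀ s n, (s = s₁ ∧ n = n₁ ∨ s = s₂ ∧ n = n₂ ∨ s = s₃ ∧ n = n₃) → ⟪n, m⟫ = 0 := by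
    intro s n hs
    have e := hm' s trivial
    have u : ⟪n, n⟫ = 1 := by
      rcases hs with ⟨-, rfl⟩ | ⟨-, rfl⟩ | ⟨-, rfl⟩
      exacts [h.unit_one, h.unit_two, h.unit_three]
    have e' : σ s m = m - (2 * ⟪n, m⟫) • n := by
      rcases hs with ⟨rfl, rfl⟩ | ⟨rfl, rfl⟩ | ⟨rfl, rfl⟩
      exacts [h.refl_one _, h.refl_two _, h.refl_three _]
    rw [e'] at e
    have := congrArg (fun z => ⟪n, z⟫) e
    simp only [inner_sub_right, inner_smul_right, u] at this
    linarith
  rw [← h.eq_zero_of_orth (key s₁ n₁ (by simp)) (key s₂ n₂ (by simp)) (key s₃ n₃ (by simp))]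
  exact hm

/-- The average of f over the stabiliser of v is fixed by s₂ and s₃, hence a multiple of v. Its
product with v is still ⟨f, v⟩ = 1, and |v|² = 1 + a². -/
theorem smul_vertex_mem [Finite G] (h : Chain s₁ s₂ s₃ σ n₁ n₂ n₃ t v f a b) :
    (1 + a ^ 2)⁻¹ • v ∈ convexHull ℝ (orb σ f) := by
  let H : Subgroup G :=
    { carrier := {w | σ w v = v}
      one_mem' := by simp
      mul_mem' := by
        intro u w hu hw
        simp only [Set.mem_ofPred_eq] at *
        rw [map_mul, Module.End.mul_apply, hw, hu]
      inv_mem' := by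
        intro u hu
        simp only [Set.mem_ofPred_eq] at *
        nth_rw 1 [← hu]
        exact map_inv_map u v }
  obtain ⟨m, hm, hm1, hm2⟩ := h.exists_average H f
  have m2 : ⟪n₂, m⟫ = 0 := by
    have e := hm1 s₂ (h.fix_two h.two_v)
    rw [h.refl_two] at e
    have := congrArg (fun z => ⟪n₂, z⟫) e
    simp only [inner_sub_right, inner_smul_right, h.unit_two] at this
    linarith
  have m3 : ⟪n₃, m⟫ = 0 := by
    have e := hm1 s₃ (h.fix_three h.three_v)
    rw [h.refl_three] at e
    have := congrArg (fun z => ⟪n₃, z⟫) e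
    simp only [inner_sub_right, inner_smul_right, h.unit_three] at this
    linarith
  have e : m = (⟪n₁, m⟫ / a) • v := by
    rw [← sub_eq_zero]
    have := h.a_pos.ne'
    apply h.eq_zero_of_orth
    · rw [inner_sub_right, inner_smul_right, h.one_v]; field_simp; ring
    · rw [inner_sub_right, inner_smul_right, h.two_v, m2]; ring
    · rw [inner_sub_right, inner_smul_right, h.three_v, m3]; ring
  have e2 := hm2 v fun w hw => hw
  rw [real_inner_comm v f, h.v_f, e, inner_smul_left, h.v_v] at e2
  simp only [RCLike.conj_to_real] at e2
  have : (1 + a ^ 2)⁻¹ = ⟪n₁, m⟫ / a := by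
    have : (1 + a ^ 2) ≠ 0 := by positivity
    have ha := h.a_pos.ne'
    field_simp
    field_simp at e2
    linarith
  rw [this, ← e]
  exact hm

theorem midpoint_mem (h : Chain s₁ s₂ s₃ σ n₁ n₂ n₃ t v f a b) :
    t ∈ segment ℝ v (σ s₁ v) := by
  refine ⟨1 / 2, 1 / 2, by norm_num, by norm_num, by norm_num, ?_⟩
  rw [h.map_one_v, h.v_eq]
  module

theorem vertex_mem_orb (x : E3) : x ∈ orb σ x := ⟨1, by simp⟩

theorem convexHull_subset_polarSet [Finite G] (h : Chain s₁ s₂ s₃ σ n₁ n₂ n₃ t v f a b) :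
    convexHull ℝ (orb σ f) ⊆ polarSet (convexHull ℝ (orb σ v)) := by
  intro y hy x hx
  apply inner_le_of_mem_convexHull _ hy
  rintro _ ⟨w, rfl⟩
  dsimp only
  rw [real_inner_comm]
  apply inner_le_of_mem_convexHull _ hx
  rintro _ ⟨u, rfl⟩
  rw [← h.v_f]
  exact h.inner_le' h.dominant_v h.dominant_f u w

/-- A point of the polar is moved into the chamber and written as αv + βt + γf. The inequality at a
vertex bounds these coefficients, and what remains is a convex combination of points of the hull of
the orbit of f. -/
theorem polarSet_eq [Finite G] (h : Chain s₁ s₂ s₃ σ n₁ n₂ n₃ t v f a b) :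
    polarSet (convexHull ℝ (orb σ v)) = convexHull ℝ (orb σ f) := by
  apply Set.Subset.antisymm _ h.convexHull_subset_polarSet
  intro x hx
  obtain ⟨w, hw⟩ := h.exists_dominant x
  obtain ⟨α, β, γ, hα, hβ, hγ, e⟩ := h.exists_nonneg_comb hw
  have hle : α * (1 + a ^ 2) + β + γ ≤ 1 := by
    have := hx (σ w⁻¹ v) (subset_convexHull ℝ _ ⟨w⁻¹, rfl⟩)
    rw [← h.inner_map_left, e] at this
    simp only [inner_add_left, inner_smul_left, h.v_v, h.t_v, real_inner_comm v f, h.v_f] at this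
    simpa using this
  have hf : f ∈ convexHull ℝ (orb σ f) := subset_convexHull ℝ _ (vertex_mem_orb f)
  have ht : t ∈ convexHull ℝ (orb σ f) := by
    have := h.reverse.midpoint_mem
    exact (convex_convexHull ℝ _).segment_subset hf (map_mem_convexHull_orb _ hf) this
  have hC := convex_convexHull ℝ (orb σ f)
  have key : σ w x ∈ convexHull ℝ (orb σ f) := by
    rw [e]
    have hp : (1 + a ^ 2) ≠ 0 := by positivity
    -- The weights belong to v/(1 + a²), t, f and 0; the origin absorbs the slack in α(1 + a²) + β +
    -- γ ≤ 1.
    have := hC.sum_mem (t := Finset.univ)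
      (w := ![α * (1 + a ^ 2), β, γ, 1 - (α * (1 + a ^ 2) + β + γ)])
      (z := ![(1 + a ^ 2)⁻¹ • v, t, f, 0])
      (by
        intro i _
        fin_cases i
        · simp; positivity
        · simpa using hβ
        · simpa using hγ
        · simpa using hle)
      (by simp [Fin.sum_univ_four])
      (by
        intro i _
        fin_cases i
        · exact h.smul_vertex_mem
        · exact ht
        · exact hf
        · exact h.zero_mem f)
    simpa [Fin.sum_univ_four, smul_smul, hp] using this
  rw [← map_inv_map (σ := σ) w x]
  exact map_mem_convexHull_orb _ key

/-- The orbit lies on a sphere, all of whose points are extreme in the closed ball. -/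
theorem extremePoints_eq (h : Chain s₁ s₂ s₃ σ n₁ n₂ n₃ t v f a b) (x : E3) :
    (convexHull ℝ (orb σ x)).extremePoints ℝ = orb σ x := by
  apply Set.Subset.antisymm extremePoints_convexHull_subset
  have nrm : ∀ w, ‖σ w x‖ = ‖x‖ := by
    intro w
    rw [← sq_eq_sq₀ (norm_nonneg _) (norm_nonneg _), ← real_inner_self_eq_norm_sq, h.inner_map,
      real_inner_self_eq_norm_sq]
  have hsub : convexHull ℝ (orb σ x) ⊆ Metric.closedBall 0 ‖x‖ := by
    apply convexHull_min _ (convex_closedBall _ _)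
    rintro _ ⟨w, rfl⟩
    simp [nrm]
  intro y hy
  apply inter_extremePoints_subset_extremePoints_of_subset hsub
  refine ⟨subset_convexHull ℝ _ hy, ?_⟩
  rw [StrictConvexSpace.extremePoints_closedBall_eq_sphere]
  obtain ⟨w, rfl⟩ := hy
  simp [nrm]

theorem finite_orb [Finite G] (x : E3) : (orb σ x).Finite := Set.finite_range _

/-- The hull is a polar by `polarSet_eq` for the reversed chain, and the polar of a bounded set
contains a neighbourhood of the origin. -/
theorem zero_mem_interior [Finite G] (h : Chain s₁ s₂ s₃ σ n₁ n₂ n₃ t v f a b) :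
    (0 : E3) ∈ interior (convexHull ℝ (orb σ v)) := by
  rw [← h.reverse.polarSet_eq, mem_interior]
  obtain ⟨R, hR⟩ := ((finite_orb (σ := σ) f).isCompact_convexHull ℝ).isBounded.subset_closedBall 0
  refine ⟨Metric.ball 0 (1 / (|R| + 1)), ?_, Metric.isOpen_ball, by simp; positivity⟩
  intro u hu x hx
  have h1 := hR hx
  rw [mem_closedBall_zero_iff] at h1
  rw [mem_ball_zero_iff] at hu
  have h2 := real_inner_le_norm u x
  have h3 : ‖u‖ * ‖x‖ ≤ 1 / (|R| + 1) * (|R| + 1) :=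
    mul_le_mul hu.le (h1.trans (by linarith [le_abs_self R])) (norm_nonneg _) (by positivity)
  have h4 : 1 / (|R| + 1) * (|R| + 1) = 1 := by
    have : |R| + 1 ≠ 0 := by positivity
    field_simp
  linarith

theorem isPolyhedron [Finite G] (h : Chain s₁ s₂ s₃ σ n₁ n₂ n₃ t v f a b) :
    IsPolyhedron (convexHull ℝ (orb σ v)) :=
  ⟨⟨_, finite_orb v, rfl⟩, ⟨0, h.zero_mem_interior⟩⟩

end Chain

/-! ### Faces of polytopes -/

/-- The points of `P` that are extremal in the direction `c`. -/
def faceOf (P : Set E3) (c : E3) : Set E3 := {x ∈ P | ∀ y ∈ P, ⟪y, c⟫ ≤ ⟪x, c⟫}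

theorem isExposed_faceOf (P : Set E3) (c : E3) : IsExposed ℝ P (faceOf P c) := by
  intro _
  refine ⟨innerSL ℝ c, ?_⟩
  ext x
  simp only [faceOf, Set.mem_ofPred_eq, innerSL_apply_apply, real_inner_comm]

theorem exists_faceOf {P F : Set E3} (hF : IsExposed ℝ P F) (hne : F.Nonempty) :
    ∃ c, F = faceOf P c := by
  obtain ⟨l, hl⟩ := hF hne
  refine ⟨(InnerProductSpace.toDual ℝ E3).symm l, ?_⟩
  have e : ∀ y, ⟪y, (InnerProductSpace.toDual ℝ E3).symm l⟫ = l y := fun y => by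
    rw [real_inner_comm, InnerProductSpace.toDual_symm_apply]
  simp only [hl, faceOf, e]

/-- A convex hull of finitely many points. -/
def IsPolytope (P : Set E3) : Prop := ∃ V : Set E3, V.Finite ∧ P = convexHull ℝ V

namespace IsPolytope

variable {P : Set E3}

theorem isCompact (hP : IsPolytope P) : IsCompact P := by
  obtain ⟨V, hV, rfl⟩ := hP
  exact hV.isCompact_convexHull ℝ

theorem convex (hP : IsPolytope P) : Convex ℝ P := by
  obtain ⟨V, hV, rfl⟩ := hP
  exact convex_convexHull ℝ V

theorem finite_extremePoints (hP : IsPolytope P) : (P.extremePoints ℝ).Finite := by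
  obtain ⟨V, hV, rfl⟩ := hP
  exact hV.subset extremePoints_convexHull_subset

theorem convexHull_extremePoints_face (hP : IsPolytope P) {F : Set E3} (hF : IsExposed ℝ P F) :
    convexHull ℝ (F ∩ P.extremePoints ℝ) = F := by
  rw [← hF.isExtreme.extremePoints_eq]
  have h1 : (F.extremePoints ℝ).Finite := by
    rw [hF.isExtreme.extremePoints_eq]
    exact hP.finite_extremePoints.inter_of_right _
  rw [← (h1.isCompact_convexHull ℝ).isClosed.closure_eq]
  exact closure_convexHull_extremePoints (hF.isCompact hP.isCompact) (hF.convex hP.convex)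

theorem convexHull_extremePoints (hP : IsPolytope P) : convexHull ℝ (P.extremePoints ℝ) = P := by
  have := hP.convexHull_extremePoints_face (IsExposed.refl P)
  rwa [Set.inter_eq_self_of_subset_right extremePoints_subset] at this

/-- Hahn–Banach separates the vertex from the compact hull of the other vertices. Thus vertices
belong to the lattice of exposed faces, as its atoms. -/
theorem isExposed_singleton (hP : IsPolytope P) {x : E3} (hx : x ∈ P.extremePoints ℝ) :
    IsExposed ℝ P {x} := by
  have hxV := (hP.convex.mem_extremePoints_iff_mem_sdiff_convexHull_sdiff.1 hx)
  set S := P.extremePoints ℝ \ {x} with hS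
  have hSf : S.Finite := hP.finite_extremePoints.sdiff
  have hxS : x ∉ convexHull ℝ S := fun h =>
    hxV.2 (convexHull_mono (Set.sdiff_subset_sdiff_left extremePoints_subset) h)
  obtain ⟨l, u, h1, h2⟩ := geometric_hahn_banach_closed_point (convex_convexHull ℝ S)
    (hSf.isCompact_convexHull ℝ).isClosed hxS
  set c := (InnerProductSpace.toDual ℝ E3).symm l with hc
  have hl : ∀ y, l y = ⟪y, c⟫ := fun y => by
    rw [hc, real_inner_comm, InnerProductSpace.toDual_symm_apply]
  have hmax : ∀ y ∈ P.extremePoints ℝ, ⟪y, c⟫ ≤ ⟪x, c⟫ := by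
    intro y hy
    by_cases hyx : y = x
    · rw [hyx]
    · have := h1 y (subset_convexHull ℝ _ ⟨hy, hyx⟩)
      rw [← hl, ← hl]
      linarith
  have hle : ∀ y ∈ P, ⟪y, c⟫ ≤ ⟪x, c⟫ := by
    intro y hy
    rw [← hP.convexHull_extremePoints] at hy
    exact inner_le_of_mem_convexHull hmax hy
  have : faceOf P c = {x} := by
    apply Set.Subset.antisymm
    · rintro y ⟨hy, hy'⟩
      have e : ⟪y, c⟫ = ⟪x, c⟫ := le_antisymm (hle y hy) (hy' x hx.1)
      rw [← hP.convexHull_extremePoints] at hy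
      have := mem_convexHull_of_eq_max hmax hy e
      have hs : {z ∈ P.extremePoints ℝ | ⟪z, c⟫ = ⟪x, c⟫} ⊆ {x} := by
        rintro z ⟨hz, hz'⟩
        by_contra hzx
        have := h1 z (subset_convexHull ℝ _ ⟨hz, hzx⟩)
        rw [hl, hz', ← hl] at this
        linarith
      simpa using convexHull_mono hs this
    · rintro _ rfl
      exact ⟨hx.1, hle⟩
  rw [← this]
  exact isExposed_faceOf P c

end IsPolytope

theorem IsPolyhedron.isPolytope {P : Set E3} (hP : IsPolyhedron P) : IsPolytope P := hP.1

/-- The empty face. -/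
instance facesOrderBot (P : Set E3) : OrderBot (Faces P) where
  bot := ⟨∅, isExposed_empty⟩
  bot_le F := Set.empty_subset F.1

theorem faces_ne_bot_iff {P : Set E3} {F : Faces P} : F ≠ ⊥ ↔ F.1.Nonempty := by
  rw [Set.nonempty_iff_ne_empty, Ne, Ne, Subtype.ext_iff]; rfl

theorem IsPolytope.isAtom_iff {P : Set E3} (hP : IsPolytope P) (F : Faces P) :
    IsAtom F ↔ ∃ x ∈ P.extremePoints ℝ, F.1 = {x} := by
  constructor
  · intro hF
    have hne := faces_ne_bot_iff.1 hF.1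
    have h1 := hP.convexHull_extremePoints_face F.2
    have h2 : (F.1 ∩ P.extremePoints ℝ).Nonempty := by
      rw [← convexHull_nonempty_iff (𝕜 := ℝ), h1]; exact hne
    obtain ⟨x, hxF, hx⟩ := h2
    refine ⟨x, hx, ?_⟩
    have := hF.le_iff.1 (show (⟨{x}, hP.isExposed_singleton hx⟩ : Faces P) ≤ F from
      Set.singleton_subset_iff.2 hxF)
    rcases this with h | h
    · exact absurd h (faces_ne_bot_iff.2 (Set.singleton_nonempty x))
    · rw [← h]
  · rintro ⟨x, hx, hF⟩
    refine ⟨faces_ne_bot_iff.2 (by rw [hF]; exact Set.singleton_nonempty x), fun F' hF' => ?_⟩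
    by_contra hne
    obtain ⟨y, hy⟩ := faces_ne_bot_iff.1 hne
    apply hF'.not_ge
    change F.1 ⊆ F'.1
    have h1 : y ∈ F.1 := hF'.le hy
    rw [hF, Set.mem_singleton_iff] at h1
    rw [hF, Set.singleton_subset_iff, ← h1]
    exact hy

/-- An isomorphism of face lattices induces a bijection of the vertices. -/
theorem exists_vertexMap {K P : Set E3} (hK : IsPolytope K) (hP : IsPolytope P)
    (ι : Faces K ≃o Faces P) : ∃ φ : E3 → E3,
      Set.BijOn φ (K.extremePoints ℝ) (P.extremePoints ℝ) ∧
      ∀ (F : Faces K), ∀ x ∈ K.extremePoints ℝ, φ x ∈ (ι F).1 ↔ x ∈ F.1 := by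
  classical
  have key : ∀ x, ∃ y, ∀ hx : x ∈ K.extremePoints ℝ, y ∈ P.extremePoints ℝ ∧
      (ι ⟨{x}, hK.isExposed_singleton hx⟩).1 = {y} := by
    intro x
    by_cases hx : x ∈ K.extremePoints ℝ
    · have h1 : IsAtom (⟨{x}, hK.isExposed_singleton hx⟩ : Faces K) :=
        (hK.isAtom_iff _).2 ⟨x, hx, rfl⟩
      obtain ⟨y, hy, hy'⟩ := (hP.isAtom_iff _).1 ((ι.isAtom_iff _).2 h1)
      exact ⟨y, fun _ => ⟨hy, hy'⟩⟩
    · exact ⟨0, fun h => absurd h hx⟩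
  choose φ hφ using key
  have inc : ∀ (F : Faces K), ∀ x ∈ K.extremePoints ℝ, φ x ∈ (ι F).1 ↔ x ∈ F.1 := by
    intro F x hx
    have h1 : (⟨{x}, hK.isExposed_singleton hx⟩ : Faces K) ≤ F ↔ x ∈ F.1 :=
      Set.singleton_subset_iff
    rw [← h1, ← ι.le_iff_le, ← Subtype.coe_le_coe, (hφ x hx).2]
    exact Set.singleton_subset_iff.symm
  refine ⟨φ, ⟨fun x hx => (hφ x hx).1, ?_, ?_⟩, inc⟩
  · intro x hx y hy hxy
    have h1 := (inc ⟨{y}, hK.isExposed_singleton hy⟩ x hx).1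
    rw [(hφ y hy).2] at h1
    exact h1 hxy
  · intro y hy
    have h1 : IsAtom (⟨{y}, hP.isExposed_singleton hy⟩ : Faces P) :=
      (hP.isAtom_iff _).2 ⟨y, hy, rfl⟩
    obtain ⟨x, hx, hx'⟩ := (hK.isAtom_iff _).1 ((ι.symm.isAtom_iff _).2 h1)
    refine ⟨x, hx, ?_⟩
    have h2 := (hφ x hx).2
    have h3 : (⟨{x}, hK.isExposed_singleton hx⟩ : Faces K) =
        ι.symm ⟨{y}, hP.isExposed_singleton hy⟩ := Subtype.ext hx'.symm
    rw [h3, ι.apply_symm_apply] at h2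
    exact (Set.singleton_injective h2).symm

/-! ### The edges of the regular polyhedron -/

namespace Chain

variable {G : Type*} [Group G] {s₁ s₂ s₃ : G} {σ : G →* Module.End ℝ E3}
  {n₁ n₂ n₃ t v f : E3} {a b : ℝ}

/-- By `of_inner_eq` only the reflections fixing c matter. Here s₂ does not fix it, and s₁, s₃
preserve the pair of endpoints. -/
theorem orb_eq_edge [Finite G] (h : Chain s₁ s₂ s₃ σ n₁ n₂ n₃ t v f a b) {c : E3}
    (hc : Dominant n₁ n₂ n₃ c) (hc2 : 0 < ⟪n₂, c⟫) (w : G) (hw : ⟪σ w v, c⟫ = ⟪v, c⟫) :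
    σ w v = v ∨ σ w v = σ s₁ v := by
  refine h.of_inner_eq h.dominant_v hc (fun y => y = v ∨ y = σ s₁ v) (Or.inl rfl) ?_ ?_ ?_ w hw
  · rintro - y (rfl | rfl)
    · exact Or.inr rfl
    · left
      rw [← Module.End.mul_apply, ← map_mul, h.flag.sq_one, map_one, Module.End.one_apply]
  · intro hz
    exact absurd hz hc2.ne'
  · rintro - y (rfl | rfl)
    · exact Or.inl (h.fix_three h.three_v)
    · right
      rw [← Module.End.mul_apply, ← map_mul, ← h.flag.comm, map_mul, Module.End.mul_apply,
        h.fix_three h.three_v]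

theorem orb_eq_vertex [Finite G] (h : Chain s₁ s₂ s₃ σ n₁ n₂ n₃ t v f a b) {c : E3}
    (hc : Dominant n₁ n₂ n₃ c) (hc1 : 0 < ⟪n₁, c⟫) (w : G) (hw : ⟪σ w v, c⟫ = ⟪v, c⟫) :
    σ w v = v := by
  refine h.of_inner_eq h.dominant_v hc (fun y => y = v) rfl ?_ ?_ ?_ w hw
  · intro hz
    exact absurd hz hc1.ne'
  · rintro - y rfl
    exact h.fix_two h.two_v
  · rintro - y rfl
    exact h.fix_three h.three_v

/-- The exposing direction is moved into the chamber. The walls containing it decide whether the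
face is a vertex, an image of the segment from v to s₁v tangent at t, or of larger dimension. -/
theorem edgeScribed [Finite G] (h : Chain s₁ s₂ s₃ σ n₁ n₂ n₃ t v f a b) :
    EdgeScribed (convexHull ℝ (orb σ v)) := by
  rintro F ⟨hexp, hne, hrank⟩
  set K := convexHull ℝ (orb σ v) with hK
  obtain ⟨c, rfl⟩ := exists_faceOf hexp hne
  obtain ⟨w, hw⟩ := h.exists_dominant c
  have inv : ∀ x, ⟪σ w x, σ w c⟫ = ⟪x, c⟫ := fun x => h.inner_map w x c
  set c' := σ w c with hc'
  have hmax : ∀ y ∈ orb σ v, ⟪y, c'⟫ ≤ ⟪v, c'⟫ := by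
    rintro _ ⟨u, rfl⟩
    exact h.inner_le h.dominant_v hw u
  have mem : ∀ x, x ∈ faceOf K c ↔ σ w x ∈ K ∧ ⟪σ w x, c'⟫ = ⟪v, c'⟫ := by
    intro x
    constructor
    · rintro ⟨hx, hx'⟩
      have hx2 := map_mem_convexHull_orb w hx
      refine ⟨hx2, le_antisymm (inner_le_of_mem_convexHull hmax hx2) ?_⟩
      have := hx' (σ w⁻¹ v) (subset_convexHull ℝ _ ⟨w⁻¹, rfl⟩)
      rwa [← inv, ← inv, map_map_inv] at this
    · rintro ⟨hx, hx'⟩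
      refine ⟨?_, fun y hy => ?_⟩
      · have := map_mem_convexHull_orb w⁻¹ hx
        rwa [map_inv_map] at this
      · rw [← inv, ← inv, hx']
        exact inner_le_of_mem_convexHull hmax (map_mem_convexHull_orb w hy)
  have vert : ∀ x ∈ faceOf K c, σ w x ∈ convexHull ℝ {y ∈ orb σ v | ⟪y, c'⟫ = ⟪v, c'⟫} :=
    fun x hx => mem_convexHull_of_eq_max hmax ((mem x).1 hx).1 ((mem x).1 hx).2
  have inj : ∀ x y, σ w x = y → x = σ w⁻¹ y := by
    rintro x _ rfl
    rw [map_inv_map]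
  have memorb : ∀ u, ⟪σ u v, c'⟫ = ⟪v, c'⟫ → σ w⁻¹ (σ u v) ∈ faceOf K c := by
    intro u hu
    rw [mem, map_map_inv]
    exact ⟨subset_convexHull ℝ _ ⟨u, rfl⟩, hu⟩
  have mem1 : σ w⁻¹ v ∈ faceOf K c := by simpa using memorb 1 (by simp)
  rcases hw.1.eq_or_lt with z1 | z1
  · have hs1 : σ s₁ c' = c' := h.fix_one z1.symm
    have is1 : s₁⁻¹ = s₁ := inv_eq_of_mul_eq_one_left h.flag.sq_one
    have mem2 : σ w⁻¹ (σ s₁ v) ∈ faceOf K c := memorb s₁ (by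
      rw [h.inner_map_left, is1, hs1])
    rcases hw.2.1.eq_or_lt with z2 | z2
    -- If the direction lies on the first two walls, the face contains images of v, s₁v and s₂s₁v;
    -- pairing with n₃ shows that they are not collinear.
    · exfalso
      have hs2 : σ s₂ c' = c' := h.fix_two z2.symm
      have is2 : s₂⁻¹ = s₂ := inv_eq_of_mul_eq_one_left h.flag.sq_two
      have mem3 : σ w⁻¹ (σ s₂ (σ s₁ v)) ∈ faceOf K c := by
        have := memorb (s₂ * s₁) (by
          rw [map_mul, Module.End.mul_apply, h.inner_map_left, is2, hs2, h.inner_map_left, is1,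
            hs1])
        rwa [map_mul, Module.End.mul_apply] at this
      have d1 : σ s₁ v - v = -((2 * a) • n₁) := by rw [h.map_one_v, h.v_eq]; module
      have d2 : σ s₂ (σ s₁ v) - v = -((2 * a) • σ s₂ n₁) := by
        have := congrArg (σ s₂) d1
        rwa [map_sub, h.fix_two h.two_v, map_neg, map_smul] at this
      have m1 := vsub_mem_vectorSpan ℝ mem2 mem1
      have m2 := vsub_mem_vectorSpan ℝ mem3 mem1
      rw [vsub_eq_sub, ← map_sub, d1] at m1
      rw [vsub_eq_sub, ← map_sub, d2] at m2
      have ha := h.a_pos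
      have ne : (⟨_, m1⟩ : vectorSpan ℝ (faceOf K c)) ≠ 0 := by
        intro hz
        have hz' := congrArg (σ w) (Subtype.ext_iff.1 hz)
        simp only [map_map_inv, ZeroMemClass.coe_zero, map_zero, neg_eq_zero, smul_eq_zero] at hz'
        rcases hz' with hz' | hz'
        · linarith
        · have := h.unit_one
          rw [hz'] at this
          simp at this
      obtain ⟨k, hk⟩ := (finrank_eq_one_iff_of_nonzero' _ ne).1 hrank ⟨_, m2⟩
      have hk' := congrArg (σ w) (Subtype.ext_iff.1 hk)
      simp only [SetLike.val_smul, map_smul, map_map_inv] at hk'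
      have hk3 := congrArg (fun z => ⟪n₃, z⟫) hk'
      simp only [h.refl_two, inner_smul_right, inner_neg_right, inner_sub_right,
        real_inner_comm n₁ n₃, h.orth] at hk3
      have := mul_pos_of_neg_of_neg h.one_two h.three_two
      have := mul_pos ha this
      rw [real_inner_comm] at this
      nlinarith [real_inner_comm n₁ n₂, real_inner_comm n₃ n₂]
    · have sub : ∀ x ∈ faceOf K c, σ w x ∈ segment ℝ v (σ s₁ v) := by
        intro x hx
        rw [← convexHull_pair]
        refine convexHull_mono ?_ (vert x hx)
        rintro _ ⟨⟨u, rfl⟩, hu⟩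
        exact h.orb_eq_edge hw z2 u hu
      refine ⟨σ w⁻¹ t, ?_, ?_, ?_⟩
      · rw [mem, map_map_inv]
        have ht := h.midpoint_mem
        refine ⟨(convex_convexHull ℝ _).segment_subset (subset_convexHull ℝ _ (vertex_mem_orb v))
          (subset_convexHull ℝ _ ⟨s₁, rfl⟩) ht, ?_⟩
        rw [h.v_eq, inner_add_left, inner_smul_left, ← z1]
        simp
      · rw [← sq_eq_sq₀ (norm_nonneg _) zero_le_one, ← real_inner_self_eq_norm_sq, h.inner_map,
          h.unit_t, one_pow]
      · intro x hx
        rw [h.inner_map_left, inv_inv]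
        obtain ⟨α, β, -, -, hαβ, e⟩ := sub x hx
        have t2 : ⟪t, σ s₁ v⟫ = 1 := by
          rw [h.map_one_v, inner_sub_right, inner_smul_right, h.unit_t, real_inner_comm,
            h.orth_one]
          ring
        rw [← e, inner_add_right, inner_smul_right, inner_smul_right, h.t_v, t2]
        linarith
  · exfalso
    have sub : faceOf K c ⊆ {σ w⁻¹ v} := by
      intro x hx
      apply inj
      have h1 := vert x hx
      have h2 : {y ∈ orb σ v | ⟪y, c'⟫ = ⟪v, c'⟫} ⊆ {v} := by
        rintro _ ⟨⟨u, rfl⟩, hu⟩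
        exact h.orb_eq_vertex hw z1 u hu
      simpa using convexHull_mono h2 h1
    have e : vectorSpan ℝ (faceOf K c) = ⊥ := by
      rw [Set.eq_singleton_iff_nonempty_unique_mem.2 ⟨hne, fun x hx => sub hx⟩]
      exact vectorSpan_singleton ℝ _
    rw [e, finrank_bot] at hrank
    omega

end Chain

/-! ### The flag family of an edge-scribed polyhedron -/

/-- The Lorentzian vector of the cap with apex `u`. -/
def capVec (u : E3) : Vec4 := (Real.sqrt (⟪u, u⟫ - 1))⁻¹ • aff u

theorem lor_capVec_self {u : E3} (hu : 1 < ⟪u, u⟫) : lor (capVec u) (capVec u) = 1 := by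
  have h1 : 0 < Real.sqrt (⟪u, u⟫ - 1) := Real.sqrt_pos.2 (by linarith)
  have h2 : Real.sqrt (⟪u, u⟫ - 1) ^ 2 = ⟪u, u⟫ - 1 := Real.sq_sqrt (by linarith)
  simp only [capVec, map_smul, LinearMap.smul_apply, lor_aff, smul_eq_mul]
  generalize Real.sqrt (⟪u, u⟫ - 1) = S at *
  rw [← h2]
  field_simp

theorem posSide_capVec {u : E3} (hu : 1 < ⟪u, u⟫) : posSide (capVec u) = illum u := by
  rw [illum_eq, capVec, posSide_smul]
  exact inv_pos.2 (Real.sqrt_pos.2 (by linarith))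

/-- Pairing τ = θp + ηp' with p and p' gives θA + ηC = 0 = θC + ηB, hence C² = AB and C ≤ 0. For
normalised caps this is tangency, product -1. -/
theorem inner_of_tangent {p p' τ : E3} (hseg : τ ∈ segment ℝ p p')
    (h1 : ⟪τ, p⟫ = 1) (h2 : ⟪τ, p'⟫ = 1) (hp : 1 < ⟪p, p⟫) (hp' : 1 < ⟪p', p'⟫) :
    ⟪p, p'⟫ - 1 = -(Real.sqrt (⟪p, p⟫ - 1) * Real.sqrt (⟪p', p'⟫ - 1)) := by
  obtain ⟨θ, η, hθ, hη, hs, e⟩ := hseg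
  have e1 := congrArg (fun z => ⟪p, z⟫) e
  have e2 := congrArg (fun z => ⟪p', z⟫) e
  simp only [inner_add_right, inner_smul_right] at e1 e2
  rw [real_inner_comm] at h1 h2
  rw [h1] at e1
  rw [h2, real_inner_comm p p'] at e2
  set A := ⟪p, p⟫ - 1 with hA
  set B := ⟪p', p'⟫ - 1 with hB
  set C := ⟪p, p'⟫ - 1 with hC
  have f1 : θ * A + η * C = 0 := by rw [hA, hC]; linarith
  have f2 : θ * C + η * B = 0 := by rw [hB, hC]; linarith
  have A0 : 0 < A := by linarith
  have B0 : 0 < B := by linarith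
  have hη0 : 0 < η := by
    rcases hη.eq_or_lt with z | z
    · rw [← z] at f1 hs; nlinarith
    · exact z
  have hθ0 : 0 < θ := by
    rcases hθ.eq_or_lt with z | z
    · rw [← z] at f2 hs; nlinarith
    · exact z
  have C0 : C ≤ 0 := by
    by_contra hn
    push Not at hn
    nlinarith [mul_pos hη0 hn, mul_pos hθ0 A0]
  have CC : C ^ 2 = A * B := by
    have : θ * η * (C ^ 2 - A * B) = 0 := by linear_combination (θ * C) * f1 - (θ * A) * f2
    have hne : θ * η ≠ 0 := (mul_pos hθ0 hη0).ne'
    rcases mul_eq_zero.1 this with z | z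
    · exact absurd z hne
    · linarith
  rw [← Real.sqrt_mul A0.le, ← CC, Real.sqrt_sq_eq_abs, abs_of_nonpos C0, neg_neg]

theorem eq_zero_of_triangular {e₁ e₂ e₃ d₁ d₂ d₃ : E3} (h11 : ⟪e₁, d₁⟫ ≠ 0) (h22 : ⟪e₂, d₂⟫ ≠ 0)
    (h33 : ⟪e₃, d₃⟫ ≠ 0) (h12 : ⟪e₁, d₂⟫ = 0) (h13 : ⟪e₁, d₃⟫ = 0) (h23 : ⟪e₂, d₃⟫ = 0) {x : E3}
    (hx1 : ⟪e₁, x⟫ = 0) (hx2 : ⟪e₂, x⟫ = 0) (hx3 : ⟪e₃, x⟫ = 0) : x = 0 := by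
  have hli : LinearIndependent ℝ ![e₁, e₂, e₃] := by
    rw [Fintype.linearIndependent_iff]
    intro g hg
    simp [Fin.sum_univ_three] at hg
    have k3 := congrArg (fun z => ⟪z, d₃⟫) hg
    have k2 := congrArg (fun z => ⟪z, d₂⟫) hg
    have k1 := congrArg (fun z => ⟪z, d₁⟫) hg
    simp only [inner_add_left, inner_smul_left, h13, h23, h12, inner_zero_left] at k1 k2 k3
    simp [h33] at k3
    simp [k3, h22] at k2
    simp [k3, k2, h11] at k1
    intro i
    fin_cases i
    exacts [k1, k2, k3]
  let B := basisOfLinearIndependentOfCardEqFinrank hli (by simp)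
  apply InnerProductSpace.ext_inner_left_basis B
  intro i
  rw [inner_zero_right]
  fin_cases i <;> simp [B, hx1, hx2, hx3]

/-! ### Flags of an edge-scribed polyhedron, transported from the regular one -/

namespace Chain

variable {G : Type*} [Group G] {s₁ s₂ s₃ : G} {σ : G →* Module.End ℝ E3}
  {n₁ n₂ n₃ t v f : E3} {a b r : ℝ}

theorem inner_edge_left (h : Chain s₁ s₂ s₃ σ n₁ n₂ n₃ t v f a b) (w : G) :
    ⟪σ (w * s₁) v, σ w t⟫ = 1 := by
  rw [map_mul, Module.End.mul_apply, h.inner_map, h.map_one_v, inner_sub_left, inner_smul_left,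
    h.unit_t, h.orth_one]
  simp

theorem inner_edge_lt (h : Chain s₁ s₂ s₃ σ n₁ n₂ n₃ t v f a b) (w : G) :
    ⟪σ (w * s₂ * s₁) v, σ w t⟫ < 1 := by
  simp only [map_mul, Module.End.mul_apply, h.inner_map]
  have e1 : ⟪n₁, n₂⟫ < 0 := h.one_two
  rw [h.refl_one, h.refl_two]
  simp only [inner_sub_left, inner_sub_right, inner_smul_left, inner_smul_right, h.one_v,
    h.two_v, h.orth_one, real_inner_comm n₁ n₂, real_inner_comm t v, h.t_v]
  simp only [RCLike.conj_to_real]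
  have := mul_neg_of_neg_of_pos (mul_neg_of_pos_of_neg h.a_pos e1) h.pos_t
  nlinarith [real_inner_comm t v, h.t_v]

theorem inner_facet_one (h : Chain s₁ s₂ s₃ σ n₁ n₂ n₃ t v f a b) (w : G) :
    ⟪σ (w * s₁) v, σ w f⟫ = 1 := by
  rw [← h.f_one w, h.inner_map, h.v_f]

theorem inner_facet_two (h : Chain s₁ s₂ s₃ σ n₁ n₂ n₃ t v f a b) (w : G) :
    ⟪σ (w * s₂ * s₁) v, σ w f⟫ = 1 := by
  rw [← h.f_two w]
  exact h.inner_facet_one _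

theorem eq_of_inner_edge [Finite G] (h : Chain s₁ s₂ s₃ σ n₁ n₂ n₃ t v f a b) {u w : G}
    (hu : ⟪σ u v, σ w t⟫ = 1) : σ u v = σ w v ∨ σ u v = σ (w * s₁) v := by
  have e : ⟪σ (w⁻¹ * u) v, t⟫ = ⟪v, t⟫ := by
    rw [real_inner_comm t v, h.t_v, ← hu, ← h.inner_map w, ← Module.End.mul_apply, ← map_mul,
      mul_inv_cancel_left]
  have := h.orb_eq_edge h.dominant_t h.pos_t _ e
  rw [map_mul, Module.End.mul_apply] at this
  rcases this with k | k
  · left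
    have := congrArg (σ w) k
    rwa [map_map_inv] at this
  · right
    have := congrArg (σ w) k
    rwa [map_map_inv, ← Module.End.mul_apply, ← map_mul] at this

/-- The faces of a polytope which correspond to the faces of a regular polyhedron under an
isomorphism of face lattices. -/
theorem exists_support [Finite G] (h : Chain s₁ s₂ s₃ σ n₁ n₂ n₃ t v f a b) (hr : 0 < r)
    {P : Set E3} (ι : Faces (convexHull ℝ (orb σ (r • v))) ≃o Faces P)
    {φ : E3 → E3}
    (hφ : Set.BijOn φ ((convexHull ℝ (orb σ (r • v))).extremePoints ℝ) (P.extremePoints ℝ))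
    (inc : ∀ F, ∀ x ∈ (convexHull ℝ (orb σ (r • v))).extremePoints ℝ, φ x ∈ (ι F).1 ↔ x ∈ F.1)
    {c : E3} (hc : Dominant n₁ n₂ n₃ c) (hvc : ⟪v, c⟫ = 1) (w : G) : ∃ F e M, IsExposed ℝ P F ∧
      (∀ u, φ (r • σ u v) ∈ F ↔ ⟪σ u v, σ w c⟫ = 1) ∧ (∀ u, ⟪φ (r • σ u v), e⟫ ≤ M) ∧
      (∀ u, ⟪φ (r • σ u v), e⟫ = M ↔ ⟪σ u v, σ w c⟫ = 1) := by
  have hext := h.extremePoints_eq (r • v)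
  have hmem : ∀ u, r • σ u v ∈ (convexHull ℝ (orb σ (r • v))).extremePoints ℝ := fun u => by
    rw [hext]; exact ⟨u, by simp⟩
  have hle : ∀ y ∈ orb σ (r • v), ⟪y, σ w c⟫ ≤ r := by
    rintro _ ⟨u, rfl⟩
    have := h.inner_le' h.dominant_v hc u w
    rw [hvc] at this
    simp only [map_smul, inner_smul_left, RCLike.conj_to_real]
    nlinarith
  let F : Faces (convexHull ℝ (orb σ (r • v))) := ⟨faceOf _ (σ w c), isExposed_faceOf _ _⟩
  have hF : ∀ u, r • σ u v ∈ F.1 ↔ ⟪σ u v, σ w c⟫ = 1 := by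
    intro u
    constructor
    · rintro ⟨h1, h2⟩
      have k1 := inner_le_of_mem_convexHull hle h1
      have k2 := h2 (r • σ w v) (hmem w).1
      simp only [inner_smul_left, RCLike.conj_to_real, h.inner_map, hvc] at k1 k2
      have : r * ⟪σ u v, σ w c⟫ = r * 1 := by linarith
      exact mul_left_cancel₀ hr.ne' this
    · intro h1
      refine ⟨(hmem u).1, fun y hy => ?_⟩
      rw [inner_smul_left, h1]
      simpa using inner_le_of_mem_convexHull hle hy
  have hF' : ∀ u, φ (r • σ u v) ∈ (ι F).1 ↔ ⟪σ u v, σ w c⟫ = 1 := fun u => by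
    rw [inc F _ (hmem u), hF]
  have hw : φ (r • σ w v) ∈ (ι F).1 := (hF' w).2 (by rw [h.inner_map, hvc])
  obtain ⟨e, he⟩ := exists_faceOf (ι F).2 ⟨_, hw⟩
  have hPu : ∀ u, φ (r • σ u v) ∈ P := fun u => (hφ.mapsTo (hmem u)).1
  have hw' := hw
  rw [he] at hw'
  refine ⟨(ι F).1, e, ⟪φ (r • σ w v), e⟫, (ι F).2, hF', fun u => hw'.2 _ (hPu u), fun u => ?_⟩
  rw [← hF', he]
  constructor
  · intro h1
    exact ⟨hPu u, fun y hy => by rw [h1]; exact hw'.2 y hy⟩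
  · rintro ⟨-, h1⟩
    exact le_antisymm (hw'.2 _ (hPu u)) (h1 _ (hPu w))

/-- The lattice isomorphism carries the incidences of the regular polyhedron to P. Edge-scribedness
must then supply the metric facts: vertices lie outside the sphere, facet planes cut it, and
adjacent caps touch. -/
theorem exists_family [Finite G] (h : Chain s₁ s₂ s₃ σ n₁ n₂ n₃ t v f a b) (hr : 0 < r)
    {P : Set E3} (hP : IsPolytope P) (hE : EdgeScribed P)
    (ι : Faces (convexHull ℝ (orb σ (r • v))) ≃o Faces P) :
    ∃ x y, IsFamily s₁ s₂ s₃ x y ∧ ballProj P = Set.range fun w => posSide (x w) := by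
  have hext := h.extremePoints_eq (r • v)
  have hK : IsPolytope (convexHull ℝ (orb σ (r • v))) := ⟨_, finite_orb _, rfl⟩
  obtain ⟨φ, hφ, inc⟩ := exists_vertexMap hK hP ι
  have hmem : ∀ u, r • σ u v ∈ (convexHull ℝ (orb σ (r • v))).extremePoints ℝ := fun u => by
    rw [hext]; exact ⟨u, by simp⟩
  set p : G → E3 := fun w => φ (r • σ w v) with hp
  have pinj : ∀ u w, p u = p w → σ u v = σ w v := by
    intro u w huw
    have := hφ.injOn (hmem u) (hmem w) huw
    exact smul_right_injective E3 hr.ne' this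
  have pext : P.extremePoints ℝ = Set.range p := by
    rw [← hφ.image_eq, hext]
    ext x
    constructor
    · rintro ⟨_, ⟨u, rfl⟩, rfl⟩
      exact ⟨u, by simp [hp]⟩
    · rintro ⟨u, rfl⟩
      exact ⟨r • σ u v, ⟨u, by simp⟩, rfl⟩
  have p2 : ∀ w, p (w * s₂) = p w := fun w => by simp only [hp, h.v_two]
  have p3 : ∀ w, p (w * s₃) = p w := fun w => by simp only [hp, h.v_three]
  have vt : ⟪v, t⟫ = 1 := by rw [real_inner_comm, h.t_v]
  have ha := h.a_pos
  -- the edges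
  have edge : ∀ w, ∃ e M, (∀ u, ⟪p u, e⟫ ≤ M) ∧ (∀ u, ⟪p u, e⟫ = M ↔ ⟪σ u v, σ w t⟫ = 1) ∧
      ∃ τ ∈ segment ℝ (p w) (p (w * s₁)), ⟪τ, τ⟫ = 1 ∧ ⟪τ, p w⟫ = 1 ∧ ⟪τ, p (w * s₁)⟫ = 1 := by
    intro w
    obtain ⟨F, e, M, hF, hmF, he1, he2⟩ := h.exists_support hr ι hφ inc h.dominant_t vt w
    refine ⟨e, M, he1, he2, ?_⟩
    have i1 : p w ∈ F := (hmF w).2 (by rw [h.inner_map, vt])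
    have i2 : p (w * s₁) ∈ F := (hmF _).2 (h.inner_edge_left w)
    have hF2 : F = segment ℝ (p w) (p (w * s₁)) := by
      rw [← hP.convexHull_extremePoints_face hF, ← convexHull_pair, pext]
      congr 1
      ext x
      constructor
      · rintro ⟨hx, u, rfl⟩
        rcases h.eq_of_inner_edge ((hmF u).1 hx) with k | k
        · left; simp only [hp, k]
        · right; simp only [hp, k, Set.mem_singleton_iff]
      · rintro (rfl | rfl)
        · exact ⟨i1, w, rfl⟩
        · exact ⟨i2, _, rfl⟩
    have hne : p w ≠ p (w * s₁) := by
      intro hh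
      have := pinj _ _ hh
      rw [map_mul, Module.End.mul_apply] at this
      have k := congrArg (fun z => ⟪σ w n₁, z⟫) this
      simp only [h.inner_map, h.one_v, h.map_one_v, inner_sub_right, h.orth_one, inner_smul_right,
        h.unit_one] at k
      linarith
    obtain ⟨τ, hτF, hτ1, hτ2⟩ := hE F ⟨hF, ⟨_, i1⟩, by
      rw [hF2, vectorSpan_segment]
      exact finrank_span_singleton (vsub_ne_zero.2 hne.symm)⟩
    exact ⟨τ, hF2 ▸ hτF, by rw [real_inner_self_eq_norm_sq, hτ1, one_pow], hτ2 _ i1, hτ2 _ i2⟩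
  have facet : ∀ w, ∃ n d, (∀ u, ⟪p u, n⟫ ≤ d) ∧ (∀ u, ⟪p u, n⟫ = d ↔ ⟪σ u v, σ w f⟫ = 1) := by
    intro w
    obtain ⟨-, e, M, -, -, he1, he2⟩ := h.exists_support hr ι hφ inc h.dominant_f h.v_f w
    exact ⟨e, M, he1, he2⟩
  -- the vertices are outside the sphere
  have out : ∀ w, 1 < ⟪p w, p w⟫ := by
    intro w
    by_contra hle
    push Not at hle
    -- A vertex in the closed ball would be the tangency point of all its edges, since |p - τ|² =
    -- |p|² - 1 ≤ 0. All these edges would be perpendicular to p, but they are not coplanar.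
    have tan : ∀ u, p u = p w → ⟪p w, p (u * s₁)⟫ = 1 ∧ ⟪p w, p w⟫ = 1 := by
      intro u hu
      obtain ⟨-, -, -, -, τ, -, h1, h2, h3⟩ := edge u
      rw [hu] at h2
      have e : p w - τ = 0 := by
        rw [← inner_self_eq_zero (𝕜 := ℝ)]
        have := real_inner_self_nonneg (x := p w - τ)
        simp only [inner_sub_left, inner_sub_right, h1, h2, real_inner_comm τ (p w)] at this ⊢
        linarith
      rw [sub_eq_zero] at e
      rw [e]
      exact ⟨h3, h1⟩
    have t1 := tan w rfl
    have t2 := tan (w * s₂) (p2 w)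
    have t3 := tan (w * s₃ * s₂) (by rw [p2, p3])
    obtain ⟨e, M, -, he, -⟩ := edge w
    obtain ⟨n, d, -, hn⟩ := facet w
    have w1 : ⟪σ w v, σ w t⟫ = 1 := by rw [h.inner_map, vt]
    have w2 : ⟪σ w v, σ w f⟫ = 1 := by rw [h.inner_map, h.v_f]
    have z : p (w * s₁) - p w = 0 := by
      refine eq_zero_of_triangular (e₁ := p w) (e₂ := n) (e₃ := e) (d₁ := p w)
        (d₂ := p (w * s₃ * s₂ * s₁) - p w) (d₃ := p (w * s₂ * s₁) - p w) ?_ ?_ ?_ ?_ ?_ ?_ ?_ ?_ ?_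
      · rw [t1.2]; exact one_ne_zero
      · rw [real_inner_comm, inner_sub_left, (hn w).2 w2, sub_ne_zero]
        exact fun hh => (h.inner_opposite w).ne ((hn _).1 hh)
      · rw [real_inner_comm, inner_sub_left, (he w).2 w1, sub_ne_zero]
        exact fun hh => (h.inner_edge_lt w).ne ((he _).1 hh)
      · rw [inner_sub_right, t3.1, t1.2, sub_self]
      · rw [inner_sub_right, t2.1, t1.2, sub_self]
      · rw [real_inner_comm, inner_sub_left, (hn w).2 w2, (hn _).2 (h.inner_facet_two w), sub_self]
      · rw [inner_sub_right, t1.1, t1.2, sub_self]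
      · rw [real_inner_comm, inner_sub_left, (hn w).2 w2, (hn _).2 (h.inner_facet_one w), sub_self]
      · rw [real_inner_comm, inner_sub_left, (he w).2 w1, (he _).2 (h.inner_edge_left w), sub_self]
    obtain ⟨-, -, -, -, τ, h0, h1, h2, h3⟩ := edge w
    rw [sub_eq_zero] at z
    have := pinj _ _ z
    rw [map_mul, Module.End.mul_apply] at this
    have k := congrArg (fun z => ⟪σ w n₁, z⟫) this
    simp only [h.inner_map, h.one_v, h.map_one_v, inner_sub_right, h.orth_one, inner_smul_right,
      h.unit_one] at k
    linarith
  -- the facet planes cut the sphere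
  have normal : ∀ c ∈ orb σ f, ∃ Y : Vec4, lor Y Y = 1 ∧ (∀ u, lor (capVec (p u)) Y ≤ 0) ∧
      ∀ u, lor (capVec (p u)) Y = 0 ↔ ⟪σ u v, c⟫ = 1 := by
    rintro _ ⟨w, rfl⟩
    obtain ⟨n, d, hn1, hn2⟩ := facet w
    have w1 : ⟪σ w v, σ w t⟫ = 1 := by rw [h.inner_map, vt]
    have w2 : ⟪σ w v, σ w f⟫ = 1 := by rw [h.inner_map, h.v_f]
    obtain ⟨e, M, -, he, τ, hseg, hτ1, hτ2, hτ3⟩ := edge w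
    obtain ⟨-, -, -, -, τ', hseg', hτ1', hτ2', hτ3'⟩ := edge (w * s₂)
    rw [p2] at hseg' hτ2'
    have i0 := (hn2 w).2 w2
    have i1 := (hn2 _).2 (h.inner_facet_one w)
    have i2 := (hn2 _).2 (h.inner_facet_two w)
    have i3 : ⟪p (w * s₃ * s₂ * s₁), n⟫ ≠ d := fun hh =>
      (h.inner_opposite w).ne ((hn2 _).1 hh)
    have inseg : ∀ {x y z c : E3} {m : ℝ}, z ∈ segment ℝ x y → ⟪x, c⟫ = m → ⟪y, c⟫ = m →
        ⟪z, c⟫ = m := by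
      rintro x y z c m ⟨α, β, -, -, hαβ, rfl⟩ hx hy
      rw [inner_add_left, inner_smul_left, inner_smul_left, hx, hy]
      simp only [RCLike.conj_to_real]
      rw [← add_mul, hαβ, one_mul]
    have j1 := inseg hseg i0 i1
    have j2 := inseg hseg' i0 i2
    -- A facet plane through two distinct points of the sphere cannot be tangent or miss it. The
    -- points come from two edges of the facet, which meet only at a vertex outside the sphere.
    have hττ : τ ≠ τ' := by
      rintro rfl
      have k1 := inseg hseg ((he w).2 w1) ((he _).2 (h.inner_edge_left w))
      obtain ⟨α, β, -, -, hαβ, e1⟩ := hseg'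
      have k2 := congrArg (fun z => ⟪z, e⟫) e1
      simp only [inner_add_left, inner_smul_left, RCLike.conj_to_real] at k2
      rw [k1, (he w).2 w1] at k2
      have k3 : ⟪p (w * s₂ * s₁), e⟫ ≠ M := fun hh => (h.inner_edge_lt w).ne ((he _).1 hh)
      have k4 : β * (⟪p (w * s₂ * s₁), e⟫ - M) = 0 := by
        have : α = 1 - β := by linarith
        rw [this] at k2
        linarith
      have hβ : β = 0 := by
        rcases mul_eq_zero.1 k4 with z | z
        · exact z
        · exact absurd (by linarith) k3
      have hα : α = 1 := by linarith
      rw [hα, hβ, one_smul, zero_smul, add_zero] at e1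
      have := out w
      rw [e1, hτ1] at this
      exact lt_irrefl _ this
    have hnd : d ^ 2 < ⟪n, n⟫ := by
      by_contra hle
      push Not at hle
      have z : ∀ τ, ⟪τ, τ⟫ = 1 → ⟪τ, n⟫ = d → d • τ = n := by
        intro τ h1 h2
        rw [← sub_eq_zero, ← inner_self_eq_zero (𝕜 := ℝ)]
        have := real_inner_self_nonneg (x := d • τ - n)
        simp only [inner_sub_left, inner_sub_right, inner_smul_left, inner_smul_right, h1, h2,
          real_inner_comm τ n, RCLike.conj_to_real] at this ⊢
        nlinarith
      have z1 := z τ hτ1 j1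
      have z2 := z τ' hτ1' j2
      by_cases hd : d = 0
      · rw [hd, zero_smul] at z1
        rw [← z1, inner_zero_right] at i3
        exact i3 hd.symm
      · exact hττ (smul_right_injective E3 hd (z1.trans z2.symm))
    have hs : 0 < Real.sqrt (⟪n, n⟫ - d ^ 2) := Real.sqrt_pos.2 (by linarith)
    have hs2 : Real.sqrt (⟪n, n⟫ - d ^ 2) ^ 2 = ⟪n, n⟫ - d ^ 2 := Real.sq_sqrt (by linarith)
    have val : ∀ u, lor (capVec (p u)) ((Real.sqrt (⟪n, n⟫ - d ^ 2))⁻¹ • planeVec n d) =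
        ((Real.sqrt (⟪n, n⟫ - d ^ 2))⁻¹ * (Real.sqrt (⟪p u, p u⟫ - 1))⁻¹) * (⟪p u, n⟫ - d) := by
      intro u
      simp only [capVec, map_smul, LinearMap.smul_apply, aff_eq_planeVec, lor_planeVec, smul_eq_mul]
      ring
    have hpos : ∀ u,
        0 < (Real.sqrt (⟪n, n⟫ - d ^ 2))⁻¹ * (Real.sqrt (⟪p u, p u⟫ - 1))⁻¹ := fun u =>
      mul_pos (inv_pos.2 hs) (inv_pos.2 (Real.sqrt_pos.2 (by linarith [out u])))
    refine ⟨(Real.sqrt (⟪n, n⟫ - d ^ 2))⁻¹ • planeVec n d, ?_, fun u => ?_, fun u => ?_⟩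
    · simp only [map_smul, LinearMap.smul_apply, lor_planeVec, smul_eq_mul]
      clear val hpos
      generalize Real.sqrt (⟪n, n⟫ - d ^ 2) = S at *
      rw [← pow_two d, ← hs2]
      field_simp
    · rw [val]
      exact mul_nonpos_of_nonneg_of_nonpos (hpos u).le (by linarith [hn1 u])
    · rw [val, ← hn2, mul_eq_zero, sub_eq_zero]
      exact ⟨fun hh => hh.resolve_left (hpos u).ne', Or.inr⟩
  -- The choice is indexed by the facet centre, not by the flag, so that the normals are
  -- automatically invariant under s₁ and s₂.
  choose! Y hY1 hY2 hY3 using normal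
  have orbf : ∀ w, σ w f ∈ orb σ f := fun w => ⟨w, rfl⟩
  refine ⟨fun w => capVec (p w), fun w => Y (σ w f), ?_, ?_⟩
  · constructor
    · exact fun w => lor_capVec_self (out w)
    · exact fun w => hY1 _ (orbf w)
    · intro w; simp only [p2]
    · intro w; simp only [p3]
    · intro w; simp only [h.f_one]
    · intro w; simp only [h.f_two]
    · intro w
      obtain ⟨-, -, -, -, τ, h0, h1, h2, h3⟩ := edge w
      have e := inner_of_tangent h0 h2 h3 (out w) (out _)
      have k1 : 0 < Real.sqrt (⟪p w, p w⟫ - 1) := Real.sqrt_pos.2 (by linarith [out w])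
      have k2 : 0 < Real.sqrt (⟪p (w * s₁), p (w * s₁)⟫ - 1) :=
        Real.sqrt_pos.2 (by linarith [out (w * s₁)])
      simp only [capVec, map_smul, LinearMap.smul_apply, lor_aff, smul_eq_mul, e]
      field_simp
    · intro w
      have k1 : 0 < Real.sqrt (⟪p w, p w⟫ - 1) := Real.sqrt_pos.2 (by linarith [out w])
      have k2 : 0 < Real.sqrt (⟪p (w * s₁), p (w * s₁)⟫ - 1) :=
        Real.sqrt_pos.2 (by linarith [out (w * s₁)])
      have e : ∀ u, capVec u 3 = (Real.sqrt (⟪u, u⟫ - 1))⁻¹ := fun u => by simp [capVec, aff]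
      rw [Pi.add_apply, e, e]
      positivity
    · intro w
      exact (hY3 _ (orbf w) w).2 (by rw [h.inner_map, h.v_f])
    · exact fun u w => hY2 _ (orbf w) u
    · intro w
      refine lt_of_le_of_ne (hY2 _ (orbf w) _) fun hh => ?_
      exact (h.inner_opposite w).ne ((hY3 _ (orbf w) _).1 hh)
  · rw [ballProj, pext, ← Set.range_comp]
    congr 1
    funext w
    exact (posSide_capVec (out w)).symm

end Chain

/-! ### The Möbius action on collections of disks -/

theorem act_one (𝓑 : Set (Set Rhat)) : act 1 𝓑 = 𝓑 := by
  simp [act]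

theorem act_mul (μ ν : Mob) (𝓑 : Set (Set Rhat)) : act (μ * ν) 𝓑 = act μ (act ν 𝓑) := by
  simp only [act, Set.image_image]
  congr 1

theorem act_inv_act (μ : Mob) (𝓑 : Set (Set Rhat)) : act μ⁻¹ (act μ 𝓑) = 𝓑 := by
  rw [← act_mul, inv_mul_cancel, act_one]

theorem act_act_inv (μ : Mob) (𝓑 : Set (Set Rhat)) : act μ (act μ⁻¹ 𝓑) = 𝓑 := by
  rw [← act_mul, mul_inv_cancel, act_one]

theorem act_subset {μ : Mob} {𝓑 𝓒 : Set (Set Rhat)} (h : 𝓑 ⊆ 𝓒) : act μ 𝓑 ⊆ act μ 𝓒 :=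
  Set.image_mono h

theorem act_dual_subset (ν : Mob) (𝓑 : Set (Set Rhat)) : act ν (dual 𝓑) ⊆ dual (act ν 𝓑) := by
  rintro _ ⟨b, ⟨μ, P₀, h1, h2, h3, h4, h5⟩, rfl⟩
  refine ⟨μ * ν⁻¹, P₀, h1, h2, h3, by rw [act_mul, act_inv_act, h4], ?_⟩
  rw [mul_inv_rev, inv_inv, act_mul]
  exact ⟨b, h5, rfl⟩

theorem dual_act (ν : Mob) (𝓑 : Set (Set Rhat)) : dual (act ν 𝓑) = act ν (dual 𝓑) := by
  apply Set.Subset.antisymm _ (act_dual_subset ν 𝓑)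
  have := act_subset (μ := ν) (act_dual_subset ν⁻¹ (act ν 𝓑))
  rwa [act_act_inv, act_inv_act] at this

theorem reflMat_mulVec_of_preserves {A : Mat4} (hA : ∀ x y, lor (A *ᵥ x) (A *ᵥ y) = lor x y)
    (x : Vec4) : reflMat (A *ᵥ x) * A = A * reflMat x := by
  apply Matrix.mulVec_injective
  funext y
  rw [← Matrix.mulVec_mulVec, ← Matrix.mulVec_mulVec, reflMat_mulVec, reflMat_mulVec, hA,
    Matrix.mulVec_sub, Matrix.mulVec_smul]

theorem reflMob_mulVec (μ : Mob) {x : Vec4} (hx : lor x x = 1)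
    (hx' : lor (rho μ *ᵥ x) (rho μ *ᵥ x) = 1) :
    reflMob (rho μ *ᵥ x) hx' = μ * reflMob x hx * μ⁻¹ := by
  apply rho_injective
  rw [map_mul, map_mul, rho_reflMob, rho_reflMob,
    ← reflMat_mulVec_of_preserves (rho_preserves μ), mul_assoc, rho_mul_inv, mul_one]

theorem reflMob_mem_inversions {𝓑 : Set (Set Rhat)} {x : Vec4} (hx : lor x x = 1)
    (h : posSide x ∈ 𝓑) : reflMob x hx ∈ inversions 𝓑 :=
  ⟨(exists_disk hx).choose, by rwa [carrier_eq, (exists_disk hx).choose_spec], rfl⟩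

theorem mem_inversions_iff {𝓑 : Set (Set Rhat)} {g : Mob} :
    g ∈ inversions 𝓑 ↔ ∃ (x : Vec4) (hx : lor x x = 1), posSide x ∈ 𝓑 ∧ g = reflMob x hx := by
  constructor
  · rintro ⟨D, hD, rfl⟩
    refine ⟨D.vec, lor_vec_self D, by rwa [← carrier_eq], ?_⟩
    apply rho_injective
    rw [rho_reflMob, rho_inv_disk]
  · rintro ⟨x, hx, h, rfl⟩
    exact reflMob_mem_inversions hx h

theorem conj_inversions_subset (ν : Mob) (𝓑 : Set (Set Rhat)) :
    MulAut.conj ν '' inversions 𝓑 ⊆ inversions (act ν 𝓑) := by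
  rintro _ ⟨g, hg, rfl⟩
  obtain ⟨x, hx, h, rfl⟩ := mem_inversions_iff.1 hg
  rw [MulAut.conj_apply, ← reflMob_mulVec ν hx (by rw [rho_preserves, hx])]
  exact reflMob_mem_inversions _ ⟨_, h, image_posSide ν x⟩

theorem inversions_act (ν : Mob) (𝓑 : Set (Set Rhat)) :
    inversions (act ν 𝓑) = MulAut.conj ν '' inversions 𝓑 := by
  apply Set.Subset.antisymm _ (conj_inversions_subset ν 𝓑)
  intro g hg
  have := conj_inversions_subset ν⁻¹ (act ν 𝓑) ⟨g, hg, rfl⟩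
  rw [act_inv_act] at this
  exact ⟨_, this, by simp [mul_assoc]⟩

theorem apollonian_act (ν : Mob) (𝓑 : Set (Set Rhat)) :
    apollonian (act ν 𝓑) = (apollonian 𝓑).map (MulAut.conj ν).toMonoidHom := by
  rw [apollonian, apollonian, MonoidHom.map_closure, dual_act, inversions_act]
  rfl

theorem symGroup_act (ν : Mob) (𝓑 : Set (Set Rhat)) :
    symGroup (act ν 𝓑) = (symGroup 𝓑).map (MulAut.conj ν).toMonoidHom := by
  rw [symGroup, symGroup, MonoidHom.map_closure]
  congr 1
  ext μ
  constructor
  · intro h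
    refine ⟨ν⁻¹ * μ * ν, ?_, by simp [mul_assoc]⟩
    rw [Set.mem_ofPred_eq] at h ⊢
    rw [act_mul, act_mul, h, act_inv_act]
  · rintro ⟨μ, h, rfl⟩
    rw [Set.mem_ofPred_eq] at h ⊢
    simp only [MulEquiv.toMonoidHom_eq_coe, MonoidHom.coe_coe, MulAut.conj_apply]
    rw [act_mul, act_inv_act, act_mul, h]

theorem superSym_act (ν : Mob) (𝓑 : Set (Set Rhat)) :
    superSym (act ν 𝓑) = (superSym 𝓑).map (MulAut.conj ν).toMonoidHom := by
  rw [superSym, superSym, MonoidHom.map_closure, dual_act, apollonian_act, apollonian_act,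
    symGroup_act]
  simp only [Subgroup.coe_map, Set.image_union]

/-! ### Duality and projective transformations -/

theorem aff_smul_add {x y : E3} {α β : ℝ} (h : α + β = 1) :
    aff (α • x + β • y) = α • aff x + β • aff y := by
  ext i
  fin_cases i <;> simp [aff, h]

theorem aff_injective : Function.Injective aff := by
  intro x y h
  ext i
  fin_cases i
  exacts [congrFun h 0, congrFun h 1, congrFun h 2]

theorem aff_ne_zero (x : E3) : aff x ≠ 0 := fun h => by
  have := congrFun h 3
  simp [aff] at this

theorem lor_aff_nonpos {P : Set E3} {u m : E3} (hu : u ∈ P) (hm : m ∈ polarSet P) :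
    lor (aff u) (aff m) ≤ 0 := by
  have := hm u hu
  rw [real_inner_comm] at this
  rw [lor_aff]
  linarith

/-- The cone over the polar of a polytope. -/
theorem exists_polar_of_nonpos {P : Set E3} (hP : IsPolytope P) (h0 : (0 : E3) ∈ interior P)
    {g : Vec4} (hg : g ≠ 0) (h : ∀ u ∈ P.extremePoints ℝ, lor (aff u) g ≤ 0) :
    ∃ τ > 0, ∃ m ∈ polarSet P, g = (τ : ℝ) • aff m := by
  set c : E3 := !₂[g 0, g 1, g 2] with hc
  have hgc : g = planeVec c (g 3) := by
    ext i
    fin_cases i <;> simp [planeVec, hc]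
  have hle : ∀ u ∈ P, ⟪u, c⟫ ≤ g 3 := by
    intro u hu
    rw [← hP.convexHull_extremePoints] at hu
    refine inner_le_of_mem_convexHull (fun y hy => ?_) hu
    have := h y hy
    rw [hgc, aff_eq_planeVec, lor_planeVec] at this
    linarith
  have hd : 0 ≤ g 3 := by
    have := hle 0 (interior_subset h0)
    rwa [inner_zero_left] at this
  -- Since the origin is interior, a nonzero supporting functional is strictly positive there, and
  -- the vector can be normalised to last coordinate 1.
  have hd' : 0 < g 3 := by
    rcases hd.eq_or_lt with z | z
    · exfalso
      obtain ⟨ε, hε, hball⟩ := Metric.isOpen_iff.1 isOpen_interior 0 h0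
      by_cases hcz : c = 0
      · apply hg
        rw [hgc, hcz, ← z]
        ext i
        fin_cases i <;> simp [planeVec]
      · have hn : 0 < ‖c‖ := norm_pos_iff.2 hcz
        have hmem : (ε / (2 * ‖c‖)) • c ∈ P := by
          apply interior_subset
          apply hball
          rw [mem_ball_zero_iff, norm_smul, Real.norm_of_nonneg (by positivity)]
          field_simp
          linarith
        have := hle _ hmem
        rw [inner_smul_left, ← z, real_inner_self_eq_norm_sq] at this
        simp only [RCLike.conj_to_real] at this
        have : 0 < ε / (2 * ‖c‖) * ‖c‖ ^ 2 := by positivity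
        linarith
    · exact z
  refine ⟨g 3, hd', (g 3)⁻¹ • c, fun u hu => ?_, ?_⟩
  · rw [inner_smul_left, real_inner_comm]
    have := hle u hu
    simp only [RCLike.conj_to_real]
    rw [inv_mul_le_iff₀ hd']
    linarith
  · ext i
    have := hd'.ne'
    fin_cases i <;> simp [aff, hc] <;> field_simp

/-- Otherwise both g and -g would be positive multiples of vectors with last coordinate 1. -/
theorem eq_zero_of_lor_aff {P : Set E3} (hP : IsPolytope P) (h0 : (0 : E3) ∈ interior P)
    {g : Vec4} (h : ∀ u ∈ P.extremePoints ℝ, lor (aff u) g = 0) : g = 0 := by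
  by_contra hg
  obtain ⟨τ, hτ, m, -, e⟩ := exists_polar_of_nonpos hP h0 hg fun u hu => (h u hu).le
  obtain ⟨τ', hτ', m', -, e'⟩ := exists_polar_of_nonpos hP h0 (neg_ne_zero.2 hg) fun u hu => by
    rw [map_neg, h u hu, neg_zero]
  have h1 := congrFun e 3
  have h2 := congrFun e' 3
  simp [aff] at h1 h2
  linarith

theorem exists_smul_of_illum {A : Mat4} (hA : ∀ x y, lor (A *ᵥ x) (A *ᵥ y) = lor x y) {k u : E3}
    (hk : 1 < ⟪k, k⟫) (h : illum u = posSide (A *ᵥ aff k)) :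
    ∃ s > 0, aff u = (s : ℝ) • A *ᵥ aff k := by
  have hs : 0 < (Real.sqrt (⟪k, k⟫ - 1))⁻¹ := inv_pos.2 (Real.sqrt_pos.2 (by linarith))
  have h1 : posSide (aff u) = posSide (A *ᵥ capVec k) := by
    rw [← illum_eq, h, capVec, Matrix.mulVec_smul, posSide_smul hs]
  obtain ⟨s, hs', e⟩ := eq_smul_of_posSide (by rw [hA, lor_capVec_self hk]) h1
  refine ⟨s * (Real.sqrt (⟪k, k⟫ - 1))⁻¹, mul_pos hs' hs, ?_⟩
  rw [e, capVec, Matrix.mulVec_smul, smul_smul]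

/-- The matrix of μ carries vertex rays of K to those of P, hence the dual cone, which is the cone
over the polar, to the dual cone, and extreme rays to extreme rays. This makes the dual packing
independent of the choices. -/
theorem ballProj_polarSet_subset {K P : Set E3} (hK : IsPolytope K) (hP : IsPolytope P)
    (hK0 : (0 : E3) ∈ interior K) (hP0 : (0 : E3) ∈ interior P)
    (hn : ∀ k ∈ K.extremePoints ℝ, 1 < ⟪k, k⟫) {μ : Mob} (hμ : act μ (ballProj K) = ballProj P) :
    act μ⁻¹ (ballProj (polarSet P)) ⊆ ballProj (polarSet K) := by
  have hA := rho_preserves μ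
  set A := rho μ with hAdef
  have corr1 : ∀ u ∈ P.extremePoints ℝ, ∃ k ∈ K.extremePoints ℝ, ∃ s > 0,
      aff u = (s : ℝ) • A *ᵥ aff k := by
    intro u hu
    have : illum u ∈ act μ (ballProj K) := by rw [hμ]; exact ⟨u, hu, rfl⟩
    obtain ⟨_, ⟨k, hk, rfl⟩, e⟩ := this
    refine ⟨k, hk, exists_smul_of_illum hA (hn k hk) ?_⟩
    rw [← e]
    simp only [illum_eq]
    exact image_posSide μ _
  have corr2 : ∀ k ∈ K.extremePoints ℝ, ∃ u ∈ P.extremePoints ℝ, ∃ s > 0,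
      aff u = (s : ℝ) • A *ᵥ aff k := by
    intro k hk
    have : (μ : Equiv.Perm Rhat) '' illum k ∈ ballProj P := by rw [← hμ]; exact ⟨_, ⟨k, hk, rfl⟩, rfl⟩
    obtain ⟨u, hu, e⟩ := this
    refine ⟨u, hu, exists_smul_of_illum hA (hn k hk) ?_⟩
    rw [e, illum_eq]
    exact image_posSide μ _
  have inv1 : ∀ x, rho μ⁻¹ *ᵥ (A *ᵥ x) = x := fun x => by
    rw [Matrix.mulVec_mulVec, hAdef, rho_inv_mul, Matrix.one_mulVec]
  have inv2 : ∀ x, A *ᵥ (rho μ⁻¹ *ᵥ x) = x := fun x => by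
    rw [Matrix.mulVec_mulVec, hAdef, rho_mul_inv, Matrix.one_mulVec]
  have fwd : ∀ x ∈ polarSet K, ∃ τ > 0, ∃ m ∈ polarSet P, A *ᵥ aff x = (τ : ℝ) • aff m := by
    intro x hx
    apply exists_polar_of_nonpos hP hP0
    · intro hz
      have := inv1 (aff x)
      rw [hz, Matrix.mulVec_zero] at this
      exact aff_ne_zero x this.symm
    · intro u hu
      obtain ⟨k, hk, s, hs, e⟩ := corr1 u hu
      rw [e, map_smul, LinearMap.smul_apply, hA, smul_eq_mul]
      exact mul_nonpos_of_nonneg_of_nonpos hs.le (lor_aff_nonpos hk.1 hx)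
  rintro _ ⟨_, ⟨m, hm, rfl⟩, rfl⟩
  obtain ⟨τ, hτ, m', hm', e⟩ := exists_polar_of_nonpos hK hK0 (g := rho μ⁻¹ *ᵥ aff m)
    (fun hz => by
      have := inv2 (aff m)
      rw [hz, Matrix.mulVec_zero] at this
      exact aff_ne_zero m this.symm)
    (fun k hk => by
      obtain ⟨u, hu, s, hs, e⟩ := corr2 k hk
      rw [← hA, inv2]
      have := lor_aff_nonpos hu.1 hm.1
      rw [e, map_smul, LinearMap.smul_apply, smul_eq_mul] at this
      exact nonpos_of_mul_nonpos_right this hs)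
  have e' : aff m = τ • A *ᵥ aff m' := by
    rw [← Matrix.mulVec_smul, ← e, inv2]
  refine ⟨m', mem_extremePoints_iff_left.2 ⟨hm', ?_⟩, ?_⟩
  · rintro x₁ hx₁ x₂ hx₂ ⟨α, β, hα, hβ, hαβ, hx⟩
    obtain ⟨τ₁, hτ₁, m₁, hm₁, e₁⟩ := fwd x₁ hx₁
    obtain ⟨τ₂, hτ₂, m₂, hm₂, e₂⟩ := fwd x₂ hx₂
    have e3 : aff m = (τ * α * τ₁) • aff m₁ + (τ * β * τ₂) • aff m₂ := by
      rw [e', ← hx, aff_smul_add hαβ, Matrix.mulVec_add, Matrix.mulVec_smul, Matrix.mulVec_smul,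
        e₁, e₂]
      module
    have hsum : τ * α * τ₁ + τ * β * τ₂ = 1 := by
      have := congrFun e3 3
      simp [aff] at this
      exact this.symm
    have h1 : m₁ = m := by
      refine (mem_extremePoints_iff_left.1 hm).2 m₁ hm₁ m₂ hm₂
        ⟨_, _, by positivity, by positivity, hsum, aff_injective ?_⟩
      rw [aff_smul_add hsum, e3]
    rw [h1, e', ← Matrix.mulVec_smul, ← Matrix.mulVec_smul] at e₁
    have e4 := congrArg (fun z => rho μ⁻¹ *ᵥ z) e₁
    simp only [inv1] at e4
    have h2 := congrFun e4 3
    simp [aff] at h2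
    rw [smul_smul, ← h2, one_smul] at e4
    exact aff_injective e4
  · dsimp only
    rw [illum_eq, illum_eq, image_posSide, e, posSide_smul hτ]

/-! ### The super symmetrized Apollonian group of a regular polyhedron -/

theorem GramNondeg.matrix_ext {c : Fin 4 → Vec4} (h : GramNondeg c) {A B : Mat4}
    (hAB : ∀ i, A *ᵥ c i = B *ᵥ c i) : A = B := by
  apply Matrix.mulVec_injective
  funext x
  obtain ⟨t, rfl⟩ := h.exists_comb x
  simp only [Matrix.mulVec_sum, Matrix.mulVec_smul, hAB]

theorem reflMat_neg (x : Vec4) : reflMat (-x) = reflMat x := by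
  apply Matrix.mulVec_injective
  funext y
  rw [reflMat_mulVec, reflMat_mulVec]
  simp

/-- The time direction. -/
def timeVec : Vec4 := planeVec 0 1

theorem lor_aff_time (x : E3) : lor (aff x) timeVec = -1 := by
  rw [timeVec, aff_eq_planeVec, lor_planeVec]; simp

theorem lor_time_time : lor timeVec timeVec = -1 := by
  rw [timeVec, lor_planeVec]; simp

theorem reflMat_planeVec_aff (n x : E3) :
    reflMat (planeVec n 0) *ᵥ aff x = aff (x - (2 * ⟪n, x⟫) • n) := by
  rw [reflMat_mulVec, aff_eq_planeVec, lor_planeVec]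
  ext i
  fin_cases i <;> simp [planeVec, aff]

theorem reflMat_planeVec_time (n : E3) : reflMat (planeVec n 0) *ᵥ timeVec = timeVec := by
  rw [reflMat_mulVec, timeVec, lor_planeVec]
  simp

/-- A Lorentz matrix fixing the time direction acts on points. -/
theorem exists_aff_of_fix_time {A : Mat4} (hA : ∀ x y, lor (A *ᵥ x) (A *ᵥ y) = lor x y)
    (ht : A *ᵥ timeVec = timeVec) (x : E3) : ∃ x', A *ᵥ aff x = aff x' := by
  have h1 := hA (aff x) timeVec
  rw [ht, lor_aff_time, lor_apply] at h1
  simp [timeVec, planeVec] at h1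
  generalize A *ᵥ aff x = y at *
  refine ⟨!₂[y 0, y 1, y 2], ?_⟩
  ext i
  fin_cases i <;> simp [aff]
  linarith

namespace Chain

variable {G : Type*} [Group G] {s₁ s₂ s₃ : G} {σ : G →* Module.End ℝ E3}
  {n₁ n₂ n₃ t v f : E3} {a b : ℝ}

theorem ballProj_eq (h : Chain s₁ s₂ s₃ σ n₁ n₂ n₃ t v f a b) :
    ballProj (convexHull ℝ (orb σ v)) = illum '' orb σ v := by
  rw [ballProj, h.extremePoints_eq]

theorem isPolytope [Finite G] (x : E3) : IsPolytope (convexHull ℝ (orb σ x)) :=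
  ⟨_, finite_orb x, rfl⟩

theorem norm_gt (h : Chain s₁ s₂ s₃ σ n₁ n₂ n₃ t v f a b) (w : G) : 1 < ⟪σ w v, σ w v⟫ := by
  rw [h.inner_map, h.v_v]
  have := h.a_pos
  have : 0 < a ^ 2 := by positivity
  linarith

theorem dual_eq [Finite G] (h : Chain s₁ s₂ s₃ σ n₁ n₂ n₃ t v f a b) :
    dual (illum '' orb σ v) = illum '' orb σ f := by
  rw [← h.ballProj_eq, ← h.reverse.ballProj_eq, ← h.polarSet_eq]
  apply Set.Subset.antisymm
  · rintro c ⟨μ, P₀, h1, -, h3, h4, h5⟩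
    refine ballProj_polarSet_subset (isPolytope v) h1.isPolytope h.zero_mem_interior h3 ?_ h4 h5
    rw [h.extremePoints_eq]
    rintro _ ⟨w, rfl⟩
    exact h.norm_gt w
  · intro c hc
    exact ⟨1, _, h.isPolyhedron, h.edgeScribed, h.zero_mem_interior, act_one _, by
      rw [inv_one, act_one]; exact hc⟩

/-- The Lorentzian vectors of the five generating reflections. -/
def mirrors (n₁ n₂ n₃ v f : E3) (a b : ℝ) : Fin 5 → Vec4 :=
  ![a⁻¹ • aff v, planeVec (-n₁) 0, planeVec (-n₂) 0, planeVec (-n₃) 0, b⁻¹ • aff f]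

theorem lor_capMirror (h : Chain s₁ s₂ s₃ σ n₁ n₂ n₃ t v f a b) (w : G) :
    lor (a⁻¹ • aff (σ w v)) (a⁻¹ • aff (σ w v)) = 1 := by
  have := h.a_pos.ne'
  simp only [map_smul, LinearMap.smul_apply, lor_aff, h.inner_map, h.v_v, smul_eq_mul]
  field_simp
  ring

theorem lor_planeMirror {n : E3} (hn : ⟪n, n⟫ = 1) :
    lor (planeVec (-n) 0) (planeVec (-n) 0) = 1 := by
  rw [lor_planeVec]
  simp [-inner_self_eq_norm_sq_to_K, hn]

theorem lor_mirrors_self (h : Chain s₁ s₂ s₃ σ n₁ n₂ n₃ t v f a b) (i : Fin 5) :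
    lor (mirrors n₁ n₂ n₃ v f a b i) (mirrors n₁ n₂ n₃ v f a b i) = 1 := by
  fin_cases i
  · have := h.lor_capMirror 1
    rwa [map_one, Module.End.one_apply] at this
  · exact lor_planeMirror h.unit_one
  · exact lor_planeMirror h.unit_two
  · exact lor_planeMirror h.unit_three
  · have := h.reverse.lor_capMirror 1
    rwa [map_one, Module.End.one_apply] at this

/-- The group generated by the five reflections. -/
def reflGroup (h : Chain s₁ s₂ s₃ σ n₁ n₂ n₃ t v f a b) : Subgroup Mob :=
  Subgroup.closure (Set.range fun i => reflMob (mirrors n₁ n₂ n₃ v f a b i) (h.lor_mirrors_self i))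

theorem reflMob_mem (h : Chain s₁ s₂ s₃ σ n₁ n₂ n₃ t v f a b) (i : Fin 5) :
    reflMob (mirrors n₁ n₂ n₃ v f a b i) (h.lor_mirrors_self i) ∈ h.reflGroup :=
  Subgroup.subset_closure ⟨i, rfl⟩

theorem rho_planeMirror {n : E3} (hn : lor (planeVec (-n) 0) (planeVec (-n) 0) = 1) :
    (∀ x, rho (reflMob (planeVec (-n) 0) hn) *ᵥ aff x = aff (x - (2 * ⟪n, x⟫) • n)) ∧
      rho (reflMob (planeVec (-n) 0) hn) *ᵥ timeVec = timeVec := by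
  have e : planeVec (-n) 0 = -planeVec n 0 := by
    ext i; fin_cases i <;> simp [planeVec]
  rw [rho_reflMob, e, reflMat_neg]
  exact ⟨reflMat_planeVec_aff n, reflMat_planeVec_time n⟩

/-- The elements of the reflection group as Möbius transformations. -/
theorem exists_mob (h : Chain s₁ s₂ s₃ σ n₁ n₂ n₃ t v f a b) (w : G) :
    ∃ μ ∈ Subgroup.closure {reflMob _ (h.lor_mirrors_self 1), reflMob _ (h.lor_mirrors_self 2),
      reflMob _ (h.lor_mirrors_self 3)}, (∀ x, rho μ *ᵥ aff x = aff (σ w x)) ∧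
      rho μ *ᵥ timeVec = timeVec := by
  refine h.gen (fun w => ∃ μ ∈ Subgroup.closure {reflMob _ (h.lor_mirrors_self 1),
    reflMob _ (h.lor_mirrors_self 2), reflMob _ (h.lor_mirrors_self 3)},
    (∀ x, rho μ *ᵥ aff x = aff (σ w x)) ∧ rho μ *ᵥ timeVec = timeVec)
    ⟨1, one_mem _, by simp, by simp⟩ ?_ w
  rintro w ⟨μ, hμ, h1, h2⟩
  have step : ∀ (s : G) (n : E3) (hn : lor (planeVec (-n) 0) (planeVec (-n) 0) = 1),
      (∀ x, σ s x = x - (2 * ⟪n, x⟫) • n) →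
      (∀ x, rho (μ * reflMob _ hn) *ᵥ aff x = aff (σ (w * s) x)) ∧
      rho (μ * reflMob _ hn) *ᵥ timeVec = timeVec := by
    intro s n hn hs
    obtain ⟨k1, k2⟩ := rho_planeMirror hn
    refine ⟨fun x => ?_, ?_⟩
    · rw [map_mul, ← Matrix.mulVec_mulVec, k1, h1, map_mul, Module.End.mul_apply, hs]
    · rw [map_mul, ← Matrix.mulVec_mulVec, k2, h2]
  refine ⟨⟨_, mul_mem hμ (Subgroup.subset_closure ?_), step s₁ n₁ (h.lor_mirrors_self 1) h.refl_one⟩,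
    ⟨_, mul_mem hμ (Subgroup.subset_closure ?_), step s₂ n₂ (h.lor_mirrors_self 2) h.refl_two⟩,
    ⟨_, mul_mem hμ (Subgroup.subset_closure ?_), step s₃ n₃ (h.lor_mirrors_self 3) h.refl_three⟩⟩
  · exact Set.mem_insert _ _
  · exact Set.mem_insert_of_mem _ (Set.mem_insert _ _)
  · exact Set.mem_insert_of_mem _ (Set.mem_insert_of_mem _ rfl)

theorem closure_le_reflGroup (h : Chain s₁ s₂ s₃ σ n₁ n₂ n₃ t v f a b) :
    Subgroup.closure {reflMob _ (h.lor_mirrors_self 1), reflMob _ (h.lor_mirrors_self 2),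
      reflMob _ (h.lor_mirrors_self 3)} ≤ h.reflGroup := by
  rw [Subgroup.closure_le]
  rintro _ (rfl | rfl | rfl)
  exacts [h.reflMob_mem 1, h.reflMob_mem 2, h.reflMob_mem 3]

/-- Three independent directions are fixed, and their orthogonal line is spanned by the normal of
the second wall; on it an isometry is ±1. -/
theorem eq_or_eq_of_fix [Finite G] (h : Chain s₁ s₂ s₃ σ n₁ n₂ n₃ t v f a b) {A : Mat4}
    (hA : ∀ x y, lor (A *ᵥ x) (A *ᵥ y) = lor x y) (ht : A *ᵥ timeVec = timeVec)
    (hv : A *ᵥ aff v = aff v) (hf : A *ᵥ aff f = aff f) :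
    A = 1 ∨ A = reflMat (planeVec (-n₂) 0) := by
  have v2 : lor (aff v) (planeVec (-n₂) 0) = 0 := by
    rw [aff_eq_planeVec, lor_planeVec, inner_neg_right, real_inner_comm, h.two_v]; ring
  have f2 : lor (aff f) (planeVec (-n₂) 0) = 0 := by
    rw [aff_eq_planeVec, lor_planeVec, inner_neg_right, real_inner_comm, h.two_f]; ring
  have t2 : lor timeVec (planeVec (-n₂) 0) = 0 := by
    rw [timeVec, lor_planeVec]; simp
  have n2 := h.lor_mirrors_self 2
  change lor (planeVec (-n₂) 0) (planeVec (-n₂) 0) = 1 at n2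
  set N := planeVec (-n₂) 0
  have vv : lor (aff v) (aff v) = a ^ 2 := by rw [lor_aff, h.v_v]; ring
  have ff : lor (aff f) (aff f) = b ^ 2 := by rw [lor_aff, h.f_f]; ring
  have vf : lor (aff v) (aff f) = 0 := by rw [lor_aff, h.v_f]; ring
  have ha := h.a_pos
  have hb := h.b_pos
  have nd : GramNondeg ![timeVec, aff v, aff f, N] := by
    intro c hc
    have h0 := hc 0
    have h1 := hc 1
    have h2 := hc 2
    have h3 := hc 3
    simp [Fin.sum_univ_four, vv, ff, vf, lor_comm (aff f) (aff v), v2, f2, t2, n2, lor_aff_time,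
      lor_comm timeVec (aff _), lor_comm N, lor_time_time] at h0 h1 h2 h3
    have e1 : c 0 = c 1 * a ^ 2 := by linarith
    have e2 : c 0 = c 2 * b ^ 2 := by linarith
    have e3 : c 0 + c 1 + c 2 = 0 := by linarith
    have z1 : c 1 * (a ^ 2 * b ^ 2 + a ^ 2 + b ^ 2) = 0 := by
      linear_combination b ^ 2 * e3 - (1 + b ^ 2) * e1 + e2
    have p : (a ^ 2 * b ^ 2 + a ^ 2 + b ^ 2) ≠ 0 := by positivity
    have c1 : c 1 = 0 := (mul_eq_zero.1 z1).resolve_right p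
    have c0 : c 0 = 0 := by rw [e1, c1, zero_mul]
    have c2 : c 2 = 0 := by linarith
    ext i
    fin_cases i
    exacts [c0, c1, c2, h3]
  -- the image of the remaining direction
  have hN : A *ᵥ N - lor N (A *ᵥ N) • N = 0 := by
    apply nd.eq_zero
    intro i
    fin_cases i
    · have := hA timeVec N
      rw [ht] at this
      simp [this, t2]
    · have := hA (aff v) N
      rw [hv] at this
      simp [this, v2]
    · have := hA (aff f) N
      rw [hf] at this
      simp [this, f2]
    · simp [n2]
  rw [sub_eq_zero] at hN
  have sq := hA N N
  set c := lor N (A *ᵥ N)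
  rw [hN] at sq
  simp only [map_smul, LinearMap.smul_apply, n2, smul_eq_mul, mul_one] at sq
  have hc : (c - 1) * (c + 1) = 0 := by linear_combination sq
  rcases mul_eq_zero.1 hc with z | z
  · left
    have c1 : c = 1 := by linarith
    rw [c1, one_smul] at hN
    apply nd.matrix_ext
    intro i
    rw [Matrix.one_mulVec]
    fin_cases i
    exacts [ht, hv, hf, hN]
  · right
    have c1 : c = -1 := by linarith
    rw [c1, neg_one_smul] at hN
    apply nd.matrix_ext
    intro i
    rw [reflMat_mulVec]
    fin_cases i
    · change A *ᵥ timeVec = timeVec - (2 * lor N timeVec) • N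
      rw [lor_comm, t2, ht]; simp
    · change A *ᵥ aff v = aff v - (2 * lor N (aff v)) • N
      rw [lor_comm, v2, hv]; simp
    · change A *ᵥ aff f = aff f - (2 * lor N (aff f)) • N
      rw [lor_comm, f2, hf]; simp
    · change A *ᵥ N = N - (2 * lor N N) • N
      rw [n2, hN]; module

/-- The caps of the regular polyhedron have apex vectors of equal norm, so a symmetry permutes the
vectors, not just the rays. It therefore fixes the time direction and is a Euclidean isometry B; an
element of the reflection group brings (Bv, Bf) back to (v, f). -/
theorem mem_closure_of_act_eq [Finite G] (h : Chain s₁ s₂ s₃ σ n₁ n₂ n₃ t v f a b) {μ : Mob}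
    (hμ : act μ (illum '' orb σ v) = illum '' orb σ v) :
    μ ∈ Subgroup.closure {reflMob _ (h.lor_mirrors_self 1), reflMob _ (h.lor_mirrors_self 2),
      reflMob _ (h.lor_mirrors_self 3)} := by
  have hA := rho_preserves μ
  have ha := h.a_pos
  have one : ∀ {k u : G} {s : ℝ}, 0 < s → aff (σ u v) = s • rho μ *ᵥ aff (σ k v) →
      rho μ *ᵥ aff (σ k v) = aff (σ u v) := by
    intro k u s hs e
    have e2 := congrArg (fun z => lor z z) e
    simp only [map_smul, LinearMap.smul_apply, hA, lor_aff, h.inner_map, h.v_v, smul_eq_mul] at e2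
    have : a ^ 2 * ((s - 1) * (s + 1)) = 0 := by linarith
    rcases mul_eq_zero.1 this with z | z
    · exact absurd z (by positivity)
    · rcases mul_eq_zero.1 z with z | z
      · rw [show s = 1 by linarith, one_smul] at e
        exact e.symm
      · linarith
  have corr1 : ∀ k, ∃ u, rho μ *ᵥ aff (σ k v) = aff (σ u v) := by
    intro k
    have : (μ : Equiv.Perm Rhat) '' illum (σ k v) ∈ illum '' orb σ v := by
      rw [← hμ]; exact ⟨_, ⟨_, ⟨k, rfl⟩, rfl⟩, rfl⟩
    obtain ⟨_, ⟨u, rfl⟩, e⟩ := this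
    obtain ⟨s, hs, e'⟩ := exists_smul_of_illum (u := σ u v) hA (h.norm_gt k) (by
      rw [e, illum_eq]; exact image_posSide μ _)
    exact ⟨u, one hs e'⟩
  have corr2 : ∀ u, ∃ k, rho μ *ᵥ aff (σ k v) = aff (σ u v) := by
    intro u
    have : illum (σ u v) ∈ act μ (illum '' orb σ v) := by rw [hμ]; exact ⟨_, ⟨u, rfl⟩, rfl⟩
    obtain ⟨_, ⟨_, ⟨k, rfl⟩, rfl⟩, e⟩ := this
    obtain ⟨s, hs, e'⟩ := exists_smul_of_illum (u := σ u v) hA (h.norm_gt k) (by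
      rw [← e]; simp only [illum_eq]; exact image_posSide μ _)
    exact ⟨k, one hs e'⟩
  have ht : rho μ *ᵥ timeVec = timeVec := by
    rw [← sub_eq_zero]
    apply eq_zero_of_lor_aff (isPolytope v) h.zero_mem_interior
    rw [h.extremePoints_eq]
    rintro _ ⟨u, rfl⟩
    obtain ⟨k, hk⟩ := corr2 u
    rw [map_sub, lor_aff_time]
    dsimp only
    rw [← hk, hA, lor_aff_time, sub_self]
  choose B hB using exists_aff_of_fix_time hA ht
  have hBB : ∀ x y, ⟪B x, B y⟫ = ⟪x, y⟫ := by
    intro x y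
    have := hA (aff x) (aff y)
    rw [hB, hB, lor_aff, lor_aff] at this
    linarith
  obtain ⟨u, hu⟩ := corr1 1
  have hBv : B v = σ u v := by
    have := hB v
    rw [map_one, Module.End.one_apply] at hu
    rw [hu] at this
    exact (aff_injective this).symm
  -- B preserves the polar, so Bf lies in the hull of the orbit of f; having the norm of that orbit,
  -- it must be one of its points.
  have hBf : ∃ u', B f = σ u' f := by
    have hp : B f ∈ convexHull ℝ (orb σ f) := by
      rw [← h.polarSet_eq]
      intro x hx
      rw [real_inner_comm]
      refine inner_le_of_mem_convexHull ?_ hx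
      rintro _ ⟨w, rfl⟩
      obtain ⟨k, hk⟩ := corr2 w
      rw [hB] at hk
      dsimp only
      rw [← aff_injective hk, hBB, ← h.v_f]
      exact h.inner_le h.dominant_v h.dominant_f k
    have hmax : ∀ y ∈ orb σ f, ⟪y, B f⟫ ≤ ⟪f, f⟫ := by
      rintro _ ⟨w, rfl⟩
      have := real_inner_self_nonneg (x := σ w f - B f)
      simp only [inner_sub_left, inner_sub_right, hBB, h.inner_map,
        real_inner_comm (σ w f) (B f)] at this
      linarith
    have hm := mem_convexHull_of_eq_max hmax hp (hBB f f)
    obtain ⟨_, ⟨w, rfl⟩, hw⟩ := convexHull_nonempty_iff (𝕜 := ℝ).1 ⟨_, hm⟩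
    refine ⟨w, ?_⟩
    have hz : σ w f - B f = 0 := by
      rw [← inner_self_eq_zero (𝕜 := ℝ)]
      simp only [inner_sub_left, inner_sub_right, hBB, h.inner_map,
        real_inner_comm (σ w f) (B f)]
      linarith
    exact (sub_eq_zero.1 hz).symm
  obtain ⟨u', hu'⟩ := hBf
  -- Making the sum dominant handles the vertex and the facet at once: maximality in this direction,
  -- with ⟨v, f⟩ = 1 as the largest mixed product, forces the images to be v and f.
  obtain ⟨w, hw⟩ := h.exists_dominant (B v + B f)
  obtain ⟨ν, hν, hν1, hν2⟩ := h.exists_mob w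
  rw [map_add] at hw
  have cross : ⟪σ w (B v), σ w (B f)⟫ = 1 := by rw [h.inner_map, hBB, h.v_f]
  have fv : σ w (B v) = v := by
    have k1 := h.inner_le h.dominant_v hw (w * u)
    rw [map_mul, Module.End.mul_apply, ← hBv, inner_add_right, inner_add_right, cross,
      h.inner_map, hBB] at k1
    have k2 := h.inner_le' h.dominant_v h.dominant_f 1 (w * u')
    rw [map_one, Module.End.one_apply, map_mul, Module.End.mul_apply, ← hu', h.v_f] at k2
    rw [← sub_eq_zero]
    have k3 := real_inner_self_nonneg (x := σ w (B v) - v)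
    rw [← inner_self_eq_zero (𝕜 := ℝ)]
    simp only [inner_sub_left, inner_sub_right, hBB, h.inner_map,
      real_inner_comm v (σ w (B v))] at k3 ⊢
    linarith
  have ff : σ w (B f) = f := by
    have k1 := h.inner_le h.dominant_f hw (w * u')
    rw [map_mul, Module.End.mul_apply, ← hu', inner_add_right, inner_add_right,
      real_inner_comm (σ w (B v)) (σ w (B f)), cross, h.inner_map, hBB] at k1
    have k2 := h.inner_le' h.dominant_v h.dominant_f (w * u) 1
    rw [map_one, Module.End.one_apply, map_mul, Module.End.mul_apply, ← hBv, h.v_f,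
      real_inner_comm] at k2
    rw [← sub_eq_zero]
    have k3 := real_inner_self_nonneg (x := σ w (B f) - f)
    rw [← inner_self_eq_zero (𝕜 := ℝ)]
    simp only [inner_sub_left, inner_sub_right, hBB, h.inner_map,
      real_inner_comm f (σ w (B f))] at k3 ⊢
    linarith
  have key := h.eq_or_eq_of_fix (rho_preserves (ν * μ))
    (by rw [map_mul, ← Matrix.mulVec_mulVec, ht, hν2])
    (by rw [map_mul, ← Matrix.mulVec_mulVec, hB, hν1, fv])
    (by rw [map_mul, ← Matrix.mulVec_mulVec, hB, hν1, ff])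
  rw [← Subgroup.mul_mem_cancel_left _ hν]
  rcases key with k | k
  · rw [← map_one rho] at k
    rw [rho_injective k]
    exact one_mem _
  · replace k := k.trans (rho_reflMob _ (h.lor_mirrors_self 2)).symm
    rw [rho_injective k]
    exact Subgroup.subset_closure (by simp)

theorem act_eq_of_rho (w : G) {μ : Mob} (hμ : ∀ x, rho μ *ᵥ aff x = aff (σ w x)) :
    act μ (illum '' orb σ v) = illum '' orb σ v := by
  have im : ∀ x, (μ : Equiv.Perm Rhat) '' illum x = illum (σ w x) := fun x => by
    rw [illum_eq, image_posSide, hμ, illum_eq]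
  apply Set.Subset.antisymm
  · rintro _ ⟨_, ⟨_, ⟨u, rfl⟩, rfl⟩, rfl⟩
    exact ⟨σ w (σ u v), ⟨w * u, by simp⟩, (im _).symm⟩
  · rintro _ ⟨_, ⟨u, rfl⟩, rfl⟩
    refine ⟨_, ⟨σ w⁻¹ (σ u v), ⟨w⁻¹ * u, by simp⟩, rfl⟩, ?_⟩
    dsimp only
    rw [im, map_map_inv]

theorem inversions_subset (h : Chain s₁ s₂ s₃ σ n₁ n₂ n₃ t v f a b) {H : Subgroup Mob}
    (h0 : reflMob _ (h.lor_mirrors_self 0) ∈ H)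
    (hH : ∀ w, ∃ μ ∈ H, ∀ x, rho μ *ᵥ aff x = aff (σ w x)) :
    inversions (illum '' orb σ v) ⊆ H := by
  intro g hg
  obtain ⟨x, hx, ⟨_, ⟨w, rfl⟩, e⟩, rfl⟩ := mem_inversions_iff.1 hg
  obtain ⟨μ, hμ, hμ'⟩ := hH w
  have e1 : x = rho μ *ᵥ (a⁻¹ • aff v) := by
    rw [Matrix.mulVec_smul, hμ']
    refine eq_of_posSide (h.lor_capMirror w) hx ?_
    rw [posSide_smul (inv_pos.2 h.a_pos), ← illum_eq, e]
  subst e1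
  have := mul_mem (mul_mem hμ h0) (inv_mem hμ)
  rwa [← reflMob_mulVec μ (h.lor_mirrors_self 0) hx] at this

/-- The dual of the dual is the packing itself, so the generators are the inversions in both orbits
of caps and the symmetries. The inversions of each orbit are conjugate under the reflection group to
the one at v or at f. -/
theorem superSym_eq [Finite G] (h : Chain s₁ s₂ s₃ σ n₁ n₂ n₃ t v f a b) :
    superSym (illum '' orb σ v) = h.reflGroup := by
  have hH : ∀ w, ∃ μ ∈ h.reflGroup, ∀ x, rho μ *ᵥ aff x = aff (σ w x) := by
    intro w
    obtain ⟨μ, hμ, h1, -⟩ := h.exists_mob w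
    exact ⟨μ, h.closure_le_reflGroup hμ, h1⟩
  apply le_antisymm
  · rw [superSym, Subgroup.closure_le, apollonian, apollonian, symGroup, h.dual_eq,
      h.reverse.dual_eq, Set.union_subset_iff, Set.union_subset_iff]
    simp only [SetLike.coe_subset_coe, Subgroup.closure_le]
    refine ⟨⟨h.inversions_subset (h.reflMob_mem 0) hH, fun μ hμ =>
      h.closure_le_reflGroup (h.mem_closure_of_act_eq hμ)⟩, ?_⟩
    exact h.reverse.inversions_subset (h.reflMob_mem 4) hH
  · rw [reflGroup, Subgroup.closure_le]
    have left : inversions (illum '' orb σ v) ⊆ superSym (illum '' orb σ v) := by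
      intro g hg
      refine Subgroup.subset_closure (Or.inl (Or.inl ?_))
      rw [apollonian, h.dual_eq, h.reverse.dual_eq]
      exact Subgroup.subset_closure hg
    have right : inversions (illum '' orb σ f) ⊆ superSym (illum '' orb σ v) := by
      intro g hg
      refine Subgroup.subset_closure (Or.inr ?_)
      rw [apollonian, h.dual_eq]
      exact Subgroup.subset_closure hg
    have mid : ∀ s n (hn : lor (planeVec (-n) 0) (planeVec (-n) 0) = 1),
        (∀ x, σ s x = x - (2 * ⟪n, x⟫) • n) →
        reflMob _ hn ∈ superSym (illum '' orb σ v) := by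
      intro s n hn hs
      refine Subgroup.subset_closure (Or.inl (Or.inr (Subgroup.subset_closure ?_)))
      exact act_eq_of_rho s fun x => by rw [(rho_planeMirror hn).1, hs]
    rintro _ ⟨i, rfl⟩
    fin_cases i
    · apply left
      apply reflMob_mem_inversions
      exact ⟨v, vertex_mem_orb v, by
        rw [illum_eq]; exact (posSide_smul (inv_pos.2 h.a_pos) _).symm⟩
    · exact mid s₁ n₁ _ h.refl_one
    · exact mid s₂ n₂ _ h.refl_two
    · exact mid s₃ n₃ _ h.refl_three
    · apply right
      apply reflMob_mem_inversions
      exact ⟨f, vertex_mem_orb f, by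
        rw [illum_eq]; exact (posSide_smul (inv_pos.2 h.b_pos) _).symm⟩

end Chain

/-! ### Construction of the reflection groups -/

/-- The walls of a chamber of a finite reflection group with linear diagram `p – q`, and the
points `t`, `t + a • n₁`, `t + b • n₃` on its extremal rays. -/
structure ChamberData (p q : ℕ) (n₁ n₂ n₃ t : E3) (a b : ℝ) : Prop where
  three_le_p : 3 ≤ p
  p_le_five : p ≤ 5
  three_le_q : 3 ≤ q
  q_le_five : q ≤ 5
  unit_one : ⟪n₁, n₁⟫ = 1
  unit_two : ⟪n₂, n₂⟫ = 1
  unit_three : ⟪n₃, n₃⟫ = 1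
  unit_t : ⟪t, t⟫ = 1
  orth : ⟪n₁, n₃⟫ = 0
  orth_one : ⟪n₁, t⟫ = 0
  orth_three : ⟪n₃, t⟫ = 0
  pos_t : 0 < ⟪n₂, t⟫
  a_pos : 0 < a
  b_pos : 0 < b
  two_v : ⟪n₂, t + a • n₁⟫ = 0
  two_f : ⟪n₂, t + b • n₃⟫ = 0
  cos_p : ⟪n₁, n₂⟫ = -Real.cos (Real.pi / p)
  cos_q : ⟪n₂, n₃⟫ = -Real.cos (Real.pi / q)

/-- The Coxeter matrix of the diagram `p – q`. -/
def chainMatrix (p q : ℕ) (hp : p ≠ 1) (hq : q ≠ 1) : CoxeterMatrix (Fin 3) where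
  M := !![1, p, 2; p, 1, q; 2, q, 1]
  isSymm := by
    ext i j
    fin_cases i <;> fin_cases j <;> rfl
  diagonal i := by fin_cases i <;> rfl
  off_diagonal i j h := by
    fin_cases i <;> fin_cases j <;> simp at h ⊢ <;> assumption

/-- The group is the abstract Coxeter group of p – q acting through the three reflections; the
general chamber theorems give faithfulness and uniqueness of dominant points. Finiteness is obtained
later, from a finite invariant set. -/
theorem ChamberData.exists_chain {p q : ℕ} {n₁ n₂ n₃ t : E3} {a b : ℝ}
    (d : ChamberData p q n₁ n₂ n₃ t a b) : ∃ (G : Type) (_ : Group G) (s₁ s₂ s₃ : G)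
      (σ : G →* Module.End ℝ E3), Chain s₁ s₂ s₃ σ n₁ n₂ n₃ t (t + a • n₁) (t + b • n₃) a b ∧
      Function.Injective σ ∧ (s₁ * s₂) ^ p = 1 ∧ (s₂ * s₃) ^ q = 1 := by
  have hp := d.three_le_p
  have hq := d.three_le_q
  let M := chainMatrix p q (by omega) (by omega)
  let φ : LinearMap.BilinForm ℝ E3 := innerₗ E3
  let α : Fin 3 → E3 := ![n₁, n₂, n₃]
  have hφ : ∀ x y, φ x y = ⟪x, y⟫ := fun x y => rfl
  have hsymm : ∀ x y, φ x y = φ y x := fun x y => real_inner_comm y x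
  have hp0 : p ≠ 0 := by omega
  have hq0 : q ≠ 0 := by omega
  have hα : RootFamily M φ α := by
    refine ⟨hsymm, ?_, ?_, ?_⟩
    · intro i
      fin_cases i
      exacts [d.unit_one, d.unit_two, d.unit_three]
    · intro i j hij _
      fin_cases i <;> fin_cases j <;> simp at hij
      · exact d.cos_p
      · change ⟪n₁, n₃⟫ = -Real.cos (Real.pi / (2 : ℕ))
        rw [d.orth]; simp
      · change ⟪n₂, n₁⟫ = -Real.cos (Real.pi / p)
        rw [real_inner_comm, d.cos_p]
      · exact d.cos_q
      · change ⟪n₃, n₁⟫ = -Real.cos (Real.pi / (2 : ℕ))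
        rw [real_inner_comm, d.orth]; simp
      · change ⟪n₃, n₂⟫ = -Real.cos (Real.pi / q)
        rw [real_inner_comm, d.cos_q]
    · intro i j h
      exfalso
      fin_cases i <;> fin_cases j <;> revert h <;> simp [M, chainMatrix, hp0, hq0]
  have hlift : M.IsLiftable fun i => formRefl φ (α i) := by
    intro i j
    by_cases hij : i = j
    · subst hij
      rw [formRefl_mul_self φ (hα.unit i), one_pow]
    · have h0 : M i j ≠ 0 := by
        fin_cases i <;> fin_cases j <;> simp [M, chainMatrix, hp0, hq0]
      have h5 : M i j ≤ 5 := by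
        have := d.p_le_five
        have := d.q_le_five
        fin_cases i <;> fin_cases j <;> simp [M, chainMatrix] <;> omega
      have h1 := M.off_diagonal i j hij
      exact formRefl_mul_pow φ (hα.unit i) (hα.unit j) (hsymm _ _) (by omega) h5
        (hα.finite i j hij h0)
  let cs := M.toCoxeterSystem
  let σ : M.Group →* Module.End ℝ E3 := cs.lift ⟨_, hlift⟩
  have hσ : ∀ i, σ (cs.simple i) = formRefl φ (α i) := cs.lift_apply_simple hlift
  refine ⟨M.Group, inferInstance, cs.simple 0, cs.simple 1, cs.simple 2, σ, ?_,
    faithful_of_chamber hα hσ (p := (t + a • n₁) + (t + b • n₃) + t) ?_,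
    cs.simple_mul_simple_pow 0 1, cs.simple_mul_simple_pow 1 2⟩
  rotate_left
  · intro i
    rw [hsymm, hφ]
    have := d.a_pos
    have := d.b_pos
    have e1 := d.two_v
    have e2 := d.two_f
    have o := d.orth
    rw [real_inner_comm] at o
    fin_cases i
    · simp [α, inner_add_right, inner_smul_right, d.orth_one, d.unit_one, d.orth,
        -inner_self_eq_norm_sq_to_K, d.a_pos]
    · change 0 < ⟪n₂, _⟫
      rw [inner_add_right, inner_add_right, e1, e2]
      simpa using d.pos_t
    · simp [α, inner_add_right, inner_smul_right, d.orth_three, d.unit_three, o,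
        -inner_self_eq_norm_sq_to_K, d.b_pos]
  refine
    { gen := ?_
      flag := ⟨cs.simple_mul_simple_self 0, cs.simple_mul_simple_self 1,
        cs.simple_mul_simple_self 2, ?_⟩
      refl_one := fun x => by rw [hσ, formRefl_apply]; rfl
      refl_two := fun x => by rw [hσ, formRefl_apply]; rfl
      refl_three := fun x => by rw [hσ, formRefl_apply]; rfl
      unit_one := d.unit_one
      unit_two := d.unit_two
      unit_three := d.unit_three
      unit_t := d.unit_t
      orth := d.orth
      orth_one := d.orth_one
      orth_three := d.orth_three
      pos_t := d.pos_t
      a_pos := d.a_pos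
      b_pos := d.b_pos
      v_eq := rfl
      f_eq := rfl
      two_v := d.two_v
      two_f := d.two_f
      dominant_unique := ?_ }
  · intro P h1 hP w
    induction w using cs.simple_induction_right with
    | one => exact h1
    | mul_simple_right w i ih =>
      fin_cases i
      exacts [(hP w ih).1, (hP w ih).2.1, (hP w ih).2.2]
  · have h := cs.simple_mul_simple_pow 0 2
    change (cs.simple 0 * cs.simple 2) ^ 2 = 1 at h
    rw [pow_two] at h
    have := eq_inv_of_mul_eq_one_left h
    rwa [mul_inv_rev, cs.inv_simple, cs.inv_simple] at this
  · intro w x hx hw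
    apply dominant_unique hα hσ w
    · intro i
      rw [hsymm]
      fin_cases i
      exacts [hx.1, hx.2.1, hx.2.2]
    · intro i
      rw [hsymm]
      fin_cases i
      exacts [hw.1, hw.2.1, hw.2.2]

/-! ### Finiteness of the group, and recognition of an orbit -/

namespace Chain

variable {G : Type*} [Group G] {s₁ s₂ s₃ : G} {σ : G →* Module.End ℝ E3}
  {n₁ n₂ n₃ t v f : E3} {a b r : ℝ}

/-- The differences along v, s₁v, s₂s₁v, s₃s₂s₁v are nonzero multiples of n₁, n₂, n₃, which
determine every vector. -/
theorem map_eq_self_of_orb (h : Chain s₁ s₂ s₃ σ n₁ n₂ n₃ t v f a b) {w : G}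
    (hw : ∀ u, σ w (σ u v) = σ u v) (x : E3) : σ w x = x := by
  have step : ∀ (y n : E3) (c : ℝ), c ≠ 0 → σ w y = y → σ w (y - c • n) = y - c • n →
      σ w n = n := by
    intro y n c hc h1 h2
    rw [map_sub, h1, map_smul] at h2
    exact smul_right_injective E3 hc (sub_right_injective h2)
  have ha := h.a_pos
  have o := h.one_two
  have o' := h.three_two
  have i2 : ⟪n₂, σ s₁ v⟫ = -(2 * a) * ⟪n₁, n₂⟫ := by
    rw [h.refl_one, inner_sub_right, inner_smul_right, h.two_v, h.one_v, real_inner_comm n₁ n₂]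
    ring
  have i3 : ⟪n₃, σ s₂ (σ s₁ v)⟫ = (4 * a) * ⟪n₁, n₂⟫ * ⟪n₃, n₂⟫ := by
    rw [h.refl_two, inner_sub_right, inner_smul_right, i2, h.refl_one, inner_sub_right,
      inner_smul_right, h.three_v, real_inner_comm n₁ n₃, h.orth]
    ring
  have m1 : σ w n₁ = n₁ := by
    have e := h.refl_one v
    rw [h.one_v] at e
    refine step v n₁ (2 * a) (by positivity) (by simpa using hw 1) ?_
    rw [← e]
    exact hw s₁
  have m2 : σ w n₂ = n₂ := by
    have e := h.refl_two (σ s₁ v)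
    refine step (σ s₁ v) n₂ (2 * ⟪n₂, σ s₁ v⟫) ?_ (hw s₁) ?_
    · rw [i2]
      have := mul_ne_zero ha.ne' o.ne
      intro hz
      apply this
      linarith
    · have := hw (s₂ * s₁)
      rw [map_mul σ, Module.End.mul_apply] at this
      rw [← e]
      exact this
  have m3 : σ w n₃ = n₃ := by
    have e := h.refl_three (σ s₂ (σ s₁ v))
    have e2 : σ s₂ (σ s₁ v) = σ (s₂ * s₁) v := by rw [map_mul, Module.End.mul_apply]
    refine step (σ s₂ (σ s₁ v)) n₃ (2 * ⟪n₃, σ s₂ (σ s₁ v)⟫) ?_ (by rw [e2]; exact hw _) ?_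
    · rw [i3]
      have := mul_ne_zero ha.ne' (mul_ne_zero o.ne o'.ne)
      intro hz
      apply this
      linarith
    · have := hw (s₃ * (s₂ * s₁))
      rw [map_mul σ, map_mul σ, Module.End.mul_apply, Module.End.mul_apply] at this
      rw [← e]
      exact this
  rw [← sub_eq_zero]
  apply h.eq_zero_of_orth
  · nth_rw 1 [inner_sub_right, ← m1]
    rw [h.inner_map, sub_self]
  · nth_rw 1 [inner_sub_right, ← m2]
    rw [h.inner_map, sub_self]
  · nth_rw 1 [inner_sub_right, ← m3]
    rw [h.inner_map, sub_self]

theorem map_mem_of_invariant (h : Chain s₁ s₂ s₃ σ n₁ n₂ n₃ t v f a b) {S : Set E3}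
    (h1 : ∀ x ∈ S, x - (2 * ⟪n₁, x⟫) • n₁ ∈ S) (h2 : ∀ x ∈ S, x - (2 * ⟪n₂, x⟫) • n₂ ∈ S)
    (h3 : ∀ x ∈ S, x - (2 * ⟪n₃, x⟫) • n₃ ∈ S) (w : G) : ∀ x ∈ S, σ w x ∈ S := by
  refine h.gen (fun w => ∀ x ∈ S, σ w x ∈ S) (by simp) ?_ w
  intro w hw
  refine ⟨fun x hx => ?_, fun x hx => ?_, fun x hx => ?_⟩ <;>
    rw [map_mul, Module.End.mul_apply]
  · rw [h.refl_one]; exact hw _ (h1 x hx)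
  · rw [h.refl_two]; exact hw _ (h2 x hx)
  · rw [h.refl_three]; exact hw _ (h3 x hx)

/-- A finite invariant set containing a multiple of v has a faithful action, so the group embeds in
its self-maps. -/
theorem finite_of_invariant (h : Chain s₁ s₂ s₃ σ n₁ n₂ n₃ t v f a b) (hσ : Function.Injective σ)
    (hr : 0 < r) {S : Set E3} (hS : S.Finite) (hv : r • v ∈ S)
    (hinv : ∀ w, ∀ x ∈ S, σ w x ∈ S) : Finite G := by
  have := hS.to_subtype
  let F : G → S → S := fun w x => ⟨σ w x, hinv w x x.2⟩
  apply Finite.of_injective F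
  intro u w huw
  have key : ∀ x ∈ S, σ u x = σ w x := fun x hx =>
    Subtype.ext_iff.1 (congrFun huw ⟨x, hx⟩)
  have h1 : ∀ x, σ (w⁻¹ * u) x = x := by
    apply h.map_eq_self_of_orb
    intro g
    have := key _ (hinv g _ hv)
    rw [map_smul, map_smul, map_smul] at this
    have := smul_right_injective E3 hr.ne' this
    rw [map_mul, Module.End.mul_apply, this, map_inv_map]
  have h2 : σ (w⁻¹ * u) = σ 1 := by
    ext1 x
    rw [h1, map_one, Module.End.one_apply]
  have := hσ h2
  exact (inv_mul_eq_one.1 this).symm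

theorem eq_orb_of_invariant [Finite G] (h : Chain s₁ s₂ s₃ σ n₁ n₂ n₃ t v f a b) {S : Set E3}
    (hv : r • v ∈ S) (hinv : ∀ w, ∀ x ∈ S, σ w x ∈ S)
    (hdom : ∀ x ∈ S, Dominant n₁ n₂ n₃ x → x = r • v) : S = orb σ (r • v) := by
  apply Set.Subset.antisymm
  · intro x hx
    obtain ⟨w, hw⟩ := h.exists_dominant x
    refine ⟨w⁻¹, ?_⟩
    dsimp only
    rw [← hdom _ (hinv w x hx) hw, map_inv_map]
  · rintro _ ⟨w, rfl⟩
    exact hinv w _ hv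

end Chain

/-! ### The vertices of the Platonic solids -/

/-- `S` is the orbit of a vertex of the chamber of a finite reflection group with diagram
`p – q`. -/
def IsChainOrbit (p q : ℕ) (S : Set E3) : Prop :=
  ∃ (G : Type) (_ : Group G) (_ : Finite G) (s₁ s₂ s₃ : G) (σ : G →* Module.End ℝ E3)
      (n₁ n₂ n₃ t v f : E3) (a b r : ℝ), Chain s₁ s₂ s₃ σ n₁ n₂ n₃ t v f a b ∧
      (s₁ * s₂) ^ p = 1 ∧ (s₂ * s₃) ^ q = 1 ∧ 0 < r ∧ S = orb σ (r • v) ∧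
      ⟪n₁, n₂⟫ = -Real.cos (Real.pi / p) ∧ ⟪n₂, n₃⟫ = -Real.cos (Real.pi / q)

theorem ChamberData.isChainOrbit {p q : ℕ} {n₁ n₂ n₃ t : E3} {a b r : ℝ}
    (d : ChamberData p q n₁ n₂ n₃ t a b) (hr : 0 < r) {S : Set E3} (hS : S.Finite)
    (hv : r • (t + a • n₁) ∈ S)
    (h1 : ∀ x ∈ S, x - (2 * ⟪n₁, x⟫) • n₁ ∈ S) (h2 : ∀ x ∈ S, x - (2 * ⟪n₂, x⟫) • n₂ ∈ S)
    (h3 : ∀ x ∈ S, x - (2 * ⟪n₃, x⟫) • n₃ ∈ S)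
    (hdom : ∀ x ∈ S, Dominant n₁ n₂ n₃ x → x = r • (t + a • n₁)) :
    IsChainOrbit p q S := by
  obtain ⟨G, _, s₁, s₂, s₃, σ, h, hσ, hp, hq⟩ := d.exists_chain
  have hinv := h.map_mem_of_invariant h1 h2 h3
  have hG := h.finite_of_invariant hσ hr hS hv hinv
  exact ⟨G, inferInstance, hG, s₁, s₂, s₃, σ, n₁, n₂, n₃, t, _, _, a, b, r, h, hp, hq, hr,
    h.eq_orb_of_invariant hv hinv hdom, d.cos_p, d.cos_q⟩

theorem finite_of_coord {S : Set E3} {F : Set ℝ} (hF : F.Finite)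
    (h : ∀ x ∈ S, x 0 ∈ F ∧ x 1 ∈ F ∧ x 2 ∈ F) : S.Finite := by
  have h1 : (Set.pi Set.univ fun _ : Fin 3 => F).Finite := Set.Finite.pi fun _ => hF
  refine Set.Finite.of_finite_image (f := WithLp.ofLp) (h1.subset ?_)
    (WithLp.ofLp_injective 2).injOn
  rintro _ ⟨x, hx, rfl⟩ i -
  obtain ⟨k0, k1, k2⟩ := h x hx
  fin_cases i
  exacts [k0, k1, k2]

theorem refl_coord (n x : E3) (i : Fin 3) :
    (x - (2 * ⟪n, x⟫) • n) i = x i - 2 * (n 0 * x 0 + n 1 * x 1 + n 2 * x 2) * n i := by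
  rw [inner_eq_sum]; simp

theorem E3_ext {x y : E3} (h0 : x 0 = y 0) (h1 : x 1 = y 1) (h2 : x 2 = y 2) : x = y := by
  ext i
  fin_cases i
  exacts [h0, h1, h2]

theorem cos_pi_div_four' : Real.cos (Real.pi / (4 : ℕ)) = √2 / 2 := by
  push_cast; exact Real.cos_pi_div_four

theorem cos_pi_div_three' : Real.cos (Real.pi / (3 : ℕ)) = 1 / 2 := by
  push_cast; exact Real.cos_pi_div_three

theorem cos_pi_div_five' : Real.cos (Real.pi / (5 : ℕ)) = Real.goldenRatio / 2 := by
  push_cast; rw [Real.cos_pi_div_five, Real.goldenRatio]; ring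

/-- The triples of coordinates of the vertices of an icosahedron. -/
def IcoTriple (g x y z : ℝ) : Prop :=
  (x = 0 ∧ (y = 1 ∨ y = -1) ∧ (z = g ∨ z = -g)) ∨
  (y = 0 ∧ (z = 1 ∨ z = -1) ∧ (x = g ∨ x = -g)) ∨
  (z = 0 ∧ (x = 1 ∨ x = -1) ∧ (y = g ∨ y = -g))

/-- The triples of coordinates of the vertices of a dodecahedron. -/
def DodTriple (g x y z : ℝ) : Prop :=
  ((x = 1 ∨ x = -1) ∧ (y = 1 ∨ y = -1) ∧ (z = 1 ∨ z = -1)) ∨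
  (x = 0 ∧ (y = g - 1 ∨ y = 1 - g) ∧ (z = g ∨ z = -g)) ∨
  (y = 0 ∧ (z = g - 1 ∨ z = 1 - g) ∧ (x = g ∨ x = -g)) ∨
  (z = 0 ∧ (x = g - 1 ∨ x = 1 - g) ∧ (y = g ∨ y = -g))

theorem IcoTriple.refl {g x y z : ℝ} (hg : g ^ 2 = g + 1) (h : IcoTriple g x y z) :
    IcoTriple g (((1 - g) * x - g * y + z) / 2) ((-g * x + y + (g - 1) * z) / 2)
      ((x + (g - 1) * y + g * z) / 2) := by
  unfold IcoTriple at *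
  rcases h with ⟨rfl, rfl | rfl, rfl | rfl⟩ | ⟨rfl, rfl | rfl, rfl | rfl⟩ |
    ⟨rfl, rfl | rfl, rfl | rfl⟩ <;> ring_nf <;> rw [hg] <;> ring_nf <;> grind

theorem IcoTriple.dominant {g x y z : ℝ} (hg : g ^ 2 = g + 1) (h0 : 1 < g)
    (h : IcoTriple g x y z) (hx : 0 ≤ x) (hy : 0 ≤ y) (hd : 0 ≤ -g * x - y + (g - 1) * z) :
    x = 0 ∧ y = 1 ∧ z = g := by
  unfold IcoTriple at *
  rcases h with ⟨rfl, rfl | rfl, rfl | rfl⟩ | ⟨rfl, rfl | rfl, rfl | rfl⟩ |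
    ⟨rfl, rfl | rfl, rfl | rfl⟩ <;> first | (refine ⟨?_, ?_, ?_⟩ <;> rfl) | (exfalso; nlinarith)

set_option maxHeartbeats 1000000 in
theorem DodTriple.refl {g x y z : ℝ} (hg : g ^ 2 = g + 1) (h : DodTriple g x y z) :
    DodTriple g ((g * x + (g - 1) * y + z) / 2) (((g - 1) * x + y - g * z) / 2)
      ((x - g * y + (1 - g) * z) / 2) := by
  unfold DodTriple at *
  rcases h with ⟨rfl | rfl, rfl | rfl, rfl | rfl⟩ | ⟨rfl, rfl | rfl, rfl | rfl⟩ |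
    ⟨rfl, rfl | rfl, rfl | rfl⟩ | ⟨rfl, rfl | rfl, rfl | rfl⟩ <;> ring_nf <;> (try rw [hg]) <;>
      (try ring_nf) <;> grind

theorem DodTriple.dominant {g x y z : ℝ} (hg : g ^ 2 = g + 1) (h0 : 1 < g)
    (h : DodTriple g x y z) (hz : 0 ≤ z) (hy : 0 ≤ y) (hd : 0 ≤ (g - 1) * x - y - g * z) :
    x = g ∧ y = 0 ∧ z = g - 1 := by
  unfold DodTriple at *
  rcases h with ⟨rfl | rfl, rfl | rfl, rfl | rfl⟩ | ⟨rfl, rfl | rfl, rfl | rfl⟩ |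
    ⟨rfl, rfl | rfl, rfl | rfl⟩ | ⟨rfl, rfl | rfl, rfl | rfl⟩ <;>
    first | (refine ⟨?_, ?_, ?_⟩ <;> rfl) | (exfalso; nlinarith)

theorem IcoTriple.neg_left {g x y z : ℝ} (h : IcoTriple g x y z) : IcoTriple g (-x) y z := by
  unfold IcoTriple at *; simp only [neg_zero, neg_eq_iff_eq_neg, neg_neg]; tauto

theorem IcoTriple.neg_mid {g x y z : ℝ} (h : IcoTriple g x y z) : IcoTriple g x (-y) z := by
  unfold IcoTriple at *; simp only [neg_zero, neg_eq_iff_eq_neg, neg_neg]; tauto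

theorem DodTriple.neg_mid {g x y z : ℝ} (h : DodTriple g x y z) : DodTriple g x (-y) z := by
  unfold DodTriple at *
  rcases h with ⟨rfl | rfl, rfl | rfl, rfl | rfl⟩ | ⟨rfl, rfl | rfl, rfl | rfl⟩ |
    ⟨rfl, rfl | rfl, rfl | rfl⟩ | ⟨rfl, rfl | rfl, rfl | rfl⟩ <;> simp

theorem DodTriple.neg_right {g x y z : ℝ} (h : DodTriple g x y z) : DodTriple g x y (-z) := by
  unfold DodTriple at *
  rcases h with ⟨rfl | rfl, rfl | rfl, rfl | rfl⟩ | ⟨rfl, rfl | rfl, rfl | rfl⟩ |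
    ⟨rfl, rfl | rfl, rfl | rfl⟩ | ⟨rfl, rfl | rfl, rfl | rfl⟩ <;> simp

set_option linter.unusedSimpArgs false

theorem mem_icosahedron {x : E3} :
    x ∈ Solid.icosahedron.vertices ↔ IcoTriple Real.goldenRatio (x 0) (x 1) (x 2) := by
  simp only [Solid.vertices, Set.mem_ofPred_eq, Fin.exists_fin_succ, IcoTriple]
  simp

theorem mem_dodecahedron {x : E3} :
    x ∈ Solid.dodecahedron.vertices ↔ DodTriple Real.goldenRatio (x 0) (x 1) (x 2) := by
  have e : Real.goldenRatio⁻¹ = Real.goldenRatio - 1 := by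
    rw [Real.inv_goldenRatio]; linarith [Real.goldenRatio_add_goldenConj]
  simp only [Solid.vertices, Set.mem_union, Set.mem_ofPred_eq, Fin.exists_fin_succ,
    Fin.forall_fin_succ, DodTriple, e]
  simp

theorem mem_tetrahedron {x : E3} : x ∈ Solid.tetrahedron.vertices ↔
    ((x 0 = 1 ∨ x 0 = -1) ∧ (x 1 = 1 ∨ x 1 = -1) ∧ (x 2 = 1 ∨ x 2 = -1)) ∧
      x 0 * x 1 * x 2 = 1 := by
  simp [Solid.vertices, Fin.forall_fin_succ]

theorem mem_cube {x : E3} : x ∈ Solid.cube.vertices ↔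
    (x 0 = 1 ∨ x 0 = -1) ∧ (x 1 = 1 ∨ x 1 = -1) ∧ (x 2 = 1 ∨ x 2 = -1) := by
  simp [Solid.vertices, Fin.forall_fin_succ]

theorem mem_octahedron {x : E3} : x ∈ Solid.octahedron.vertices ↔
    ((x 0 = 1 ∨ x 0 = -1) ∧ x 1 = 0 ∧ x 2 = 0) ∨ ((x 1 = 1 ∨ x 1 = -1) ∧ x 0 = 0 ∧ x 2 = 0) ∨
      ((x 2 = 1 ∨ x 2 = -1) ∧ x 0 = 0 ∧ x 1 = 0) := by
  simp [Solid.vertices, Fin.forall_fin_succ, Fin.exists_fin_succ]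

/-- Scaled so that edge midpoints are unit vectors: v is √2/2 times (1, 1, 1) and f = (0, 0, √2).
The octahedron uses this chamber with vertex and facet exchanged. -/
theorem ChamberData.cube : ChamberData 4 3 !₂[1, 0, 0] !₂[-(√2 / 2), √2 / 2, 0]
    !₂[0, -(√2 / 2), √2 / 2] !₂[0, √2 / 2, √2 / 2] (√2 / 2) 1 := by
  have h2 : √2 * √2 = 2 := Real.mul_self_sqrt (by norm_num)
  have h0 : 0 < √2 := by positivity
  constructor <;> (try simp only [inner_eq_sum, cos_pi_div_four', cos_pi_div_three',
    PiLp.add_apply, PiLp.smul_apply]) <;> simp <;> nlinarith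

theorem ChamberData.octahedron : ChamberData 3 4 !₂[0, -(√2 / 2), √2 / 2]
    !₂[-(√2 / 2), √2 / 2, 0] !₂[1, 0, 0] !₂[0, √2 / 2, √2 / 2] 1 (√2 / 2) := by
  have h2 : √2 * √2 = 2 := Real.mul_self_sqrt (by norm_num)
  have h0 : 0 < √2 := by positivity
  constructor <;> (try simp only [inner_eq_sum, cos_pi_div_four', cos_pi_div_three',
    PiLp.add_apply, PiLp.smul_apply]) <;> simp <;> nlinarith

theorem ChamberData.tetrahedron : ChamberData 3 3 !₂[0, √2 / 2, √2 / 2]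
    !₂[√2 / 2, -(√2 / 2), 0] !₂[0, √2 / 2, -(√2 / 2)] !₂[1, 0, 0] (√2) (√2) := by
  have h2 : √2 * √2 = 2 := Real.mul_self_sqrt (by norm_num)
  have h0 : 0 < √2 := by positivity
  constructor <;> (try simp only [inner_eq_sum, cos_pi_div_three', PiLp.add_apply,
    PiLp.smul_apply]) <;> simp <;> nlinarith

/-- t is the scaled midpoint of the edge from (0, 1, φ) to (0, -1, φ), so v = (0, φ - 1, 1) is (0,
1, φ)/φ; the facet centre is (2 - φ, 0, 1). -/
theorem ChamberData.icosahedron {g : ℝ} (hg : g = Real.goldenRatio) :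
    ChamberData 3 5 !₂[0, 1, 0] !₂[-g / 2, -1 / 2, (g - 1) / 2] !₂[1, 0, 0] !₂[0, 0, 1]
      (g - 1) (2 - g) := by
  have h1 : 1 < g := hg ▸ Real.one_lt_goldenRatio
  have h2 : g < 2 := hg ▸ Real.goldenRatio_lt_two
  have h3 : g ^ 2 = g + 1 := hg ▸ Real.goldenRatio_sq
  constructor <;> (try simp only [inner_eq_sum, cos_pi_div_three', cos_pi_div_five',
    PiLp.add_apply, PiLp.smul_apply, ← hg]) <;> simp <;> nlinarith

theorem ChamberData.dodecahedron {g : ℝ} (hg : g = Real.goldenRatio) :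
    ChamberData 5 3 !₂[0, 0, 1] !₂[(g - 1) / 2, -1 / 2, -g / 2] !₂[0, 1, 0] !₂[1, 0, 0]
      (2 - g) (g - 1) := by
  have h1 : 1 < g := hg ▸ Real.one_lt_goldenRatio
  have h2 : g < 2 := hg ▸ Real.goldenRatio_lt_two
  have h3 : g ^ 2 = g + 1 := hg ▸ Real.goldenRatio_sq
  constructor <;> (try simp only [inner_eq_sum, cos_pi_div_three', cos_pi_div_five',
    PiLp.add_apply, PiLp.smul_apply, ← hg]) <;> simp <;> nlinarith

theorem refl_axis_zero (x : E3) : x - (2 * ⟪!₂[(1 : ℝ), 0, 0], x⟫) • !₂[(1 : ℝ), 0, 0] =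
    !₂[-x 0, x 1, x 2] := by
  apply E3_ext <;> rw [refl_coord] <;> simp; ring

theorem refl_axis_one (x : E3) : x - (2 * ⟪!₂[(0 : ℝ), 1, 0], x⟫) • !₂[(0 : ℝ), 1, 0] =
    !₂[x 0, -x 1, x 2] := by
  apply E3_ext <;> rw [refl_coord] <;> simp; ring

theorem refl_axis_two (x : E3) : x - (2 * ⟪!₂[(0 : ℝ), 0, 1], x⟫) • !₂[(0 : ℝ), 0, 1] =
    !₂[x 0, x 1, -x 2] := by
  apply E3_ext <;> rw [refl_coord] <;> simp; ring

theorem refl_swap_one_two {i j : ℝ} (hi : 2 * (i * i) = 1) (hj : j = -i) (x : E3) :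
    x - (2 * ⟪!₂[0, i, j], x⟫) • !₂[0, i, j] = !₂[x 0, x 2, x 1] := by
  subst hj
  apply E3_ext <;> rw [refl_coord] <;> simp
  · linear_combination (x 2 - x 1) * hi
  · linear_combination (x 1 - x 2) * hi

theorem refl_swap_zero_one {i j : ℝ} (hi : 2 * (i * i) = 1) (hj : j = -i) (x : E3) :
    x - (2 * ⟪!₂[i, j, 0], x⟫) • !₂[i, j, 0] = !₂[x 1, x 0, x 2] := by
  subst hj
  apply E3_ext <;> rw [refl_coord] <;> simp
  · linear_combination (x 1 - x 0) * hi
  · linear_combination (x 0 - x 1) * hi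

theorem refl_neg_swap_one_two {i : ℝ} (hi : 2 * (i * i) = 1) (x : E3) :
    x - (2 * ⟪!₂[0, i, i], x⟫) • !₂[0, i, i] = !₂[x 0, -x 2, -x 1] := by
  apply E3_ext <;> rw [refl_coord] <;> simp
  · linear_combination -(x 2 + x 1) * hi
  · linear_combination -(x 1 + x 2) * hi

theorem refl_ico {g : ℝ} (hg : g ^ 2 = g + 1) (x : E3) :
    x - (2 * ⟪!₂[-g / 2, -1 / 2, (g - 1) / 2], x⟫) • !₂[-g / 2, -1 / 2, (g - 1) / 2] =
      !₂[((1 - g) * x 0 - g * x 1 + x 2) / 2, (-g * x 0 + x 1 + (g - 1) * x 2) / 2,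
        (x 0 + (g - 1) * x 1 + g * x 2) / 2] := by
  apply E3_ext <;> rw [refl_coord] <;> simp
  · linear_combination (x 2 - x 0) / 2 * hg
  · ring
  · linear_combination (x 0 - x 2) / 2 * hg

theorem refl_dod {g : ℝ} (hg : g ^ 2 = g + 1) (x : E3) :
    x - (2 * ⟪!₂[(g - 1) / 2, -1 / 2, -g / 2], x⟫) • !₂[(g - 1) / 2, -1 / 2, -g / 2] =
      !₂[(g * x 0 + (g - 1) * x 1 + x 2) / 2, ((g - 1) * x 0 + x 1 - g * x 2) / 2,
        (x 0 - g * x 1 + (1 - g) * x 2) / 2] := by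
  apply E3_ext <;> rw [refl_coord] <;> simp
  · linear_combination (x 2 - x 0) / 2 * hg
  · ring
  · linear_combination (x 0 - x 2) / 2 * hg

theorem isChainOrbit_tetrahedron :
    IsChainOrbit Solid.tetrahedron.p Solid.tetrahedron.q Solid.tetrahedron.vertices := by
  have h2 : √2 * √2 = 2 := Real.mul_self_sqrt (by norm_num)
  have hκ : √2 * (√2 / 2) = 1 := by linarith
  have hk : 2 * (√2 / 2 * (√2 / 2)) = 1 := by linarith
  have hk' : 2 * (-(√2 / 2) * -(√2 / 2)) = 1 := by linarith
  refine ChamberData.tetrahedron.isChainOrbit (r := 1) one_pos ?_ ?_ ?_ ?_ ?_ ?_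
  · refine finite_of_coord (F := {1, -1}) (by simp) fun x hx => ?_
    rw [mem_tetrahedron] at hx
    exact hx.1
  · rw [mem_tetrahedron]; simp [hκ]
  all_goals
    intro x hx
    rw [mem_tetrahedron] at hx
    obtain ⟨⟨h1, h2, h3⟩, h4⟩ := hx
  · rw [refl_neg_swap_one_two hk, mem_tetrahedron]
    simp only [Matrix.cons_val, neg_eq_iff_eq_neg, neg_neg]
    exact ⟨by tauto, by linarith⟩
  · rw [refl_swap_zero_one hk rfl, mem_tetrahedron]
    simp only [Matrix.cons_val, neg_eq_iff_eq_neg, neg_neg]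
    exact ⟨by tauto, by linarith⟩
  · rw [refl_swap_one_two hk rfl, mem_tetrahedron]
    simp only [Matrix.cons_val, neg_eq_iff_eq_neg, neg_neg]
    exact ⟨by tauto, by linarith⟩
  · rintro ⟨d1, d2, d3⟩
    rw [inner_eq_sum] at d1 d2 d3
    simp at d1 d2 d3
    have d1 : 0 ≤ x 1 + x 2 := by
      by_contra hn
      have : 0 < √2 / 2 := by positivity
      nlinarith
    have k2 : x 2 = 1 := by
      rcases h3 with k2 | k2
      · exact k2
      · have k1 : x 1 = 1 := h2.resolve_right fun k => by linarith
        have k0 : x 0 = 1 := h1.resolve_right fun k => by linarith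
        rw [k0, k1, k2] at h4
        norm_num at h4
    have k1 : x 1 = 1 := h2.resolve_right fun k => by linarith
    have k0 : x 0 = 1 := h1.resolve_right fun k => by linarith
    apply E3_ext <;> simp [k0, k1, k2, hκ]

theorem isChainOrbit_octahedron :
    IsChainOrbit Solid.octahedron.p Solid.octahedron.q Solid.octahedron.vertices := by
  have h2 : √2 * √2 = 2 := Real.mul_self_sqrt (by norm_num)
  have hκ : √2 * (√2 / 2) = 1 := by linarith
  have hk : 2 * (√2 / 2 * (√2 / 2)) = 1 := by linarith
  have hk' : 2 * (-(√2 / 2) * -(√2 / 2)) = 1 := by linarith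
  refine ChamberData.octahedron.isChainOrbit (r := √2 / 2) (by positivity) ?_ ?_ ?_ ?_ ?_ ?_
  · refine finite_of_coord (F := {1, -1, 0}) (by simp) fun x hx => ?_
    rw [mem_octahedron] at hx
    simp only [Set.mem_insert_iff, Set.mem_singleton_iff]
    tauto
  · rw [mem_octahedron]; simp; left; linarith
  all_goals
    intro x hx
    rw [mem_octahedron] at hx
  · rw [refl_swap_one_two hk' (neg_neg _).symm, mem_octahedron]
    simp only [Matrix.cons_val, neg_zero, neg_eq_iff_eq_neg, neg_neg]
    tauto
  · rw [refl_swap_zero_one hk' (neg_neg _).symm, mem_octahedron]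
    simp only [Matrix.cons_val, neg_zero, neg_eq_iff_eq_neg, neg_neg]
    tauto
  · rw [refl_axis_zero, mem_octahedron]
    simp only [Matrix.cons_val, neg_zero, neg_eq_iff_eq_neg, neg_neg]
    tauto
  · rintro ⟨d1, d2, d3⟩
    rw [inner_eq_sum] at d1 d2 d3
    simp at d1 d2 d3
    rcases hx with ⟨k0 | k0, k1, k2⟩ | ⟨k1 | k1, k0, k2⟩ | ⟨k2 | k2, k0, k1⟩ <;> first
      | (exfalso; linarith)
      | (apply E3_ext <;> simp [k0, k1, k2]; linarith)

theorem isChainOrbit_cube :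
    IsChainOrbit Solid.cube.p Solid.cube.q Solid.cube.vertices := by
  have h2 : √2 * √2 = 2 := Real.mul_self_sqrt (by norm_num)
  have hκ : √2 * (√2 / 2) = 1 := by linarith
  have hk : 2 * (√2 / 2 * (√2 / 2)) = 1 := by linarith
  have hk' : 2 * (-(√2 / 2) * -(√2 / 2)) = 1 := by linarith
  refine ChamberData.cube.isChainOrbit (r := √2) (by positivity) ?_ ?_ ?_ ?_ ?_ ?_
  · refine finite_of_coord (F := {1, -1}) (by simp) fun x hx => ?_
    rw [mem_cube] at hx
    exact hx
  · rw [mem_cube]; simp [hκ]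
  all_goals
    intro x hx
    rw [mem_cube] at hx
  · rw [refl_axis_zero, mem_cube]
    simp only [Matrix.cons_val, neg_zero, neg_eq_iff_eq_neg, neg_neg]
    tauto
  · rw [refl_swap_zero_one hk' (neg_neg _).symm, mem_cube]
    simp only [Matrix.cons_val, neg_zero, neg_eq_iff_eq_neg, neg_neg]
    tauto
  · rw [refl_swap_one_two hk' (neg_neg _).symm, mem_cube]
    simp only [Matrix.cons_val, neg_zero, neg_eq_iff_eq_neg, neg_neg]
    tauto
  · rintro ⟨d1, d2, d3⟩
    rw [inner_eq_sum] at d1 d2 d3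
    simp at d1 d2 d3
    have k0 : x 0 = 1 := hx.1.resolve_right fun k => by linarith
    have k1 : x 1 = 1 := hx.2.1.resolve_right fun k => by linarith
    have k2 : x 2 = 1 := hx.2.2.resolve_right fun k => by linarith
    apply E3_ext <;> simp [k0, k1, k2, hκ]

theorem isChainOrbit_icosahedron :
    IsChainOrbit Solid.icosahedron.p Solid.icosahedron.q Solid.icosahedron.vertices := by
  have hg1 := Real.one_lt_goldenRatio
  have hg3 := Real.goldenRatio_sq
  generalize hg : Real.goldenRatio = g at hg1 hg3
  refine (ChamberData.icosahedron hg.symm).isChainOrbit (r := g) (by linarith) ?_ ?_ ?_ ?_ ?_ ?_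
  · refine finite_of_coord (F := {0, 1, -1, g, -g}) (by simp) fun x hx => ?_
    rw [mem_icosahedron, hg, IcoTriple] at hx
    simp only [Set.mem_insert_iff, Set.mem_singleton_iff]
    tauto
  · rw [mem_icosahedron, hg]
    refine Or.inl ⟨?_, Or.inl ?_, Or.inl ?_⟩ <;> simp
    linarith
  all_goals
    intro x hx
    rw [mem_icosahedron, hg] at hx
  · rw [refl_axis_one, mem_icosahedron, hg]
    exact hx.neg_mid
  · rw [refl_ico hg3, mem_icosahedron, hg]
    exact hx.refl hg3
  · rw [refl_axis_zero, mem_icosahedron, hg]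
    exact hx.neg_left
  · rintro ⟨d1, d2, d3⟩
    rw [inner_eq_sum] at d1 d2 d3
    simp at d1 d2 d3
    obtain ⟨k1, k2, k3⟩ := hx.dominant hg3 hg1 (by linarith) (by linarith) (by linarith)
    apply E3_ext <;> simp [k1, k2, k3]
    linarith

theorem isChainOrbit_dodecahedron :
    IsChainOrbit Solid.dodecahedron.p Solid.dodecahedron.q Solid.dodecahedron.vertices := by
  have hg1 := Real.one_lt_goldenRatio
  have hg3 := Real.goldenRatio_sq
  generalize hg : Real.goldenRatio = g at hg1 hg3
  refine (ChamberData.dodecahedron hg.symm).isChainOrbit (r := g) (by linarith) ?_ ?_ ?_ ?_ ?_ ?_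
  · refine finite_of_coord (F := {0, 1, -1, g, -g, g - 1, 1 - g}) (by simp) fun x hx => ?_
    rw [mem_dodecahedron, hg, DodTriple] at hx
    rcases hx with ⟨k0 | k0, k1 | k1, k2 | k2⟩ | ⟨k0, k1 | k1, k2 | k2⟩ |
      ⟨k1, k2 | k2, k0 | k0⟩ | ⟨k2, k0 | k0, k1 | k1⟩ <;> simp [k0, k1, k2]
  · rw [mem_dodecahedron, hg]
    refine Or.inr (Or.inr (Or.inl ⟨?_, Or.inl ?_, Or.inl ?_⟩)) <;> simp
    linarith
  all_goals
    intro x hx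
    rw [mem_dodecahedron, hg] at hx
  · rw [refl_axis_two, mem_dodecahedron, hg]
    exact hx.neg_right
  · rw [refl_dod hg3, mem_dodecahedron, hg]
    exact hx.refl hg3
  · rw [refl_axis_one, mem_dodecahedron, hg]
    exact hx.neg_mid
  · rintro ⟨d1, d2, d3⟩
    rw [inner_eq_sum] at d1 d2 d3
    simp at d1 d2 d3
    obtain ⟨k1, k2, k3⟩ := hx.dominant hg3 hg1 (by linarith) (by linarith) (by linarith)
    apply E3_ext <;> simp [k1, k2, k3]
    linarith

/-- The vertices of a Platonic solid form an orbit of its reflection group. -/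
theorem Solid.isChainOrbit (T : Solid) : IsChainOrbit T.p T.q T.vertices := by
  cases T
  exacts [isChainOrbit_tetrahedron, isChainOrbit_octahedron, isChainOrbit_cube,
    isChainOrbit_icosahedron, isChainOrbit_dodecahedron]

/-! ### The simple roots -/

/-- The Gram matrix of the diagram `∞ – p – q – ∞`. -/
def chainGram (p q : ℕ) : Matrix (Fin 5) (Fin 5) ℝ :=
  !![1, -1, 0, 0, 0;
     -1, 1, -Real.cos (Real.pi / p), 0, 0;
     0, -Real.cos (Real.pi / p), 1, -Real.cos (Real.pi / q), 0;
     0, 0, -Real.cos (Real.pi / q), 1, -1;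
     0, 0, 0, -1, 1]

/-- The normal vectors of the five generating reflections. -/
def Solid.roots (T : Solid) : Fin 5 → Vec4 :=
  if T.p = 3 then
    ![![0, 1, 1, 1], ![0, -1, 0, 0], ![0, 1 / 2, -1, -1 / 2],
      ![-1, 0, 2 * Real.cos (Real.pi / T.q), 2 * Real.cos (Real.pi / T.q)], ![1, 0, 0, 0]]
  else
    ![![1, 0, 0, 0], ![-1, 0, 2 * Real.cos (Real.pi / T.p), 2 * Real.cos (Real.pi / T.p)],
      ![0, 1 / 2, -1, -1 / 2], ![0, -1, 0, 0], ![0, 1, 1, 1]]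

theorem Solid.p_eq_three_or (T : Solid) :
    T.p = 3 ∧ (T.q = 3 ∨ T.q = 4 ∨ T.q = 5) ∨ T.q = 3 ∧ (T.p = 3 ∨ T.p = 4 ∨ T.p = 5) := by
  cases T <;> simp [Solid.p, Solid.q]

theorem Solid.q_eq_three (T : Solid) (h : T.p ≠ 3) : T.q = 3 := by
  rcases T.p_eq_three_or with h1 | h1
  exacts [absurd h1.1 h, h1.1]

theorem cos_pi_div_ge_half {m : ℕ} (hm : 3 ≤ m) : 1 / 2 ≤ Real.cos (Real.pi / m) := by
  rw [← Real.cos_pi_div_three]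
  have h3 : (3 : ℝ) ≤ m := by exact_mod_cast hm
  apply Real.cos_le_cos_of_nonneg_of_le_pi (by positivity)
  · linarith [Real.pi_pos]
  · exact div_le_div_of_nonneg_left Real.pi_pos.le (by norm_num) h3

theorem Solid.three_le_p (T : Solid) : 3 ≤ T.p := by cases T <;> simp [Solid.p]

theorem Solid.three_le_q (T : Solid) : 3 ≤ T.q := by cases T <;> simp [Solid.q]

theorem Solid.lor_roots (T : Solid) (i j : Fin 5) :
    lor (T.roots i) (T.roots j) = chainGram T.p T.q i j := by
  unfold Solid.roots chainGram
  split_ifs with h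
  · rw [h, cos_pi_div_three']
    generalize Real.cos (Real.pi / T.q) = c
    rw [lor_apply]
    fin_cases i <;> fin_cases j <;> simp <;> ring
  · rw [T.q_eq_three h, cos_pi_div_three']
    generalize Real.cos (Real.pi / T.p) = c
    rw [lor_apply]
    fin_cases i <;> fin_cases j <;> simp <;> ring

theorem Solid.reflMat_roots (T : Solid) (i : Fin 5) : reflMat (T.roots i) = T.gens i := by
  have key : ∀ c : ℝ, reflMat ![-1, 0, 2 * c, 2 * c] =
      !![-1, 0, 4 * c, -4 * c;
        0, 1, 0, 0;
        4 * c, 0, 1 - 8 * c ^ 2, 8 * c ^ 2;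
        4 * c, 0, -8 * c ^ 2, 1 + 8 * c ^ 2] := by
    intro c
    ext i j
    fin_cases i <;> fin_cases j <;>
      simp [reflMat, Q, Matrix.vecMulVec] <;> ring
  have kS : reflMat ![1, 0, 0, 0] = matS := by
    ext i j
    fin_cases i <;> fin_cases j <;>
      simp [reflMat, Q, Matrix.vecMulVec, matS]; norm_num
  have kSstar : reflMat ![0, 1, 1, 1] = matSstar := by
    ext i j
    fin_cases i <;> fin_cases j <;>
      simp [reflMat, Q, Matrix.vecMulVec, matSstar] <;> norm_num
  have kV : reflMat ![0, -1, 0, 0] = matV := by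
    ext i j
    fin_cases i <;> fin_cases j <;>
      simp [reflMat, Q, Matrix.vecMulVec, matV]; norm_num
  have kE : reflMat ![0, 1 / 2, -1, -1 / 2] = matE := by
    ext i j
    fin_cases i <;> fin_cases j <;>
      simp [reflMat, Q, Matrix.vecMulVec, matE] <;> norm_num
  unfold Solid.roots Solid.gens
  split_ifs with h <;> fin_cases i
  exacts [kSstar, kV, kE, key _, kS, kS, key _, kE, kV, kSstar]

theorem Solid.rootFamily (T : Solid) : RootFamily T.coxeterMatrix lor T.roots := by
  have hp := T.three_le_p
  have hq := T.three_le_q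
  refine ⟨lor_comm, ?_, ?_, ?_⟩
  · intro i
    rw [T.lor_roots]
    fin_cases i <;> rfl
  · intro i j hij h0
    rw [T.lor_roots]
    fin_cases i <;> fin_cases j <;> simp [Solid.coxeterMatrix, chainGram] at hij h0 ⊢
  · intro i j h0
    rw [T.lor_roots]
    fin_cases i <;> fin_cases j <;> simp [Solid.coxeterMatrix, chainGram] at h0 ⊢ <;> omega

/-- A point in the interior of the fundamental chamber. -/
def chamberVec : Vec4 := ![1 / 2, -1 / 2, -2, -3]

theorem Solid.lor_chamberVec_pos (T : Solid) (i : Fin 5) : 0 < lor chamberVec (T.roots i) := by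
  have h1 := cos_pi_div_ge_half T.three_le_p
  have h2 := cos_pi_div_ge_half T.three_le_q
  rw [lor_apply]
  unfold Solid.roots chamberVec
  split_ifs with h <;> fin_cases i <;> simp <;> linarith

/-! ### Groups of Möbius transformations generated by reflections -/

section Coxeter

variable {B : Type*} {M : CoxeterMatrix B} {α : B → Vec4}

theorem RootFamily.isLiftable (hα : RootFamily M lor α) (h5 : ∀ i j, M i j ≤ 5) :
    M.IsLiftable fun i => reflMob (α i) (hα.unit i) := by
  have hφ : ∀ i, Matrix.toLin' (rho (reflMob (α i) (hα.unit i))) = formRefl lor (α i) :=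
    fun i => by rw [rho_reflMob, toLin'_reflMat]
  have inj : ∀ μ : Mob, Matrix.toLin' (rho μ) = 1 → μ = 1 := by
    intro μ h
    apply rho_injective
    rw [map_one]
    apply Matrix.toLin'.injective
    rw [h, Matrix.toLin'_one]
    rfl
  intro i j
  apply inj
  have e : Matrix.toLin' (rho ((reflMob (α i) (hα.unit i) * reflMob (α j) (hα.unit j)) ^ M i j)) =
      (formRefl lor (α i) * formRefl lor (α j)) ^ M i j := by
    rw [map_pow, map_mul, Matrix.toLin'_pow, Matrix.toLin'_mul, hφ, hφ]
    rfl
  rw [e]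
  by_cases hij : i = j
  · subst hij
    rw [formRefl_mul_self lor (hα.unit i), one_pow]
  by_cases h0 : M i j = 0
  · rw [h0, pow_zero]
  · have h1 := M.off_diagonal i j hij
    exact formRefl_mul_pow lor (hα.unit i) (hα.unit j) (lor_comm _ _) (by omega) (h5 i j)
      (hα.finite i j hij h0)

/-- The homomorphism from the abstract Coxeter group to the Möbius group. -/
def RootFamily.toMob (hα : RootFamily M lor α) (h5 : ∀ i j, M i j ≤ 5) : M.Group →* Mob :=
  M.toCoxeterSystem.lift ⟨_, hα.isLiftable h5⟩

variable (hα : RootFamily M lor α) (h5 : ∀ i j, M i j ≤ 5)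

theorem RootFamily.toMob_simple (i : B) :
    hα.toMob h5 (M.toCoxeterSystem.simple i) = reflMob (α i) (hα.unit i) :=
  M.toCoxeterSystem.lift_apply_simple (hα.isLiftable h5) i

/-- The linear action of the abstract Coxeter group. -/
def RootFamily.toEnd : M.Group →* Module.End ℝ Vec4 :=
  (Matrix.toLinAlgEquiv' : Mat4 ≃ₐ[ℝ] Module.End ℝ Vec4).toAlgHom.toRingHom.toMonoidHom.comp
    (rho.comp (hα.toMob h5))

theorem RootFamily.toEnd_simple (i : B) :
    hα.toEnd h5 (M.toCoxeterSystem.simple i) = formRefl lor (α i) := by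
  rw [← toLin'_reflMat, ← rho_reflMob _ (hα.unit i), ← hα.toMob_simple h5]
  rfl

theorem RootFamily.eq_one_of_chamber {p : Vec4} (hp : ∀ i, 0 < lor p (α i)) {w : M.Group}
    (hw : ∀ i, 0 < lor (rho (hα.toMob h5 w) *ᵥ p) (α i)) : w = 1 :=
  PlatonicPacking.eq_one_of_chamber hα (hα.toEnd_simple h5) hp hw

theorem RootFamily.toMob_injective {p : Vec4} (hp : ∀ i, 0 < lor p (α i)) :
    Function.Injective (hα.toMob h5) := by
  rw [injective_iff_map_eq_one]
  intro w hw
  apply hα.eq_one_of_chamber h5 hp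
  rw [hw, map_one, Matrix.one_mulVec]
  exact hp

theorem RootFamily.range_toMob : (hα.toMob h5).range =
    Subgroup.closure (Set.range fun i => reflMob (α i) (hα.unit i)) := by
  rw [MonoidHom.range_eq_map, ← M.toCoxeterSystem.subgroup_closure_range_simple,
    MonoidHom.map_closure, ← Set.range_comp]
  exact congrArg _ (congrArg _ (funext fun i => hα.toMob_simple h5 i))

theorem RootFamily.range_rho_toMob :
    Set.range (fun w => rho (hα.toMob h5 w)) =
      (Submonoid.closure (Set.range fun i => reflMat (α i)) : Set Mat4) := by
  have e : MonoidHom.mrange (rho.comp (hα.toMob h5)) =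
      Submonoid.closure (Set.range fun i => reflMat (α i)) := by
    rw [MonoidHom.mrange_eq_map, ← M.toCoxeterSystem.submonoid_closure_range_simple,
      MonoidHom.map_mclosure, ← Set.range_comp]
    congr 2
    funext i
    change rho (hα.toMob h5 _) = _
    rw [hα.toMob_simple h5 i, rho_reflMob]
  rw [← e]
  rfl

/-- A group acting with an open set of matrices meeting it only in the identity is discrete. -/
theorem RootFamily.discreteTopology {p : Vec4} (hp : ∀ i, 0 < lor p (α i)) [Finite B] (ν : Mob) :
    DiscreteTopology (Set.range fun w => rho (ν⁻¹ * hα.toMob h5 w * ν)) := by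
  rw [discreteTopology_iff_isOpen_singleton]
  rintro ⟨_, w, rfl⟩
  -- F undoes the conjugation and translates the given element to the identity. The matrices A for
  -- which F A sends p into the open chamber form an open set meeting the group in that element
  -- alone.
  let F : Mat4 → Mat4 := fun A => rho (hα.toMob h5 w)⁻¹ * (rho ν * A * rho ν⁻¹)
  have hF : Continuous F := by fun_prop
  let U : Set Mat4 := {A | ∀ i, 0 < lor (F A *ᵥ p) (α i)}
  have hU : IsOpen U := by
    rw [show U = ⋂ i, {A | 0 < lor (F A *ᵥ p) (α i)} by ext; simp [U]]
    refine isOpen_iInter_of_finite fun i => isOpen_lt continuous_const ?_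
    simp only [lor_apply]
    have : Continuous fun A => F A *ᵥ p := hF.matrix_mulVec continuous_const
    fun_prop
  have hFr : ∀ u, F (rho (ν⁻¹ * hα.toMob h5 u * ν)) = rho (hα.toMob h5 (w⁻¹ * u)) := by
    intro u
    simp only [F, ← map_mul, ← map_inv]
    congr 1
    rw [map_mul, map_inv]
    group
  convert hU.preimage continuous_subtype_val
  ext ⟨_, u, rfl⟩
  simp only [Set.mem_singleton_iff, Set.mem_preimage]
  constructor
  · intro h i
    have e : rho (ν⁻¹ * hα.toMob h5 u * ν) = rho (ν⁻¹ * hα.toMob h5 w * ν) :=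
      congrArg Subtype.val h
    rw [e, hFr, inv_mul_cancel, map_one, map_one, Matrix.one_mulVec]
    exact hp i
  · intro h
    have : w⁻¹ * u = 1 := hα.eq_one_of_chamber h5 hp fun i => by
      have := h i
      rwa [hFr] at this
    rw [inv_mul_eq_one.1 this]

end Coxeter

/-! ### The super symmetrized Apollonian group as a Coxeter group -/

namespace Chain

variable {G : Type*} [Group G] {s₁ s₂ s₃ : G} {σ : G →* Module.End ℝ E3}
  {n₁ n₂ n₃ t v f : E3} {a b : ℝ} {p q : ℕ}

theorem lor_mirrors (h : Chain s₁ s₂ s₃ σ n₁ n₂ n₃ t v f a b)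
    (hp : ⟪n₁, n₂⟫ = -Real.cos (Real.pi / p)) (hq : ⟪n₂, n₃⟫ = -Real.cos (Real.pi / q))
    (i j : Fin 5) : lor (mirrors n₁ n₂ n₃ v f a b i) (mirrors n₁ n₂ n₃ v f a b j) =
      chainGram p q i j := by
  have ha := h.a_pos.ne'
  have hb := h.b_pos.ne'
  have key : ∀ i j : Fin 5, i < j → lor (mirrors n₁ n₂ n₃ v f a b i)
      (mirrors n₁ n₂ n₃ v f a b j) = chainGram p q i j := by
    intro i j hij
    fin_cases i <;> fin_cases j <;> simp at hij <;>
      simp [mirrors, chainGram, aff_eq_planeVec, lor_planeVec, h.v_f, h.two_v, h.three_v, h.two_f,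
        h.one_f, h.orth, h.one_v, h.three_f, hp, hq, real_inner_comm n₁ v, real_inner_comm n₂ v,
        real_inner_comm n₃ v, ha, hb]
  rcases lt_trichotomy i j with hij | rfl | hij
  · exact key i j hij
  · rw [h.lor_mirrors_self]
    fin_cases i <;> rfl
  · rw [lor_comm, key j i hij]
    fin_cases i <;> fin_cases j <;> rfl

theorem gramNondeg_mirrors (h : Chain s₁ s₂ s₃ σ n₁ n₂ n₃ t v f a b)
    (hp : ⟪n₁, n₂⟫ = -Real.cos (Real.pi / p)) (hq : ⟪n₂, n₃⟫ = -Real.cos (Real.pi / q))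
    (hp3 : 3 ≤ p) : GramNondeg fun i => mirrors n₁ n₂ n₃ v f a b i.castSucc := by
  intro c hc
  simp only [h.lor_mirrors hp hq] at hc
  have hpos := cos_pi_div_ge_half hp3
  have h0 := hc 0
  have h1 := hc 1
  have h2 := hc 2
  have h3 := hc 3
  simp [Fin.sum_univ_four, chainGram] at h0 h1 h2 h3
  generalize Real.cos (Real.pi / p) = k at *
  generalize Real.cos (Real.pi / q) = l at *
  have k2 : c 2 = 0 := by
    have : c 2 * k = 0 := by linarith
    exact (mul_eq_zero.1 this).resolve_right (by linarith)
  rw [k2] at h1 h2 h3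
  have k3 : c 3 = 0 := by linarith
  rw [k3] at h2
  have k1 : c 1 = 0 := by
    have : c 1 * k = 0 := by linarith
    exact (mul_eq_zero.1 this).resolve_right (by linarith)
  have k0 : c 0 = 0 := by linarith
  ext i
  fin_cases i
  exacts [k0, k1, k2, k3]

/-- The first four mirrors form a basis with the same Gram matrix as the first four roots, and the
fifth is determined by its products with them. -/
theorem exists_rho_mirrors (h : Chain s₁ s₂ s₃ σ n₁ n₂ n₃ t v f a b) (T : Solid)
    (hp : ⟪n₁, n₂⟫ = -Real.cos (Real.pi / T.p)) (hq : ⟪n₂, n₃⟫ = -Real.cos (Real.pi / T.q)) :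
    ∃ β : Mob, ∀ i, rho β *ᵥ mirrors n₁ n₂ n₃ v f a b i = T.roots i := by
  have hnd := h.gramNondeg_mirrors hp hq T.three_le_p
  have hgram : ∀ i j, lor (mirrors n₁ n₂ n₃ v f a b i) (mirrors n₁ n₂ n₃ v f a b j) =
      lor (T.roots i) (T.roots j) := fun i j => by rw [h.lor_mirrors hp hq, T.lor_roots]
  have hcd : ∀ i j : Fin 4, lor (mirrors n₁ n₂ n₃ v f a b i.castSucc)
    (mirrors n₁ n₂ n₃ v f a b j.castSucc) = lor (T.roots i.castSucc) (T.roots j.castSucc) :=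
    fun i j => hgram _ _
  obtain ⟨A, hA, hAc⟩ := exists_matrix_of_gram hnd hcd
  have h4 : A *ᵥ mirrors n₁ n₂ n₃ v f a b (Fin.last 4) = T.roots (Fin.last 4) :=
    apply_eq_of_gram hnd hcd hA hAc fun i => hgram _ _
  have hall : ∀ i, A *ᵥ mirrors n₁ n₂ n₃ v f a b i = T.roots i :=
    fun i => Fin.lastCases h4 hAc i
  have hL : A ∈ lorentz := by
    -- The first two mirrors have product -1, so their sum is null. It is future-directed, as is its
    -- image in the explicit coordinates, which settles the orientation of time.
    refine mem_lorentz_of_null hA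
      (z := mirrors n₁ n₂ n₃ v f a b 0 + mirrors n₁ n₂ n₃ v f a b 1) ?_ ?_ ?_
    · simp only [map_add, LinearMap.add_apply, h.lor_mirrors hp hq]
      simp [chainGram]
    · have := h.a_pos
      simp [mirrors, aff, planeVec]
      positivity
    · rw [Matrix.mulVec_add, hall, hall]
      have hc := cos_pi_div_ge_half T.three_le_p
      unfold Solid.roots
      split_ifs <;> simp
      linarith
  obtain ⟨β, rfl⟩ := exists_rho_eq hL
  exact ⟨β, hall⟩

theorem act_illum (h : Chain s₁ s₂ s₃ σ n₁ n₂ n₃ t v f a b) {α : Mob} {x : G → Vec4}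
    (hx : ∀ w, rho α *ᵥ (a⁻¹ • aff (σ w v)) = x w) :
    act α (illum '' orb σ v) = Set.range fun w => posSide (x w) := by
  have e : illum '' orb σ v = Set.range fun w => posSide (a⁻¹ • aff (σ w v)) := by
    rw [orb, ← Set.range_comp]
    congr 1
    funext w
    rw [posSide_smul (inv_pos.2 h.a_pos), ← illum_eq]
    rfl
  rw [e, act, ← Set.range_comp]
  congr 1
  funext w
  rw [← hx, ← image_posSide]
  rfl

end Chain

theorem conj_reflMob {μ : Mob} {x y : Vec4} (hx : lor x x = 1) (hy : lor y y = 1)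
    (h : rho μ *ᵥ x = y) : μ * reflMob x hx * μ⁻¹ = reflMob y hy := by
  subst h
  exact (reflMob_mulVec μ hx hy).symm

theorem Solid.coxeterMatrix_le (T : Solid) (i j : Fin 5) : T.coxeterMatrix i j ≤ 5 := by
  cases T <;> fin_cases i <;> fin_cases j <;> simp [Solid.coxeterMatrix, Solid.p, Solid.q]

/-- The reflection representation of the Coxeter group of a Platonic solid in the Möbius group. -/
def Solid.toMob (T : Solid) : T.coxeterMatrix.Group →* Mob := T.rootFamily.toMob T.coxeterMatrix_le

/-- The super symmetrized Apollonian group is conjugate to the group generated by the five standard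
reflections. -/
theorem exists_superSym_eq {T : Solid} {P : Set E3} (hT : CombEquiv P T.body)
    {𝓑 : Set (Set Rhat)} (h𝓑 : IsPolytopalPacking 𝓑 P) :
    ∃ ν : Mob, superSym 𝓑 = ((MulAut.conj ν⁻¹).toMonoidHom.comp T.toMob).range := by
  obtain ⟨G, _, _, s₁, s₂, s₃, σ, n₁, n₂, n₃, t, v, f, a, b, r, h, hp, hq, hr, hV, hcp, hcq⟩ :=
    T.isChainOrbit
  obtain ⟨hP, hE, μ, hμ⟩ := h𝓑
  rw [Solid.body, hV] at hT
  obtain ⟨ι⟩ := hT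
  obtain ⟨x, y, hxy, hPx⟩ := h.exists_family hr hP.isPolytope hE ι.symm
  obtain ⟨A, hA, hAx⟩ := h.isFamily.exists_lorentz hxy h.flag h.gen hp hq T.p_eq_three_or
  obtain ⟨α, rfl⟩ := exists_rho_eq hA
  obtain ⟨β, hβ⟩ := h.exists_rho_mirrors T hcp hcq
  have h1 : 𝓑 = act (μ⁻¹ * α) (illum '' orb σ v) := by
    rw [act_mul, h.act_illum fun w => (hAx w).1, ← hPx, ← hμ, act_inv_act]
  have h2 : h.reflGroup = T.toMob.range.map (MulAut.conj β⁻¹).toMonoidHom := by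
    rw [Solid.toMob, RootFamily.range_toMob, MonoidHom.map_closure, ← Set.range_comp,
      Chain.reflGroup]
    congr 2
    funext i
    have := conj_reflMob (h.lor_mirrors_self i) (T.rootFamily.unit i) (hβ i)
    simp only [Function.comp_apply, MulEquiv.toMonoidHom_eq_coe, MonoidHom.coe_coe,
      MulAut.conj_apply, ← this]
    group
  -- First back from the packing to the regular model, then from its mirrors to the standard roots.
  refine ⟨β * (μ⁻¹ * α)⁻¹, ?_⟩
  rw [h1, superSym_act, h.superSym_eq, h2, Subgroup.map_map, MonoidHom.range_eq_map,
    Subgroup.map_map, ← MonoidHom.range_eq_map]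
  congr 1

end PlatonicPacking

end

/-! ### Assembly of the theorem -/

open PlatonicPacking in
theorem theorem3p2 (T : Solid) (P : Set E3) (hT : CombEquiv P T.body)
    (𝓑 : Set (Set Rhat)) (h𝓑 : IsPolytopalPacking 𝓑 P) :
    -- the matrix representation of the Möbius group determined by the matrices of inversions
    ∃ ρ : Mob →* Mat4, Function.Injective ρ ∧ (∀ μ, ρ μ ∈ lorentz) ∧
      (∀ D : Disk, ρ D.inv = reflMat D.vec) ∧
      -- the group is discrete
      DiscreteTopology (ρ '' (superSym 𝓑 : Set Mob)) ∧
      -- a Möbius change of coordinates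
      ∃ ν : Mob,
        -- the five matrices generate the group (they are involutions)
        (fun g : Mob => ρ (ν * g * ν⁻¹)) '' (superSym 𝓑 : Set Mob) =
          (Submonoid.closure (Set.range T.gens) : Set Mat4) ∧
        -- and they are the simple reflections of a Coxeter system with the given diagram
        ∃ cs : CoxeterSystem T.coxeterMatrix (superSym 𝓑),
          ∀ i, ρ (ν * (cs.simple i : Mob) * ν⁻¹) = T.gens i := by
  obtain ⟨ν, hν⟩ := exists_superSym_eq hT h𝓑
  have hα := T.rootFamily
  have h5 := T.coxeterMatrix_le
  have hinj : Function.Injective ((MulAut.conj ν⁻¹).toMonoidHom.comp T.toMob) :=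
    (MulAut.conj ν⁻¹).injective.comp (hα.toMob_injective h5 T.lor_chamberVec_pos)
  have hval : ∀ w, (MulAut.conj ν⁻¹).toMonoidHom.comp T.toMob w = ν⁻¹ * T.toMob w * ν := by
    intro w
    simp
  refine ⟨rho, rho_injective, rho_mem_lorentz, rho_inv_disk, ?_, ν, ?_, ?_⟩
  · rw [hν, MonoidHom.coe_range, ← Set.range_comp]
    exact hα.discreteTopology h5 T.lor_chamberVec_pos ν
  · rw [hν, MonoidHom.coe_range, ← Set.range_comp]
    have e : ((fun g : Mob => rho (ν * g * ν⁻¹)) ∘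
        ⇑((MulAut.conj ν⁻¹).toMonoidHom.comp T.toMob)) = fun w => rho (T.toMob w) := by
      funext w
      simp only [Function.comp_apply, hval]
      congr 1
      group
    rw [e]
    refine (hα.range_rho_toMob h5).trans ?_
    congr 3
    exact funext T.reflMat_roots
  · refine ⟨⟨(MulEquiv.subgroupCongr hν).trans (MonoidHom.ofInjective hinj).symm⟩, ?_⟩
    intro i
    have e : ∀ i, (((CoxeterSystem.mk ((MulEquiv.subgroupCongr hν).trans
        (MonoidHom.ofInjective hinj).symm)).simple i : superSym 𝓑) : Mob) =
        ν⁻¹ * T.toMob (T.coxeterMatrix.toCoxeterSystem.simple i) * ν := fun i => hval _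
    rw [e, ← T.reflMat_roots, ← rho_reflMob _ (hα.unit i), ← hα.toMob_simple h5]
    congr 1
    change ν * (ν⁻¹ * T.toMob _ * ν) * ν⁻¹ = T.toMob _
    group
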